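/- Identify $\mathbb R^2$ with $\mathbb C$. Consider a classical solution on $[0,T)$ of the two-dimensional incompressible, irrotational Euler--Poisson system with free boundary $$\mathbf v_t+(\mathbf v\cdot\nabla)\mathbf v=-\nabla P-\nabla\phi,\quad \operatorname{div}\mathbf v=0,\quad \operatorname{curl}\mathbf v=0\ \text{ in }\Omega(t),\qquad P=0\ \text{ on }\partial\Omega(t),$$ where $\nabla\phi(x)=\iint_{\Omega(t)}\frac{x-y}{|x-y|^2}\,dy$. Here $\Omega(t)$ is a bounded simply connected domain, $\mathbf v$ (in space-time) and $P(t,\cdot)$ (in space) are $C^1$ up to the boundary, and $z(t,\alpha)$ is a $2\pi$-periodic, counterclockwise, Lagrangian parametrization of $\partial\Omega(t)$ (that is, $z_t(t,\alpha)=\mathbf v(t,z(t,\alpha))$), which is $C^1$ in $(t,\alpha)$ and, for each $t$, is simple and regular ($z_\alpha\neq0$) and $C^2$ in $\alpha$. Let $\mathbf n=-iz_\alpha/|z_\alpha|$ be the unit exterior normal and $a:=-\frac1{|z_\alpha|}\frac{\partial P}{\partial\mathbf n}$. (i) Let $t\in[0,T)$, let $x_0\in\Omega(t)$, and let $\Phi:\Omega(t)\to\mathbb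 D$ be the Riemann mapping with $\Phi(x_0)=0$, $\Phi_z(x_0)>0$, extended continuously to $\partial\Omega(t)$. Let $h:\mathbb R\to\mathbb R$ be the corresponding change of coordinates, $e^{ih(\alpha)}=\Phi(z(t,\alpha))$, a $C^1$ diffeomorphism with $h_\alpha>0$ and $h(\alpha+2\pi)=h(\alpha)+2\pi$. Put $Z:=z(t,\cdot)\circ h^{-1}$, $Z_t:=z_t(t,\cdot)\circ h^{-1}$, $\mathcal A:=(a\,h_\alpha)\circ h^{-1}$, $\mathcal A_1:=\mathcal A\,|Z_{,\alpha'}|^2$ (where $_{,\alpha'}$ denotes $\partial_{\alpha'}$ and $\overline Z_{t,\alpha'}=\partial_{\alpha'}\overline{Z_t}$), and $$\widetilde{\mathbb H}f(\alpha'):=\frac{\mathrm{p.v.}}{2\pi i}\int_0^{2\pi}f(\beta')\cot\Big(\frac{\beta'-\alpha'}2\Big)d\beta',\qquad [g,\widetilde{\mathbb H}]f:=g\,\widetilde{\mathbb H}f-\widetilde{\mathbb H}(gf).$$ Then $Z$ and $Z_t$ are $C^1$, and for every $\alpha'\in\mathbb R$ all the principal values and integrals below converge and $$\begin{aligned}\mathcal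 A_1(\alpha')&=\operatorname{Im}[Z_t,\widetilde{\mathbb H}]\overline Z_{t,\alpha'}+\pi\operatorname{Im}[\overline Z,\widetilde{\mathbb H}]Z_{,\alpha'}\\&=\frac18\int_0^{2\pi}|Z(\beta')-Z(\alpha')|^2\csc^2\Big(\frac{\beta'-\alpha'}2\Big)d\beta'+\frac1{8\pi}\int_0^{2\pi}|Z_t(\beta')-Z_t(\alpha')|^2\csc^2\Big(\frac{\beta'-\alpha'}2\Big)d\beta'>0,\end{aligned}$$ where the first integral is positive and the second is nonnegative. (ii) The Taylor sign condition always holds: for every $t\in[0,T)$ and every $\alpha\in\mathbb R$, $a(t,\alpha)>0$, that is, $\frac{\partial P}{\partial\mathbf n}(t,z(t,\alpha))<0$. -/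

import Mathlib

open Set Filter Topology MeasureTheory
open scoped Real ComplexConjugate

noncomputable section

namespace EulerPoisson

/-! Points and vectors of the plane are complex numbers, `x + i y`. -/

/-- The divergence of a planar vector field. -/
def divergence (w : ℂ → ℂ) (x : ℂ) : ℝ :=
  (fderiv ℝ w x 1).re + (fderiv ℝ w x Complex.I).im

/-- The scalar curl of a planar vector field. -/
def curl (w : ℂ → ℂ) (x : ℂ) : ℝ :=
  (fderiv ℝ w x 1).im - (fderiv ℝ w x Complex.I).re

/-- The gradient `∇φ` of the self-gravity Newtonian potential of `U`
(for which `Δφ = 2π` in `U` and `Δφ = 0` outside), as an area integral. -/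
def gradPotential (U : Set ℂ) (x : ℂ) : ℂ :=
  ∫ y in U, (x - y) / ((‖x - y‖ ^ 2 : ℝ) : ℂ)

/-- The winding number about `w` of the `2π`-periodic closed curve `γ`. -/
def windingNumber (γ : ℝ → ℂ) (w : ℂ) : ℂ :=
  (2 * π * Complex.I)⁻¹ * ∫ α in (0 : ℝ)..(2 * π), deriv γ α / (γ α - w)

/-- `γ` is a `2π`-periodic, regular, simple, counterclockwise `C²` parametrization of the
boundary of the bounded simply connected domain `U`. -/
structure IsBoundaryParam (U : Set ℂ) (γ : ℝ → ℂ) : Prop where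
  isOpen : IsOpen U
  isBounded : Bornology.IsBounded U
  simplyConnected : IsSimplyConnected U
  contDiff : ContDiff ℝ 2 γ
  periodic : Function.Periodic γ (2 * π)
  regular : ∀ α, deriv γ α ≠ 0
  injOn : InjOn γ (Ico 0 (2 * π))
  range_eq : range γ = frontier U
  winding_inside : ∀ w ∈ U, windingNumber γ w = 1
  winding_outside : ∀ w ∉ closure U, windingNumber γ w = 0

/-- A classical solution on the time interval `[0, T)` of the incompressible irrotational
Euler-Poisson system with free boundary: fluid domains `Ω t`, velocity `v` and pressure `P`, both
`C¹` up to the boundary, and a Lagrangian parametrization `z` of the boundary. Only the values of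
`v t` and `P t` on the closure of `Ω t` matter. -/
structure IsSolution (T : ℝ) (Ω : ℝ → Set ℂ) (v : ℝ → ℂ → ℂ) (P : ℝ → ℂ → ℝ)
    (z : ℝ → ℝ → ℂ) : Prop where
  boundary : ∀ t ∈ Ico 0 T, IsBoundaryParam (Ω t) (z t)
  contDiffOn_z : ContDiffOn ℝ 1 (fun p : ℝ × ℝ => z p.1 p.2) (Ico 0 T ×ˢ univ)
  contDiffOn_v : ContDiffOn ℝ 1 (fun p : ℝ × ℂ => v p.1 p.2)
    {p : ℝ × ℂ | p.1 ∈ Ico 0 T ∧ p.2 ∈ closure (Ω p.1)}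
  contDiffOn_P : ∀ t ∈ Ico 0 T, ContDiffOn ℝ 1 (P t) (closure (Ω t))
  /-- `v_t + (v · ∇) v = - ∇P - ∇φ` in the fluid domain -/
  momentum : ∀ t ∈ Ico 0 T, ∀ x ∈ Ω t,
    derivWithin (fun s => v s x) (Ico 0 T) t + fderiv ℝ (v t) x (v t x)
      = - gradient (P t) x - gradPotential (Ω t) x
  div_eq_zero : ∀ t ∈ Ico 0 T, ∀ x ∈ Ω t, divergence (v t) x = 0
  curl_eq_zero : ∀ t ∈ Ico 0 T, ∀ x ∈ Ω t, curl (v t) x = 0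
  pressure_boundary : ∀ t ∈ Ico 0 T, ∀ x ∈ frontier (Ω t), P t x = 0
  /-- the boundary moves with the fluid: `z_t = v (t, z)` -/
  lagrangian : ∀ t ∈ Ico 0 T, ∀ α,
    derivWithin (fun s => z s α) (Ico 0 T) t = v t (z t α)

/-- The derivative `∂p/∂n` at the boundary point `γ α` of a function `p` that is `C¹` on the closure
of `U`; the unit exterior normal of the counterclockwise curve `γ` is `n = -i γ' / |γ'|`. -/
def normalDeriv (U : Set ℂ) (p : ℂ → ℝ) (γ : ℝ → ℂ) (α : ℝ) : ℝ :=
  fderivWithin ℝ p (closure U) (γ α) (-Complex.I * deriv γ α / (‖deriv γ α‖ : ℂ))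

/-- The coefficient `a = -(1/|γ'|) ∂p/∂n`. -/
def taylorCoeff (U : Set ℂ) (p : ℂ → ℝ) (γ : ℝ → ℂ) (α : ℝ) : ℝ :=
  -(1 / ‖deriv γ α‖) * normalDeriv U p γ α

/-- `Φ` is the Riemann mapping of `U` onto the unit disc with `Φ x₀ = 0`, `Φ' x₀ > 0` (together with
its continuous boundary values), and `h` is the change of the boundary parameter given by
`e^{i h(α)} = Φ (γ α)`, an orientation preserving `C¹` diffeomorphism of the circle `ℝ / 2πℤ`
(lifted to `ℝ`). -/
structure IsRiemannCoordinate (U : Set ℂ) (γ : ℝ → ℂ) (x₀ : ℂ) (Φ : ℂ → ℂ) (h : ℝ ≃ₜ ℝ) :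
    Prop where
  mem : x₀ ∈ U
  continuousOn : ContinuousOn Φ (closure U)
  differentiableOn : DifferentiableOn ℂ Φ U
  bijOn : BijOn Φ U (Metric.ball 0 1)
  map_base : Φ x₀ = 0
  deriv_re : 0 < (deriv Φ x₀).re
  deriv_im : (deriv Φ x₀).im = 0
  exp_eq : ∀ α, Complex.exp (Complex.I * (h α : ℂ)) = Φ (γ α)
  map_add : ∀ α, h (α + 2 * π) = h α + 2 * π
  contDiff : ContDiff ℝ 1 h
  deriv_pos : ∀ α, 0 < deriv h α

/-- The truncations defining the principal value integral
`(1/(2πi)) p.v. ∫_0^{2π} f(β) cot((β - α)/2) dβ` of a `2π`-periodic function `f`: by periodicity,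
the integral over a period minus the `ε`-neighbourhood of `α` is taken over
`[α + ε, α + 2π - ε]`. -/
def truncHilbert (f : ℝ → ℂ) (α ε : ℝ) : ℂ :=
  (2 * π * Complex.I)⁻¹ *
    ∫ β in (α + ε)..(α + 2 * π - ε), f β * (Real.cot ((β - α) / 2) : ℂ)

/-- The principal value that defines `H̃ f` at `α` converges. -/
def HilbertConverges (f : ℝ → ℂ) (α : ℝ) : Prop :=
  ∃ l : ℂ, Tendsto (truncHilbert f α) (𝓝[>] 0) (𝓝 l)

/-- The operator `H̃` on `2π`-periodic functions. -/
def hilbert (f : ℝ → ℂ) (α : ℝ) : ℂ :=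
  limUnder (𝓝[>] (0 : ℝ)) (truncHilbert f α)

/-- The commutator `[g, H̃] f = g H̃ f - H̃ (g f)`. -/
def hilbertComm (g f : ℝ → ℂ) (α : ℝ) : ℂ :=
  g α * hilbert f α - hilbert (fun β => g β * f β) α

/-- The integrand `|f(β) - f(α)|² csc²((β - α)/2)`. -/
def cscKernel (f : ℝ → ℂ) (α β : ℝ) : ℝ :=
  ‖f β - f α‖ ^ 2 * (1 / Real.sin ((β - α) / 2)) ^ 2

end EulerPoisson

end

open EulerPoisson

/-! ### Schwarz and Poisson kernels on the unit circle, and their reproducing formulas. -/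

namespace EulerPoisson

/-! Incompressibility and irrotationality say that `F = conj v` is holomorphic, and so is `conj
v_t`, as a locally uniform limit of difference quotients of `F` in time. The gravity field satisfies
`conj ∇φ = π conj x + (holomorphic)` inside the fluid, because the Cauchy transform of a disc is
explicit and the rest of the mass acts holomorphically. Inserting this in the momentum equation
shows that, for all constants `a` and `b`, `P + |F - a|²/2 + (π/2)|x - b|²` is locally the real part
of a holomorphic function (`IsSolution.exists_re_eq`). This is the fact behind both parts.

For (i), pull this harmonic function back to the disc by the inverse Riemann map `Ψ`, with `a` and
`b` the values of `F` and `x` at the chosen boundary point `Ψ(e^{iθ})`. Since `P = 0` on the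
boundary, the boundary values are `|Z_t(θ+β) - Z_t(θ)|²/2 + (π/2)|Z(θ+β) - Z(θ)|²`, which vanish to
second order at `β = 0`. Dividing the Poisson integral at radius `r` by `1 - r` and letting `r → 1`
gives the two `csc²` integrals by dominated convergence. On the other side the squares are `o(1 -
r)`, because holomorphic functions with `C¹` boundary values have radial derivatives, so only the
derivative of `P` in the direction `i Z'` survives, and that is `𝒜₁`
(`IsSolution.fderivWithin_eq_integral`, `taylorCoeff_mul_eq`). The commutators equal the same
integrals by integration by parts against `cot` (`hilbertComm_deriv_conj`). The densities in the
principal values are only continuous, so convergence is not automatic: it follows by comparing the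
truncation at `ε` with the Schwarz integral at radius `1 - ε`, which has a radial limit because the
density is the derivative of holomorphic boundary values (`hilbertConverges_of_tendsto`).

Part (ii) is proved without a Riemann map, so that no `C¹` boundary regularity of that map has to be
established. It is a Hopf boundary lemma. Even after adding `κ|x - c|²` with `κ < π/2`, the pressure
has no interior local minimum, so `P ≥ 0`, and on a disc inside the fluid `P` dominates a
paraboloid. A disc in the fluid touching the boundary at the given point then bounds the normal
derivative away from zero. Such a disc exists because the curve is `C²`, with the correct side
identified by the unit jump of the winding number across the curve
(`IsBoundaryParam.exists_interior_ball`). -/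

/-- The point `e^{iβ}` of the unit circle. -/
noncomputable def cis (β : ℝ) : ℂ := Complex.exp (β * Complex.I)

lemma cis_add (a b : ℝ) : cis (a + b) = cis a * cis b := by
  simp only [cis, ← Complex.exp_add]; push_cast; ring_nf

@[simp] lemma norm_cis (β : ℝ) : ‖cis β‖ = 1 := Complex.norm_exp_ofReal_mul_I β

@[simp] lemma cis_zero : cis 0 = 1 := by simp [cis]

lemma cis_ne_zero (β : ℝ) : cis β ≠ 0 := Complex.exp_ne_zero _

lemma hasDerivAt_cis (β : ℝ) : HasDerivAt cis (Complex.I * cis β) β := by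
  have h := ((hasDerivAt_id β).ofReal_comp.mul_const Complex.I).cexp
  rw [show cis = fun x : ℝ => Complex.exp (x * Complex.I) from rfl]
  simpa [mul_comm] using h

@[fun_prop] lemma continuous_cis : Continuous cis := by unfold cis; fun_prop

lemma cis_periodic : Function.Periodic cis (2 * π) := by
  intro β
  simp only [cis]; push_cast
  rw [add_mul, Complex.exp_periodic]

lemma circleMap_eq_cis (β : ℝ) : circleMap 0 1 β = cis β := by simp [circleMap, cis]

lemma norm_cis_sub_one (β : ℝ) : ‖cis β - 1‖ = 2 * |Real.sin (β / 2)| := by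
  have := Complex.norm_exp_I_mul_ofReal_sub_one β
  rw [cis, mul_comm, this]; simp

lemma one_sub_le_norm_cis_sub {r : ℝ} (h0 : 0 ≤ r) (β : ℝ) : 1 - r ≤ ‖cis β - r‖ := by
  have h := norm_sub_norm_le (cis β) (r : ℂ)
  simp [abs_of_nonneg h0] at h; linarith

/-- The radial gap `1 - r` is itself at most `‖cis β - r‖`, so moving the pole from `r` to `1` costs
only a factor of two. This makes all later bounds uniform as `r → 1`. -/
lemma norm_cis_sub_one_le {r : ℝ} (h0 : 0 ≤ r) (hr : r ≤ 1) (β : ℝ) : ‖cis β - 1‖ ≤ 2 * ‖cis β - r‖ := by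
  have h := one_sub_le_norm_cis_sub h0 β
  have h2 : ‖cis β - 1‖ ≤ ‖cis β - r‖ + ‖(r : ℂ) - 1‖ := by
    have := norm_add_le (cis β - r) ((r : ℂ) - 1)
    simpa using this
  have h3 : ‖(r : ℂ) - 1‖ = 1 - r := by
    rw [← Complex.ofReal_one, ← Complex.ofReal_sub, Complex.norm_real, Real.norm_eq_abs,
      abs_of_nonpos (by linarith)]; ring
  linarith

lemma norm_cis_sub_pos {r : ℝ} (h0 : 0 ≤ r) (hr : r < 1) (β : ℝ) : 0 < ‖cis β - r‖ :=
  lt_of_lt_of_le (by linarith) (one_sub_le_norm_cis_sub h0 β)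

lemma cis_sub_ne_zero {r : ℝ} (h0 : 0 ≤ r) (hr : r < 1) (β : ℝ) : cis β - r ≠ 0 :=
  norm_pos_iff.1 (norm_cis_sub_pos h0 hr β)

/-- The Schwarz kernel at the radius `r`. -/
noncomputable def schwarzKernel (r β : ℝ) : ℂ := (cis β + r) / (cis β - r)

/-- The Poisson kernel at the radius `r`. -/
noncomputable def diskPoisson (r β : ℝ) : ℝ := (1 - r ^ 2) / ‖cis β - r‖ ^ 2

lemma schwarzKernel_re (r β : ℝ) : (schwarzKernel r β).re = diskPoisson r β := by
  have h := congrFun (poissonKernel_eq_re_herglotzRieszKernel (c := 0) (w := (r : ℂ))) (cis β)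
  simp only [poissonKernel_def, Function.comp_apply, herglotzRieszKernel_def] at h
  simp only [schwarzKernel, diskPoisson]
  simp at h
  rw [h]

lemma continuous_schwarzKernel {r : ℝ} (h0 : 0 ≤ r) (hr : r < 1) : Continuous (schwarzKernel r) := by
  unfold schwarzKernel
  exact Continuous.div (by fun_prop) (by fun_prop) (cis_sub_ne_zero h0 hr)

lemma continuous_diskPoisson {r : ℝ} (h0 : 0 ≤ r) (hr : r < 1) : Continuous (diskPoisson r) := by
  have : diskPoisson r = fun β => (schwarzKernel r β).re := by
    ext β; rw [schwarzKernel_re]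
  rw [this]
  exact Complex.continuous_re.comp (continuous_schwarzKernel h0 hr)

lemma diskPoisson_periodic (r : ℝ) : Function.Periodic (diskPoisson r) (2 * π) := by
  intro β; simp [diskPoisson, cis_periodic β]

lemma diskPoisson_nonneg {r : ℝ} (h0 : 0 ≤ r) (hr : r < 1) (β : ℝ) : 0 ≤ diskPoisson r β :=
  div_nonneg (by nlinarith) (by positivity)

lemma mul_cis_mem_ball {r : ℝ} (h0 : 0 ≤ r) (hr : r < 1) (θ : ℝ) :
    (r : ℂ) * cis θ ∈ Metric.ball (0 : ℂ) 1 := by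
  simp [abs_of_nonneg h0, hr]

lemma diffContOnCl_rotate {ψ : ℂ → ℂ} (hψ : DiffContOnCl ℂ ψ (Metric.ball 0 1)) (θ : ℝ) :
    DiffContOnCl ℂ (fun ζ => ψ (cis θ * ζ)) (Metric.ball 0 1) := by
  refine hψ.comp (DifferentiableOn.diffContOnCl (by fun_prop)) ?_
  intro ζ hζ
  simpa using hζ

/-- The Schwarz integral formula. -/
lemma integral_mul_schwarzKernel {ψ : ℂ → ℂ} (hψ : DiffContOnCl ℂ ψ (Metric.ball 0 1)) {r : ℝ}
    (h0 : 0 ≤ r) (hr : r < 1) (θ : ℝ) :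
    ∫ β in (0 : ℝ)..(2 * π), ψ (cis (θ + β)) * schwarzKernel r β
      = 2 * π * (2 * ψ (r * cis θ) - ψ 0) := by
  have hφ := diffContOnCl_rotate hψ θ
  have hmem : (r : ℂ) ∈ Metric.ball (0 : ℂ) |(1 : ℝ)| := by simp [abs_of_nonneg h0, hr]
  have h1 := DiffContOnCl.circleAverage_smul_div (c := 0) (R := 1) (by simpa using hφ) hmem
  have h2 := DiffContOnCl.circleAverage (c := 0) (R := 1) (by simpa using hφ)
  simp only [Real.circleAverage, circleMap_eq_cis, sub_zero, smul_eq_mul, mul_zero] at h1 h2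
  have hcont : Continuous fun β => ψ (cis θ * cis β) := by
    have := hφ.continuousOn_ball
    exact this.comp_continuous continuous_cis (by simp)
  -- The Schwarz kernel is twice the Cauchy kernel minus one, so the formula is Cauchy's formula
  -- combined with the mean value property.
  have key : ∀ β, ψ (cis (θ + β)) * schwarzKernel r β
      = 2 * (cis β / (cis β - r) * ψ (cis θ * cis β)) - ψ (cis θ * cis β) := by
    intro β
    have := cis_sub_ne_zero h0 hr β
    rw [schwarzKernel, cis_add]
    field_simp
    ring
  simp_rw [key]
  rw [intervalIntegral.integral_sub, intervalIntegral.integral_const_mul]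
  · have hpi : (2 * π : ℂ) ≠ 0 := by simp [Real.pi_ne_zero]
    have e1 : ∫ β in (0 : ℝ)..(2 * π), cis β / (cis β - r) * ψ (cis θ * cis β)
        = 2 * π * ψ (cis θ * r) := by
      rw [← h1, Complex.real_smul]; push_cast; rw [mul_inv_cancel_left₀ hpi]
    have e2 : ∫ β in (0 : ℝ)..(2 * π), ψ (cis θ * cis β) = 2 * π * ψ 0 := by
      rw [← h2, Complex.real_smul]; push_cast; rw [mul_inv_cancel_left₀ hpi]
    rw [e1, e2, mul_comm (cis θ)]; ring
  · refine Continuous.intervalIntegrable ?_ _ _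
    exact continuous_const.mul ((continuous_cis.div (by fun_prop) (cis_sub_ne_zero h0 hr)).mul hcont)
  · exact hcont.intervalIntegrable _ _

/-- The Poisson integral formula for holomorphic functions. -/
lemma integral_diskPoisson_mul {ψ : ℂ → ℂ} (hψ : DiffContOnCl ℂ ψ (Metric.ball 0 1)) {r : ℝ}
    (h0 : 0 ≤ r) (hr : r < 1) (θ : ℝ) :
    ∫ β in (0 : ℝ)..(2 * π), (diskPoisson r β : ℂ) * ψ (cis (θ + β)) = 2 * π * ψ (r * cis θ) := by
  have hφ := diffContOnCl_rotate hψ θ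
  have h1 := hφ.circleAverage_re_herglotzRieszKernel_smul' (w := (r : ℂ))
    (by simp [abs_of_nonneg h0, hr])
  have hpi : (2 * π : ℂ) ≠ 0 := by simp [Real.pi_ne_zero]
  simp only [Real.circleAverage, circleMap_eq_cis, sub_zero] at h1
  rw [mul_comm (r : ℂ), ← h1, Complex.real_smul]
  push_cast
  rw [mul_inv_cancel_left₀ hpi]
  congr 1; ext β
  rw [← schwarzKernel_re, schwarzKernel, cis_add, Complex.real_smul]

/-- The Poisson integral formula for harmonic functions. -/
lemma integral_diskPoisson_mul_of_harmonic {u : ℂ → ℝ}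
    (hu : InnerProductSpace.HarmonicContOnCl u (Metric.ball 0 1)) {r : ℝ}
    (h0 : 0 ≤ r) (hr : r < 1) (θ : ℝ) :
    ∫ β in (0 : ℝ)..(2 * π), diskPoisson r β * u (cis (θ + β)) = 2 * π * u (r * cis θ) := by
  have h1 := hu.circleAverage_re_herglotzRieszKernel_smul (mul_cis_mem_ball h0 hr θ)
  have hpi : (2 * π : ℝ) ≠ 0 := by positivity
  simp only [Real.circleAverage, circleMap_eq_cis] at h1
  rw [← h1, smul_eq_mul, mul_inv_cancel_left₀ hpi]
  have hper : Function.Periodic (fun β : ℝ =>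
      (Complex.re ∘ herglotzRieszKernel 0 (r * cis θ) • u) (cis β)) (2 * π) := by
    intro β; simp only [cis_periodic β]
  have h2 := hper.intervalIntegral_add_eq 0 θ
  rw [zero_add] at h2
  have h3 := intervalIntegral.integral_comp_add_left (fun β : ℝ =>
      (Complex.re ∘ herglotzRieszKernel 0 (r * cis θ) • u) (cis β)) (a := 0) (b := 2 * π) θ
  rw [add_zero] at h3
  rw [h2, ← h3]
  congr 1; ext β
  simp only [Pi.smul_apply', Function.comp_apply, herglotzRieszKernel_def, sub_zero, smul_eq_mul]
  congr 1
  rw [← schwarzKernel_re, schwarzKernel, cis_add, mul_comm (r : ℂ), ← mul_add, ← mul_sub,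
    mul_div_mul_left _ _ (cis_ne_zero θ)]

lemma integral_diskPoisson {r : ℝ} (h0 : 0 ≤ r) (hr : r < 1) :
    ∫ β in (0 : ℝ)..(2 * π), diskPoisson r β = 2 * π := by
  have := integral_diskPoisson_mul (ψ := fun _ => 1) diffContOnCl_const h0 hr 0
  simp only [mul_one] at this
  rw [intervalIntegral.integral_ofReal] at this
  exact_mod_cast this

lemma integral_schwarzKernel {r : ℝ} (h0 : 0 ≤ r) (hr : r < 1) :
    ∫ β in (0 : ℝ)..(2 * π), schwarzKernel r β = 2 * π := by
  have := integral_mul_schwarzKernel (ψ := fun _ => 1) diffContOnCl_const h0 hr 0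
  simp only [one_mul] at this
  rw [this]; ring

end EulerPoisson

/-! ### Radial limits of derivatives of holomorphic functions with `C¹` boundary values. -/

namespace EulerPoisson

lemma exists_norm_le_of_periodic {f : ℝ → ℂ} (hf : Continuous f)
    (hp : Function.Periodic f (2 * π)) : ∃ C, 0 ≤ C ∧ ∀ x, ‖f x‖ ≤ C := by
  obtain ⟨C, hC⟩ := (hp.isBounded_of_continuous (by positivity) hf).exists_norm_le
  exact ⟨C, (norm_nonneg _).trans (hC (f 0) (mem_range_self _)), fun x => hC _ (mem_range_self x)⟩

lemma deriv_periodic {f : ℝ → ℂ} (hp : Function.Periodic f (2 * π)) :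
    Function.Periodic (deriv f) (2 * π) := by
  intro x
  rw [← deriv_comp_add_const]
  congr 1
  ext y; exact hp y

/-- Differentiating in the rotation angle puts the derivative on the boundary values and leaves the
kernel alone. Applied to the Schwarz and Poisson formulas it yields formulas for `ψ'` at interior
points in terms of the derivative along the circle. -/
lemma hasDerivAt_integral_translate {Y k : ℝ → ℂ} (hY : ContDiff ℝ 1 Y)
    (hp : Function.Periodic Y (2 * π)) (hk : Continuous k) (θ : ℝ) :
    HasDerivAt (fun θ => ∫ β in (0 : ℝ)..(2 * π), Y (θ + β) * k β)
      (∫ β in (0 : ℝ)..(2 * π), deriv Y (θ + β) * k β) θ := by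
  have hd : Continuous (deriv Y) := hY.continuous_deriv le_rfl
  obtain ⟨C, hC0, hC⟩ := exists_norm_le_of_periodic hd (deriv_periodic hp)
  have hYc := hY.continuous
  refine (intervalIntegral.hasDerivAt_integral_of_dominated_loc_of_deriv_le
    (F := fun θ β => Y (θ + β) * k β) (F' := fun θ β => deriv Y (θ + β) * k β)
    (bound := fun β => C * ‖k β‖) (s := univ) univ_mem
    (Eventually.of_forall fun θ => ?_) ?_ ?_ ?_ ?_ ?_).2
  · exact (Continuous.aestronglyMeasurable (by fun_prop))
  · exact Continuous.intervalIntegrable (by fun_prop) _ _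
  · exact (Continuous.aestronglyMeasurable (by fun_prop))
  · refine Eventually.of_forall fun β _ θ _ => ?_
    rw [norm_mul]
    exact mul_le_mul_of_nonneg_right (hC _) (norm_nonneg _)
  · exact Continuous.intervalIntegrable (by fun_prop) _ _
  · refine Eventually.of_forall fun β _ θ _ => ?_
    have h := (hY.differentiable one_ne_zero (θ + β)).hasDerivAt
    exact (h.comp_add_const θ β).mul_const _

lemma hasDerivAt_comp_mul_cis {ψ : ℂ → ℂ} (hψ : DifferentiableOn ℂ ψ (Metric.ball 0 1)) {r : ℝ}
    (h0 : 0 ≤ r) (hr : r < 1) (θ : ℝ) :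
    HasDerivAt (fun θ : ℝ => ψ (r * cis θ))
      (Complex.I * (r * cis θ) * deriv ψ (r * cis θ)) θ := by
  have h1 := (hψ.differentiableAt (Metric.isOpen_ball.mem_nhds
    (mul_cis_mem_ball h0 hr θ))).hasDerivAt
  have h2 := (hasDerivAt_cis θ).const_mul (r : ℂ)
  have := h1.comp θ h2
  convert! this using 1
  ring

lemma comp_cis_periodic (ψ : ℂ → ℂ) : Function.Periodic (fun β => ψ (cis β)) (2 * π) := by
  intro β; simp only [cis_periodic β]

lemma integral_deriv_mul_schwarzKernel {ψ : ℂ → ℂ} (hψ : DiffContOnCl ℂ ψ (Metric.ball 0 1))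
    (hY : ContDiff ℝ 1 fun β => ψ (cis β)) {r : ℝ} (h0 : 0 ≤ r) (hr : r < 1) (θ : ℝ) :
    ∫ β in (0 : ℝ)..(2 * π), deriv (fun β => ψ (cis β)) (θ + β) * schwarzKernel r β
      = 4 * π * (Complex.I * (r * cis θ) * deriv ψ (r * cis θ)) := by
  have h1 := hasDerivAt_integral_translate hY (comp_cis_periodic ψ)
    (continuous_schwarzKernel h0 hr) θ
  simp only [integral_mul_schwarzKernel hψ h0 hr] at h1
  have h2 := ((((hasDerivAt_comp_mul_cis hψ.differentiableOn h0 hr θ).const_mul 2).sub_const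
    (ψ 0)).const_mul (2 * π : ℂ))
  rw [h1.unique h2]; ring

lemma integral_diskPoisson_mul_deriv {ψ : ℂ → ℂ} (hψ : DiffContOnCl ℂ ψ (Metric.ball 0 1))
    (hY : ContDiff ℝ 1 fun β => ψ (cis β)) {r : ℝ} (h0 : 0 ≤ r) (hr : r < 1) (θ : ℝ) :
    ∫ β in (0 : ℝ)..(2 * π), (diskPoisson r β : ℂ) * deriv (fun β => ψ (cis β)) (θ + β)
      = 2 * π * (Complex.I * (r * cis θ) * deriv ψ (r * cis θ)) := by
  have hk : Continuous fun β => (diskPoisson r β : ℂ) :=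
    Complex.continuous_ofReal.comp (continuous_diskPoisson h0 hr)
  have h1 := hasDerivAt_integral_translate hY (comp_cis_periodic ψ) hk θ
  simp_rw [mul_comm _ (diskPoisson r _ : ℂ)] at h1
  simp only [integral_diskPoisson_mul hψ h0 hr] at h1
  have h2 := (hasDerivAt_comp_mul_cis hψ.differentiableOn h0 hr θ).const_mul (2 * π : ℂ)
  exact h1.unique h2

lemma eventually_lt_one : ∀ᶠ r : ℝ in 𝓝[<] 1, 0 < r ∧ r < 1 := by
  filter_upwards [Ioo_mem_nhdsLT (show (0 : ℝ) < 1 by norm_num)] with r hr using hr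

/-- Jordan's inequality for the sine of the half angle; it makes chord length and arc length
comparable on a period. -/
lemma abs_le_norm_cis_sub_one {β : ℝ} (h : |β| ≤ π) : 2 / π * |β| ≤ ‖cis β - 1‖ := by
  rw [norm_cis_sub_one]
  have h1 : |Real.sin (β / 2)| = Real.sin (|β| / 2) := by
    rcases le_total 0 β with hb | hb
    · rw [abs_of_nonneg hb] at *
      exact abs_of_nonneg (Real.sin_nonneg_of_nonneg_of_le_pi (by linarith) (by linarith))
    · rw [abs_of_nonpos hb] at *
      rw [neg_div, Real.sin_neg]
      exact abs_of_nonpos (Real.sin_nonpos_of_nonpos_of_neg_pi_le (by linarith) (by linarith))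
  have h2 := Real.mul_le_sin (x := |β| / 2) (by positivity) (by linarith)
  rw [h1]
  linarith

lemma integral_eq_setIntegral_Ioc_of_periodic {E : Type*} [NormedAddCommGroup E] [NormedSpace ℝ E]
    {f : ℝ → E} (hf : Function.Periodic f (2 * π)) :
    ∫ β in (0 : ℝ)..(2 * π), f β = ∫ β in Ioc (-π) π, f β := by
  have := hf.intervalIntegral_add_eq 0 (-π)
  rw [zero_add] at this
  rw [this, intervalIntegral.integral_of_le (by linarith [Real.pi_pos])]
  congr 2; ring_nf

/-- The Poisson kernel is an approximate identity. -/
lemma tendsto_integral_diskPoisson_smul {E : Type*} [NormedAddCommGroup E] [NormedSpace ℝ E]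
    [CompleteSpace E] {g : ℝ → E} (hg : Continuous g) (hp : Function.Periodic g (2 * π)) :
    Tendsto (fun r => ∫ β in (0 : ℝ)..(2 * π), diskPoisson r β • g β) (𝓝[<] 1)
      (𝓝 ((2 * π) • g 0)) := by
  have hpi := Real.pi_pos
  have key := tendsto_setIntegral_peak_smul_of_integrableOn_of_tendsto (μ := volume)
    (φ := fun r β => (2 * π)⁻¹ * diskPoisson r β) (l := 𝓝[<] (1 : ℝ)) (x₀ := (0 : ℝ))
    (s := Ioc (-π) π) (t := Ioc (-π) π) (g := g) (a := g 0) measurableSet_Ioc measurableSet_Ioc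
    subset_rfl self_mem_nhdsWithin (by simp) ?_ ?_ ?_ ?_ ?_ ?_
  · have := key.const_smul (2 * π)
    refine this.congr' ?_
    filter_upwards [eventually_lt_one] with r hr
    rw [integral_eq_setIntegral_Ioc_of_periodic, ← integral_smul]
    · congr 1; ext β
      rw [smul_smul, mul_inv_cancel_left₀ (by positivity)]
    · intro β; simp only [diskPoisson_periodic r β, hp β]
  · filter_upwards [eventually_lt_one] with r hr x _
    have := diskPoisson_nonneg hr.1.le hr.2 x
    positivity
  · intro u hu h0u
    obtain ⟨δ, hδ, hball⟩ := Metric.isOpen_iff.1 hu 0 h0u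
    rw [Metric.tendstoUniformlyOn_iff]
    intro ε hε
    have hlim : Tendsto (fun r : ℝ => (2 * π)⁻¹ * ((1 - r ^ 2) / (δ / π) ^ 2)) (𝓝[<] 1) (𝓝 0) := by
      have : Continuous fun r : ℝ => (2 * π)⁻¹ * ((1 - r ^ 2) / (δ / π) ^ 2) := by fun_prop
      have h := this.tendsto 1
      simp only [one_pow, sub_self, zero_div, mul_zero] at h
      exact h.mono_left nhdsWithin_le_nhds
    filter_upwards [eventually_lt_one, hlim.eventually (gt_mem_nhds hε)] with r hr hr2 β hβ
    have hδβ : δ ≤ |β| := by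
      by_contra hcon
      exact hβ.2 (hball (by simpa using hcon))
    have hβπ : |β| ≤ π := abs_le.2 ⟨hβ.1.1.le, hβ.1.2⟩
    have h1 := abs_le_norm_cis_sub_one hβπ
    have h2 := norm_cis_sub_one_le hr.1.le hr.2.le β
    -- Away from `β = 0` the denominator of the kernel is bounded below independently of `r`, while
    -- its numerator `1 - r²` tends to zero.
    have h3 : δ / π ≤ ‖cis β - r‖ := by
      have : 2 / π * δ ≤ 2 / π * |β| := by gcongr
      have e : 2 / π * δ = 2 * (δ / π) := by ring
      linarith
    have hP := diskPoisson_nonneg hr.1.le hr.2 β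
    rw [Pi.zero_apply, dist_zero_left, Real.norm_eq_abs, abs_of_nonneg (by positivity)]
    refine lt_of_le_of_lt ?_ hr2
    unfold diskPoisson
    have h4 : 0 ≤ 1 - r ^ 2 := by nlinarith [hr.1, hr.2]
    gcongr
  · refine tendsto_const_nhds.congr' ?_
    filter_upwards [eventually_lt_one] with r hr
    rw [integral_const_mul, ← integral_eq_setIntegral_Ioc_of_periodic (diskPoisson_periodic r),
       integral_diskPoisson hr.1.le hr.2]
    field_simp
  · filter_upwards [eventually_lt_one] with r hr
    exact (continuous_const.mul (continuous_diskPoisson hr.1.le hr.2)).aestronglyMeasurable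
  · exact (hg.integrableOn_Icc).mono_set Ioc_subset_Icc_self
  · exact hg.continuousWithinAt

/-- Radial limits of the derivative of a holomorphic function with `C¹` boundary values. -/
lemma tendsto_mul_deriv_radial {ψ : ℂ → ℂ} (hψ : DiffContOnCl ℂ ψ (Metric.ball 0 1))
    (hY : ContDiff ℝ 1 fun β => ψ (cis β)) (θ : ℝ) :
    Tendsto (fun r : ℝ => Complex.I * (r * cis θ) * deriv ψ (r * cis θ)) (𝓝[<] 1)
      (𝓝 (deriv (fun β => ψ (cis β)) θ)) := by
  have hd : Continuous (deriv fun β => ψ (cis β)) := hY.continuous_deriv le_rfl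
  have h := tendsto_integral_diskPoisson_smul (g := fun β => deriv (fun β => ψ (cis β)) (θ + β))
    (by fun_prop) (fun β => by
      beta_reduce; rw [← add_assoc]; exact deriv_periodic (comp_cis_periodic ψ) (θ + β))
  have h2 := h.const_smul (2 * π)⁻¹
  rw [smul_smul, inv_mul_cancel₀ (by positivity), one_smul, add_zero] at h2
  refine h2.congr' ?_
  filter_upwards [eventually_lt_one] with r hr
  simp only [Complex.real_smul]
  rw [integral_diskPoisson_mul_deriv hψ hY hr.1.le hr.2]
  have : (2 * π : ℂ) ≠ 0 := by simp [Real.pi_ne_zero]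
  push_cast
  rw [inv_mul_cancel_left₀ this]

/-- The radial derivative at the boundary of a holomorphic function with `C¹` boundary values. -/
lemma hasDerivWithinAt_radial {ψ : ℂ → ℂ} (hψ : DiffContOnCl ℂ ψ (Metric.ball 0 1))
    (hY : ContDiff ℝ 1 fun β => ψ (cis β)) (θ : ℝ) :
    HasDerivWithinAt (fun r : ℝ => ψ (r * cis θ))
      (-Complex.I * deriv (fun β => ψ (cis β)) θ) (Iic 1) 1 := by
  have hderiv : ∀ r ∈ Ioo (0 : ℝ) 1,
      HasDerivAt (fun r : ℝ => ψ (r * cis θ)) (deriv ψ (r * cis θ) * cis θ) r := by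
    intro r hr
    have h1 := (hψ.differentiableOn.differentiableAt (Metric.isOpen_ball.mem_nhds
      (mul_cis_mem_ball hr.1.le hr.2 θ))).hasDerivAt
    have h2 : HasDerivAt (fun r : ℝ => (r : ℂ) * cis θ) (cis θ) r := by
      simpa using (hasDerivAt_id r).ofReal_comp.mul_const (cis θ)
    exact h1.comp r h2
  -- A function continuous up to the endpoint whose derivative has a limit there is differentiable
  -- at the endpoint with that derivative.
  refine hasDerivWithinAt_Iic_of_tendsto_deriv (s := Ioo 0 1)
    (fun r hr => (hderiv r hr).differentiableAt.differentiableWithinAt) ?_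
    (Ioo_mem_nhdsLT (by norm_num)) ?_
  · have h1 := hψ.continuousOn_ball (1 * cis θ) (by simp)
    have h2 : ContinuousWithinAt (fun r : ℝ => (r : ℂ) * cis θ) (Ioo 0 1) 1 :=
      Continuous.continuousWithinAt (by fun_prop)
    refine ContinuousWithinAt.comp (t := Metric.closedBall (0 : ℂ) 1) (g := ψ) ?_ h2 ?_
    · simpa using h1
    · intro r hr
      exact Metric.ball_subset_closedBall (mul_cis_mem_ball hr.1.le hr.2 θ)
  · have h := (tendsto_mul_deriv_radial hψ hY θ).const_mul (-Complex.I)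
    have h2 : Tendsto (fun r : ℝ => (r : ℂ)⁻¹) (𝓝[<] 1) (𝓝 1) := by
      have : ContinuousAt (fun r : ℝ => (r : ℂ)⁻¹) 1 :=
        ContinuousAt.inv₀ Complex.continuous_ofReal.continuousAt (by simp)
      have h3 := this.tendsto
      simp only [Complex.ofReal_one, inv_one] at h3
      exact h3.mono_left nhdsWithin_le_nhds
    have h4 := h2.mul h
    rw [one_mul] at h4
    refine h4.congr' ?_
    filter_upwards [eventually_lt_one] with r hr
    rw [(hderiv r hr).deriv]
    have : (r : ℂ) ≠ 0 := by exact_mod_cast hr.1.ne'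
    field_simp
    rw [Complex.I_sq]; ring

end EulerPoisson

/-! ### Convergence of the principal values. -/

namespace EulerPoisson

lemma norm_cis_sub_one_le_abs (β : ℝ) : ‖cis β - 1‖ ≤ |β| := by
  rw [norm_cis_sub_one]
  have := Real.abs_sin_le_abs (x := β / 2)
  rw [abs_div, abs_two] at this
  linarith

lemma cis_sub_two_pi (β : ℝ) : cis (β - 2 * π) = cis β := cis_periodic.sub_eq β

/-- The kernel of the Hilbert transform is, up to the factor `i`, the Schwarz kernel at radius one;
this lets the truncated integrals be compared with integrals at radius `r < 1`. At zeros of the sine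
both sides vanish by the convention on division by zero. -/
lemma ofReal_cot_half (β : ℝ) : (Real.cot (β / 2) : ℂ) = Complex.I * schwarzKernel 1 β := by
  have h : cis β = cis (β / 2) * cis (β / 2) := by rw [← cis_add]; ring_nf
  have h2 : cis (β / 2) = Real.cos (β / 2) + Real.sin (β / 2) * Complex.I := by
    rw [cis, Complex.exp_mul_I]; push_cast; rfl
  have h3 : ((Real.cos (β / 2) : ℝ) : ℂ) ^ 2 + ((Real.sin (β / 2) : ℝ) : ℂ) ^ 2 = 1 := by
    exact_mod_cast Real.cos_sq_add_sin_sq (β / 2)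
  have e1 : cis β + 1 = 2 * Real.cos (β / 2) * cis (β / 2) := by
    rw [h, h2]
    linear_combination (-1 : ℂ) * h3 + (Real.sin (β / 2) : ℂ) ^ 2 * Complex.I_sq
  have e2 : cis β - 1 = 2 * Complex.I * Real.sin (β / 2) * cis (β / 2) := by
    rw [h, h2]
    linear_combination h3 - (Real.sin (β / 2) : ℂ) ^ 2 * Complex.I_sq
  rw [schwarzKernel, Complex.ofReal_one, e1, e2, Real.cot_eq_cos_div_sin]
  have hne := cis_ne_zero (β / 2)
  by_cases hs : Real.sin (β / 2) = 0
  · simp [hs]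
  · have hs' : (Real.sin (β / 2) : ℂ) ≠ 0 := by exact_mod_cast hs
    rw [Complex.ofReal_div]
    field_simp

lemma norm_cis_sub_le {ε : ℝ} (hε : 0 ≤ ε) (β : ℝ) :
    ‖cis β - (1 - ε : ℝ)‖ ≤ ‖cis β - 1‖ + ε := by
  have h : cis β - ((1 - ε : ℝ) : ℂ) = (cis β - 1) + (ε : ℂ) := by push_cast; ring
  rw [h]
  refine (norm_add_le _ _).trans ?_
  rw [Complex.norm_real, Real.norm_of_nonneg hε]

/-- In this range `‖cis β - (1 - ε)‖ ≤ 2ε`, while `1 - (1 - ε)² ≥ ε`, so the single power in the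
denominator of the Schwarz kernel can be traded for the Poisson kernel. The constant `4` would do;
`6` matches the bound of the next lemma. -/
lemma norm_schwarzKernel_le {ε : ℝ} (hε : 0 < ε) (h1 : ε < 1) {β : ℝ} (hβ : ‖cis β - 1‖ ≤ ε) :
    ‖schwarzKernel (1 - ε) β‖ ≤ 6 * diskPoisson (1 - ε) β := by
  have h0 : 0 ≤ 1 - ε := by linarith
  have hpos := norm_cis_sub_pos h0 (by linarith) β
  have hle := norm_cis_sub_le hε.le β
  have hnum : ‖cis β + (1 - ε : ℝ)‖ ≤ 2 := by
    refine (norm_add_le _ _).trans ?_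
    rw [Complex.norm_real, Real.norm_of_nonneg h0, norm_cis]; linarith
  rw [schwarzKernel, diskPoisson, norm_div, ← mul_div_assoc, div_le_div_iff₀ hpos (by positivity)]
  have : ‖cis β + (1 - ε : ℝ)‖ * ‖cis β - (1 - ε : ℝ)‖ ≤ 2 * (2 * ε) := by
    gcongr; linarith
  have h2 : ‖cis β + (1 - ε : ℝ)‖ * ‖cis β - (1 - ε : ℝ)‖ ^ 2
      ≤ 4 * ε * ‖cis β - (1 - ε : ℝ)‖ := by nlinarith
  have h3 : 4 * ε ≤ 6 * (1 - (1 - ε) ^ 2) := by nlinarith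
  exact h2.trans (by gcongr)

/-- The difference is `2ε cis β / ((cis β - 1)(cis β - r))` with `r = 1 - ε`. Here `‖cis β - r‖ ≤
3‖cis β - 1‖`, which gives `6ε / ‖cis β - r‖²`, and `ε ≤ 1 - r²`. -/
lemma norm_schwarzKernel_sub_le {ε : ℝ} (hε : 0 < ε) (h1 : ε < 1) {β : ℝ}
    (hβ : ε ≤ 2 * ‖cis β - 1‖) :
    ‖schwarzKernel 1 β - schwarzKernel (1 - ε) β‖ ≤ 6 * diskPoisson (1 - ε) β := by
  have h0 : 0 ≤ 1 - ε := by linarith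
  have hpos := norm_cis_sub_pos h0 (by linarith) β
  have hle := norm_cis_sub_le hε.le β
  have hpos1 : 0 < ‖cis β - 1‖ := by linarith
  have hne := norm_pos_iff.1 hpos
  have hne1 := norm_pos_iff.1 hpos1
  have e : schwarzKernel 1 β - schwarzKernel (1 - ε) β
      = 2 * ε * cis β / ((cis β - 1) * (cis β - (1 - ε : ℝ))) := by
    rw [schwarzKernel, schwarzKernel, Complex.ofReal_one, div_sub_div _ _ hne1 hne]
    congr 1; push_cast; ring
  rw [e, diskPoisson, norm_div, norm_mul, norm_mul, norm_mul, norm_cis, Complex.norm_real,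
    Real.norm_of_nonneg hε.le, ← mul_div_assoc, div_le_div_iff₀ (by positivity) (by positivity)]
  simp only [Complex.norm_ofNat, mul_one]
  have h3 : ‖cis β - (1 - ε : ℝ)‖ ≤ 3 * ‖cis β - 1‖ := by linarith
  set a := ‖cis β - (1 - ε : ℝ)‖
  set b := ‖cis β - 1‖
  have h4 : 2 * ε * a ^ 2 ≤ 6 * ε * (b * a) := by
    have : a * a ≤ (3 * b) * a := by gcongr
    nlinarith
  have h5 : 0 ≤ b * a := by positivity
  nlinarith [mul_nonneg h5 h0, mul_nonneg (mul_nonneg h5 h0) hε.le]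

lemma le_norm_cis_sub_one {ε β : ℝ} (h : β ∈ Icc ε (2 * π - ε)) : ε ≤ 2 * ‖cis β - 1‖ := by
  have hpi := Real.pi_pos
  have hpi4 := Real.pi_le_four
  have key : ∀ x : ℝ, |x| ≤ π → ε ≤ |x| → ε ≤ 2 * ‖cis x - 1‖ := by
    intro x hx hε
    have h1 := abs_le_norm_cis_sub_one hx
    -- The factor two suffices because `π ≤ 4`.
    have h2 : |x| ≤ 2 * (2 / π * |x|) := by
      have : 1 ≤ 4 / π := by rw [le_div_iff₀ hpi]; linarith
      calc |x| = 1 * |x| := by ring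
        _ ≤ 4 / π * |x| := by gcongr
        _ = _ := by ring
    linarith
  by_cases hb : |β| ≤ π
  · exact key β hb (h.1.trans (le_abs_self β))
  · rw [← cis_sub_two_pi]
    have h1 := h.1
    have h2 := h.2
    by_cases hβ : 0 ≤ β
    · rw [abs_of_nonneg hβ] at hb
      by_cases hβ2 : β ≤ 2 * π
      · refine key _ ?_ ?_ <;> rw [abs_of_nonpos (by linarith)] <;> linarith
      · have := norm_nonneg (cis (β - 2 * π) - 1)
        linarith
    · have := norm_nonneg (cis (β - 2 * π) - 1)
      linarith

lemma continuousOn_schwarzKernel_one {ε : ℝ} (hε : 0 < ε) :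
    ContinuousOn (schwarzKernel 1) (Icc ε (2 * π - ε)) := by
  unfold schwarzKernel
  refine ContinuousOn.div (by fun_prop) (by fun_prop) fun β hβ => ?_
  have := le_norm_cis_sub_one hβ
  rw [← norm_pos_iff, Complex.ofReal_one]
  linarith

/-- Cutting the kernel at distance `ε` and shrinking the radius to `1 - ε` are the same
regularization up to a Poisson average of `‖g‖`. That average tends to zero when `g` is continuous
with `g 0 = 0`, so no Hölder or Dini modulus is needed. -/
lemma norm_integral_schwarzKernel_sub_le {g : ℝ → ℂ} (hg : Continuous g) {ε : ℝ} (hε : 0 < ε)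
    (h1 : ε < 1) :
    ‖(∫ β in ε..(2 * π - ε), g β * schwarzKernel 1 β)
        - ∫ β in (0 : ℝ)..(2 * π), g β * schwarzKernel (1 - ε) β‖
      ≤ 6 * ∫ β in (0 : ℝ)..(2 * π), diskPoisson (1 - ε) β * ‖g β‖ := by
  have hpi := Real.pi_gt_three
  have h0 : 0 ≤ 1 - ε := by linarith
  have hlt : 1 - ε < 1 := by linarith
  have hcS := continuous_schwarzKernel h0 hlt
  have hcP := continuous_diskPoisson h0 hlt
  have hi : ∀ a b, IntervalIntegrable (fun β => g β * schwarzKernel (1 - ε) β) volume a b :=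
    fun a b => Continuous.intervalIntegrable (by fun_prop) _ _
  have hP : ∀ a b, IntervalIntegrable (fun β => 6 * (diskPoisson (1 - ε) β * ‖g β‖)) volume a b :=
    fun a b => Continuous.intervalIntegrable (by fun_prop) _ _
  have hle : ε ≤ 2 * π - ε := by linarith
  have hi1 : IntervalIntegrable (fun β => g β * schwarzKernel 1 β) volume ε (2 * π - ε) := by
    refine ContinuousOn.intervalIntegrable ?_
    rw [uIcc_of_le hle]
    exact hg.continuousOn.mul (continuousOn_schwarzKernel_one hε)
  rw [← intervalIntegral.integral_add_adjacent_intervals (hi 0 ε) (hi ε (2 * π)),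
    ← intervalIntegral.integral_add_adjacent_intervals (hi ε (2 * π - ε)) (hi (2 * π - ε) (2 * π)),
    ← intervalIntegral.integral_const_mul,
    ← intervalIntegral.integral_add_adjacent_intervals (hP 0 ε) (hP ε (2 * π)),
    ← intervalIntegral.integral_add_adjacent_intervals (hP ε (2 * π - ε)) (hP (2 * π - ε) (2 * π))]
  have b1 : ‖∫ β in (0 : ℝ)..ε, g β * schwarzKernel (1 - ε) β‖
      ≤ ∫ β in (0 : ℝ)..ε, 6 * (diskPoisson (1 - ε) β * ‖g β‖) := by
    refine intervalIntegral.norm_integral_le_of_norm_le hε.le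
      (Eventually.of_forall fun β hβ => ?_) (hP _ _)
    have := norm_schwarzKernel_le hε h1 ((norm_cis_sub_one_le_abs β).trans
      (by rw [abs_of_pos hβ.1]; exact hβ.2))
    rw [norm_mul]
    nlinarith [norm_nonneg (g β)]
  have b3 : ‖∫ β in (2 * π - ε)..(2 * π), g β * schwarzKernel (1 - ε) β‖
      ≤ ∫ β in (2 * π - ε)..(2 * π), 6 * (diskPoisson (1 - ε) β * ‖g β‖) := by
    refine intervalIntegral.norm_integral_le_of_norm_le (by linarith)
      (Eventually.of_forall fun β hβ => ?_) (hP _ _)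
    have h2 : ‖cis β - 1‖ ≤ ε := by
      rw [← cis_sub_two_pi]
      refine (norm_cis_sub_one_le_abs _).trans ?_
      have := hβ.1
      have := hβ.2
      rw [abs_of_nonpos (by linarith)]; linarith
    have := norm_schwarzKernel_le hε h1 h2
    rw [norm_mul]
    nlinarith [norm_nonneg (g β)]
  have b2 : ‖(∫ β in ε..(2 * π - ε), g β * schwarzKernel 1 β)
        - ∫ β in ε..(2 * π - ε), g β * schwarzKernel (1 - ε) β‖
      ≤ ∫ β in ε..(2 * π - ε), 6 * (diskPoisson (1 - ε) β * ‖g β‖) := by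
    rw [← intervalIntegral.integral_sub hi1 (hi _ _)]
    refine intervalIntegral.norm_integral_le_of_norm_le hle
      (Eventually.of_forall fun β hβ => ?_) (hP _ _)
    have := norm_schwarzKernel_sub_le hε h1 (le_norm_cis_sub_one (Ioc_subset_Icc_self hβ))
    rw [← mul_sub, norm_mul]
    nlinarith [norm_nonneg (g β)]
  set A := ∫ β in (0 : ℝ)..ε, g β * schwarzKernel (1 - ε) β
  set B := ∫ β in ε..(2 * π - ε), g β * schwarzKernel (1 - ε) β
  set D := ∫ β in (2 * π - ε)..(2 * π), g β * schwarzKernel (1 - ε) β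
  set X := ∫ β in ε..(2 * π - ε), g β * schwarzKernel 1 β
  have e : X - (A + (B + D)) = (X - B) - A - D := by ring
  rw [e]
  have t1 := norm_sub_le ((X - B) - A) D
  have t2 := norm_sub_le (X - B) A
  linarith

lemma truncHilbert_eq (f : ℝ → ℂ) (α ε : ℝ) : truncHilbert f α ε = (2 * π * Complex.I)⁻¹ *
    ∫ β in ε..(2 * π - ε), f (α + β) * (Real.cot (β / 2) : ℂ) := by
  have h := intervalIntegral.integral_comp_add_left
    (fun β => f β * (Real.cot ((β - α) / 2) : ℂ)) (a := ε) (b := 2 * π - ε) α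
  rw [truncHilbert, add_sub_assoc, ← h]
  simp only [add_sub_cancel_left]

/-- The cotangent is odd under `β ↦ 2π - β`, which preserves the truncated period. -/
lemma integral_cot_eq_zero (ε : ℝ) :
    ∫ β in ε..(2 * π - ε), (Real.cot (β / 2) : ℂ) = 0 := by
  have h := intervalIntegral.integral_comp_sub_left
    (fun β => (Real.cot (β / 2) : ℂ)) (a := ε) (b := 2 * π - ε) (2 * π)
  have h2 : ∀ β : ℝ, (Real.cot ((2 * π - β) / 2) : ℂ) = -(Real.cot (β / 2) : ℂ) := by
    intro β
    rw [show (2 * π - β) / 2 = π - β / 2 by ring, Real.cot_eq_cos_div_sin, Real.cos_pi_sub,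
      Real.sin_pi_sub, Real.cot_eq_cos_div_sin, neg_div, Complex.ofReal_neg]
  simp only [h2, intervalIntegral.integral_neg, sub_sub_cancel] at h
  exact CharZero.neg_eq_self_iff.1 h

lemma tendsto_one_sub_nhdsLT : Tendsto (fun ε : ℝ => 1 - ε) (𝓝[>] 0) (𝓝[<] 1) := by
  refine tendsto_nhdsWithin_iff.2 ⟨?_, ?_⟩
  · have : Tendsto (fun ε : ℝ => 1 - ε) (𝓝 0) (𝓝 (1 - 0)) := Continuous.tendsto (by fun_prop) 0
    rw [sub_zero] at this
    exact this.mono_left nhdsWithin_le_nhds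
  · filter_upwards [self_mem_nhdsWithin] with ε hε
    have : 0 < ε := hε
    simpa using this

/-- The principal value converges as soon as the Schwarz integral has a radial limit. -/
lemma hilbertConverges_of_tendsto {k : ℝ → ℂ} (hk : Continuous k)
    (hp : Function.Periodic k (2 * π)) {α : ℝ} {l : ℂ}
    (hl : Tendsto (fun r => ∫ β in (0 : ℝ)..(2 * π), k (α + β) * schwarzKernel r β) (𝓝[<] 1)
      (𝓝 l)) : HilbertConverges k α := by
  -- Subtracting the value at the singularity makes the Poisson average vanish in the limit. It
  -- changes neither truncation, since the cotangent integrates to zero, and shifts the Schwarz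
  -- integral only by `2π k α`.
  have hg : Continuous fun β => k (α + β) - k α := by fun_prop
  have hP := tendsto_integral_diskPoisson_smul (g := fun β => ‖k (α + β) - k α‖) (by fun_prop)
    (fun β => by beta_reduce; rw [← add_assoc, hp])
  simp only [add_zero, sub_self, norm_zero, smul_eq_mul, mul_zero] at hP
  have h1 : Tendsto (fun ε : ℝ =>
      (∫ β in ε..(2 * π - ε), (k (α + β) - k α) * schwarzKernel 1 β)
        - ∫ β in (0 : ℝ)..(2 * π), (k (α + β) - k α) * schwarzKernel (1 - ε) β) (𝓝[>] 0) (𝓝 0) := by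
    have h2 := (hP.comp tendsto_one_sub_nhdsLT).const_mul 6
    rw [mul_zero] at h2
    refine squeeze_zero_norm' ?_ h2
    filter_upwards [Ioo_mem_nhdsGT (show (0 : ℝ) < 1 by norm_num)] with ε hε
    exact norm_integral_schwarzKernel_sub_le hg hε.1 hε.2
  have h3 : Tendsto (fun ε : ℝ =>
      ∫ β in (0 : ℝ)..(2 * π), (k (α + β) - k α) * schwarzKernel (1 - ε) β) (𝓝[>] 0)
      (𝓝 (l - k α * (2 * π))) := by
    refine ((hl.comp tendsto_one_sub_nhdsLT).sub_const (k α * (2 * π))).congr' ?_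
    filter_upwards [Ioo_mem_nhdsGT (show (0 : ℝ) < 1 by norm_num)] with ε hε
    have h0 : 0 ≤ 1 - ε := by linarith [hε.2]
    have hlt : 1 - ε < 1 := by linarith [hε.1]
    have hS := continuous_schwarzKernel h0 hlt
    simp only [Function.comp_apply, sub_mul]
    rw [intervalIntegral.integral_sub, intervalIntegral.integral_const_mul,
      integral_schwarzKernel h0 hlt]
    · exact Continuous.intervalIntegrable (by fun_prop) _ _
    · exact Continuous.intervalIntegrable (by fun_prop) _ _
  have h4 := (h1.add h3).const_mul ((2 * π * Complex.I)⁻¹ * Complex.I)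
  refine ⟨_, h4.congr' ?_⟩
  filter_upwards [Ioo_mem_nhdsGT (show (0 : ℝ) < 1 by norm_num)] with ε hε
  have hle : ε ≤ 2 * π - ε := by linarith [hε.2, Real.pi_gt_three]
  rw [sub_add_cancel, truncHilbert_eq, mul_assoc]
  congr 1
  have hcS : IntervalIntegrable (schwarzKernel 1) volume ε (2 * π - ε) := by
    refine ContinuousOn.intervalIntegrable ?_
    rw [uIcc_of_le hle]
    exact continuousOn_schwarzKernel_one hε.1
  have hcK : IntervalIntegrable (fun β => k (α + β) * schwarzKernel 1 β) volume ε (2 * π - ε) := by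
    refine ContinuousOn.intervalIntegrable ?_
    rw [uIcc_of_le hle]
    exact ContinuousOn.mul (by fun_prop) (continuousOn_schwarzKernel_one hε.1)
  have h0 := integral_cot_eq_zero ε
  simp only [ofReal_cot_half, intervalIntegral.integral_const_mul] at h0 ⊢
  have h5 : ∫ β in ε..(2 * π - ε), schwarzKernel 1 β = 0 := by
    simpa using h0
  simp only [sub_mul]
  rw [intervalIntegral.integral_sub hcK (hcS.const_mul _), intervalIntegral.integral_const_mul, h5,
    mul_zero, sub_zero, ← intervalIntegral.integral_const_mul]
  congr 1; ext β; ring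

/-- The principal value for the derivative of the boundary values of a holomorphic function
converges. -/
lemma hilbertConverges_deriv {ψ : ℂ → ℂ} (hψ : DiffContOnCl ℂ ψ (Metric.ball 0 1))
    (hY : ContDiff ℝ 1 fun β => ψ (cis β)) (α : ℝ) :
    HilbertConverges (deriv fun β => ψ (cis β)) α := by
  refine hilbertConverges_of_tendsto (hY.continuous_deriv le_rfl)
    -- The Schwarz integral of the boundary derivative is `4π iζψ'(ζ)` at `ζ = r cis α`, and
    -- `iζψ'(ζ)` tends radially to the boundary derivative itself.
    (deriv_periodic (comp_cis_periodic ψ)) (l := 4 * π * deriv (fun β => ψ (cis β)) α) ?_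
  refine ((tendsto_mul_deriv_radial hψ hY α).const_mul (4 * π : ℂ)).congr' ?_
  filter_upwards [eventually_lt_one] with r hr
  rw [integral_deriv_mul_schwarzKernel hψ hY hr.1.le hr.2]

end EulerPoisson

/-! ### Second-order vanishing, the `csc²` kernel and the commutator identity. -/

namespace EulerPoisson

/-- The difference quotient of a Poisson integral at a boundary point where the boundary values
vanish to second order. -/
lemma tendsto_integral_diskPoisson_div {k : ℝ → ℝ} (hk : Continuous k) {C : ℝ}
    (hC : ∀ β, |k β| ≤ C * ‖cis β - 1‖ ^ 2) :
    Tendsto (fun r => (∫ β in (0 : ℝ)..(2 * π), diskPoisson r β * k β) / (1 - r)) (𝓝[<] 1)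
      (𝓝 (∫ β in (0 : ℝ)..(2 * π), 2 * (k β / ‖cis β - 1‖ ^ 2))) := by
  have hC0 : 0 ≤ C := by
    have h := (abs_nonneg _).trans (hC π)
    have : ‖cis π - 1‖ = 2 := by rw [norm_cis_sub_one]; simp
    rw [this] at h; linarith
  have heq : ∀ r : ℝ, r < 1 → ∀ β, diskPoisson r β * k β / (1 - r)
      = (1 + r) * (k β / ‖cis β - r‖ ^ 2) := by
    intro r hr β
    have : 1 - r ≠ 0 := by linarith
    rw [diskPoisson]; field_simp; ring
  have key : Tendsto (fun r : ℝ => ∫ β in (0 : ℝ)..(2 * π), diskPoisson r β * k β / (1 - r))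
      (𝓝[<] 1) (𝓝 (∫ β in (0 : ℝ)..(2 * π), 2 * (k β / ‖cis β - 1‖ ^ 2))) := by
    -- After division by `1 - r` the numerator `1 - r²` becomes `1 + r ≤ 2`, and `|k| ≤ C‖cis β -
    -- 1‖² ≤ 4C‖cis β - r‖²`; hence the bound `8C`.
    refine intervalIntegral.tendsto_integral_filter_of_dominated_convergence (fun _ => 8 * C)
      ?_ ?_ (by simp) ?_
    · filter_upwards [eventually_lt_one] with r hr
      have := continuous_diskPoisson hr.1.le hr.2
      exact Continuous.aestronglyMeasurable (by fun_prop)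
    · filter_upwards [eventually_lt_one] with r hr
      refine Eventually.of_forall fun β _ => ?_
      have h1 := norm_cis_sub_one_le hr.1.le hr.2.le β
      have h2 := norm_cis_sub_pos hr.1.le hr.2 β
      have h3 : |k β| / ‖cis β - r‖ ^ 2 ≤ 4 * C := by
        rw [div_le_iff₀ (by positivity)]
        calc |k β| ≤ C * ‖cis β - 1‖ ^ 2 := hC β
          _ ≤ C * (2 * ‖cis β - r‖) ^ 2 := by gcongr
          _ = _ := by ring
      rw [heq r hr.2, Real.norm_eq_abs, abs_mul, abs_div, abs_of_nonneg (sq_nonneg ‖cis β - r‖),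
        abs_of_pos (by linarith [hr.1])]
      have h4 : 0 ≤ |k β| / ‖cis β - r‖ ^ 2 := by positivity
      nlinarith [hr.1, hr.2]
    · refine Eventually.of_forall fun β _ => ?_
      -- At the pole `k` vanishes, so both the integrands and the limit are zero there.
      by_cases hβ : cis β = 1
      · have hk0 : k β = 0 := by
          have := hC β
          simpa [hβ] using this
        simp [hk0]
      · have h1 : ContinuousAt (fun r : ℝ => (1 + r) * (k β / ‖cis β - r‖ ^ 2)) 1 := by
          have h2 : ‖cis β - (1 : ℝ)‖ ^ 2 ≠ 0 := by
            simpa [sub_eq_zero] using hβ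
          refine ContinuousAt.mul (by fun_prop) (ContinuousAt.div continuousAt_const ?_ h2)
          fun_prop
        have h3 := h1.tendsto
        simp only [Complex.ofReal_one] at h3
        norm_num at h3
        refine (h3.mono_left nhdsWithin_le_nhds).congr' ?_
        filter_upwards [eventually_lt_one] with r hr
        rw [heq r hr.2]
  refine key.congr fun r => ?_
  rw [intervalIntegral.integral_div]

/-- A `C¹` periodic function is Lipschitz with respect to the chordal distance. -/
lemma exists_norm_sub_le_chord {g : ℝ → ℂ} (hg : ContDiff ℝ 1 g)
    (hp : Function.Periodic g (2 * π)) :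
    ∃ C, 0 ≤ C ∧ ∀ α β, ‖g (α + β) - g α‖ ≤ C * ‖cis β - 1‖ := by
  obtain ⟨C, hC0, hC⟩ := exists_norm_le_of_periodic (hg.continuous_deriv le_rfl)
    (deriv_periodic hp)
  -- `C` bounds the derivative. The increment is first reduced modulo the period to `(-π, π]`, where
  -- arc length is at most `π/2` times chord length.
  refine ⟨C * (π / 2), by positivity, fun α β => ?_⟩
  obtain ⟨n, hn, -⟩ := existsUnique_sub_zsmul_mem_Ioc (show (0 : ℝ) < 2 * π by positivity) β (-π)
  set β' := β - n • (2 * π) with hβ'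
  have e1 : cis β = cis β' := (cis_periodic.sub_zsmul_eq n).symm
  have e2 : g (α + β) = g (α + β') := by
    rw [hβ', ← add_sub_assoc, hp.sub_zsmul_eq]
  rw [e1, e2]
  have h1 : ‖g (α + β') - g α‖ ≤ C * ‖α + β' - α‖ :=
    convex_univ.norm_image_sub_le_of_norm_deriv_le
      (fun x _ => hg.differentiable one_ne_zero x) (fun x _ => hC x) (mem_univ _) (mem_univ _)
  rw [add_sub_cancel_left, Real.norm_eq_abs] at h1
  have h2 : |β'| ≤ π := abs_le.2 ⟨hn.1.le, by linarith [hn.2]⟩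
  have h3 := abs_le_norm_cis_sub_one h2
  have h4 : |β'| ≤ π / 2 * ‖cis β' - 1‖ := by
    calc |β'| = π / 2 * (2 / π * |β'|) := by field_simp
      _ ≤ _ := by gcongr
  calc _ ≤ C * |β'| := h1
    _ ≤ C * (π / 2 * ‖cis β' - 1‖) := by gcongr
    _ = _ := by ring

lemma intervalIntegrable_of_bounded {E : Type*} [NormedAddCommGroup E]
    {f : ℝ → E} (hf : AEStronglyMeasurable f volume) {C : ℝ} (hC : ∀ x, ‖f x‖ ≤ C) (a b : ℝ) :
    IntervalIntegrable f volume a b := by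
  refine (intervalIntegrable_const (c := C)).mono_fun hf.restrict
    (Eventually.of_forall fun x => ?_)
  exact (hC x).trans (le_abs_self C)

lemma tendsto_integral_trunc {E : Type*} [NormedAddCommGroup E] [NormedSpace ℝ E]
    {f : ℝ → E} (hf : ∀ a b, IntervalIntegrable f volume a b) :
    Tendsto (fun ε => ∫ β in ε..(2 * π - ε), f β) (𝓝[>] 0)
      (𝓝 (∫ β in (0 : ℝ)..(2 * π), f β)) := by
  have hc := intervalIntegral.continuous_primitive hf 0
  have h1 : Continuous fun ε : ℝ => (∫ β in (0 : ℝ)..(2 * π - ε), f β) - ∫ β in (0 : ℝ)..ε, f β :=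
    (hc.comp (by fun_prop)).sub hc
  have h2 := h1.tendsto 0
  simp only [sub_zero, intervalIntegral.integral_same] at h2
  refine (h2.mono_left nhdsWithin_le_nhds).congr fun ε => ?_
  rw [intervalIntegral.integral_interval_sub_left (hf _ _) (hf _ _)]

lemma norm_cis_sub_one_sq (β : ℝ) : ‖cis β - 1‖ ^ 2 = 4 * Real.sin (β / 2) ^ 2 := by
  rw [norm_cis_sub_one, mul_pow, sq_abs]; ring

/-- Half-angle form of the chord length, `‖cis β - 1‖² = 4 sin²(β/2)`; it turns the limit of the
Poisson difference quotient into the kernel of the statement. -/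
lemma cscKernel_add (g : ℝ → ℂ) (α β : ℝ) :
    cscKernel g α (α + β) = 4 * (‖g (α + β) - g α‖ ^ 2 / ‖cis β - 1‖ ^ 2) := by
  rw [cscKernel, norm_cis_sub_one_sq, add_sub_cancel_left]
  by_cases h : Real.sin (β / 2) = 0
  · simp [h]
  · field_simp

lemma cscKernel_nonneg (g : ℝ → ℂ) (α β : ℝ) : 0 ≤ cscKernel g α β := by
  unfold cscKernel; positivity

lemma cscKernel_periodic {g : ℝ → ℂ} (hp : Function.Periodic g (2 * π)) (α : ℝ) :
    Function.Periodic (cscKernel g α) (2 * π) := by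
  intro β
  have : Real.sin ((β + 2 * π - α) / 2) = -Real.sin ((β - α) / 2) := by
    rw [show (β + 2 * π - α) / 2 = (β - α) / 2 + π by ring, Real.sin_add_pi]
  rw [cscKernel, cscKernel, hp, this, one_div, one_div, inv_neg, neg_sq]

lemma intervalIntegrable_cscKernel {g : ℝ → ℂ} (hg : ContDiff ℝ 1 g)
    (hp : Function.Periodic g (2 * π)) (α a b : ℝ) :
    IntervalIntegrable (cscKernel g α) volume a b := by
  obtain ⟨C, hC0, hC⟩ := exists_norm_sub_le_chord hg hp
  refine intervalIntegrable_of_bounded (C := 4 * C ^ 2) ?_ (fun β => ?_) a b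
  · have := hg.continuous.measurable
    refine Measurable.aestronglyMeasurable ?_
    unfold cscKernel
    fun_prop
  · rw [Real.norm_of_nonneg (cscKernel_nonneg _ _ _)]
    have h := cscKernel_add g α (β - α)
    have h2 := hC α (β - α)
    rw [add_sub_cancel] at h h2
    rw [h]
    have : ‖g β - g α‖ ^ 2 / ‖cis (β - α) - 1‖ ^ 2 ≤ C ^ 2 := by
      refine div_le_of_le_mul₀ (by positivity) (by positivity) ?_
      rw [← mul_pow]; gcongr
    linarith

lemma integral_cscKernel {g : ℝ → ℂ} (hp : Function.Periodic g (2 * π)) (α : ℝ) :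
    ∫ β in (0 : ℝ)..(2 * π), cscKernel g α β
      = ∫ β in (0 : ℝ)..(2 * π), cscKernel g α (α + β) := by
  have h := (cscKernel_periodic hp α).intervalIntegral_add_eq 0 α
  rw [zero_add] at h
  rw [h, intervalIntegral.integral_comp_add_left, add_zero]

/-- The singularity of the cotangent is exactly of the order of the chord, so it is absorbed by one
Lipschitz factor. -/
lemma abs_cot_mul_norm_le (β : ℝ) : |Real.cot (β / 2)| * ‖cis β - 1‖ ≤ 2 := by
  rw [norm_cis_sub_one, Real.cot_eq_cos_div_sin, abs_div]
  by_cases h : Real.sin (β / 2) = 0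
  · simp [h]
  · have : |Real.sin (β / 2)| ≠ 0 := by simpa using h
    have h2 := Real.abs_cos_le_one (β / 2)
    calc _ = 2 * |Real.cos (β / 2)| := by field_simp
      _ ≤ 2 := by linarith

lemma measurable_cot_half : Measurable fun β : ℝ => Real.cot (β / 2) := by
  simp only [Real.cot_eq_cos_div_sin]
  fun_prop

lemma sin_half_pos {ε β : ℝ} (hε : 0 < ε) (hβ : β ∈ Icc ε (2 * π - ε)) :
    0 < Real.sin (β / 2) :=
  Real.sin_pos_of_pos_of_lt_pi (by linarith [hβ.1]) (by linarith [hβ.2])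

lemma hasDerivAt_cot_half {β : ℝ} (h : Real.sin (β / 2) ≠ 0) :
    HasDerivAt (fun β : ℝ => Real.cot (β / 2)) (-(1 / 2) * (1 / Real.sin (β / 2)) ^ 2) β := by
  simp only [Real.cot_eq_cos_div_sin]
  have h2 : HasDerivAt (fun β : ℝ => β / 2) (1 / 2) β := (hasDerivAt_id β).div_const 2
  convert! (h2.cos.div h2.sin h) using 1
  have := Real.sin_sq_add_cos_sq (β / 2)
  field_simp
  linarith

lemma continuousOn_cot_half {ε : ℝ} (hε : 0 < ε) :
    ContinuousOn (fun β : ℝ => Real.cot (β / 2)) (Icc ε (2 * π - ε)) := fun _ hβ =>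
  (hasDerivAt_cot_half (sin_half_pos hε hβ).ne').continuousAt.continuousWithinAt

lemma hasDerivAt_norm_sub_sq {g : ℝ → ℂ} (hg : ContDiff ℝ 1 g) (w : ℂ) (β : ℝ) :
    HasDerivAt (fun β => ‖g β - w‖ ^ 2) (2 * ((g β - w) * conj (deriv g β)).re) β := by
  have h := ((hg.differentiable one_ne_zero β).hasDerivAt.sub_const w).norm_sq
  convert! h using 2
  simp [Complex.inner]
  ring

/-- Integration by parts for the commutator. -/
lemma re_integral_mul_cot {g : ℝ → ℂ} (hg : ContDiff ℝ 1 g) (hp : Function.Periodic g (2 * π))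
    (α : ℝ) (hi : ∀ a b, IntervalIntegrable (fun β => (g (α + β) - g α) * conj (deriv g (α + β))
      * (Real.cot (β / 2) : ℂ)) volume a b) :
    (∫ β in (0 : ℝ)..(2 * π), (g (α + β) - g α) * conj (deriv g (α + β))
      * (Real.cot (β / 2) : ℂ)).re
      = 1 / 4 * ∫ β in (0 : ℝ)..(2 * π), cscKernel g α (α + β) := by
  obtain ⟨C, hC0, hC⟩ := exists_norm_sub_le_chord hg hp
  have hgd := hg.continuous_deriv le_rfl
  have hgc := hg.continuous
  have hint : ∀ a b, IntervalIntegrable (fun β => cscKernel g α (α + β)) volume a b := by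
    intro a b
    have := (intervalIntegrable_cscKernel hg hp α (α + a) (α + b)).comp_add_left α
    simpa using this
  have hL := (Complex.continuous_re.tendsto _).comp (tendsto_integral_trunc hi)
  have hR := (tendsto_integral_trunc hint).const_mul (1 / 4)
  -- The boundary term of the integration by parts: two Lipschitz factors against one cotangent,
  -- hence `O(‖cis β - 1‖)` and zero in the limit at both ends.
  let B : ℝ → ℝ := fun β => ‖g (α + β) - g α‖ ^ 2 / 2 * Real.cot (β / 2)
  have hB : ∀ β, |B β| ≤ C ^ 2 * ‖cis β - 1‖ := by
    intro β
    have h1 := hC α β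
    have h2 := abs_cot_mul_norm_le β
    simp only [B]
    rw [abs_mul, abs_of_nonneg (by positivity)]
    calc ‖g (α + β) - g α‖ ^ 2 / 2 * |Real.cot (β / 2)|
        ≤ (C * ‖cis β - 1‖) ^ 2 / 2 * |Real.cot (β / 2)| := by gcongr
      _ = C ^ 2 * ‖cis β - 1‖ / 2 * (|Real.cot (β / 2)| * ‖cis β - 1‖) := by ring
      _ ≤ C ^ 2 * ‖cis β - 1‖ / 2 * 2 := by gcongr
      _ = _ := by ring
  have hB0 : Tendsto (fun ε => B (2 * π - ε) - B ε) (𝓝[>] 0) (𝓝 0) := by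
    have h1 : Tendsto (fun ε : ℝ => C ^ 2 * ‖cis (2 * π - ε) - 1‖ + C ^ 2 * ‖cis ε - 1‖) (𝓝[>] 0)
        (𝓝 0) := by
      have : Continuous fun ε : ℝ => C ^ 2 * ‖cis (2 * π - ε) - 1‖ + C ^ 2 * ‖cis ε - 1‖ := by
        fun_prop
      have h := this.tendsto 0
      have hc : cis (2 * π) = 1 := by simpa using cis_periodic 0
      simp only [sub_zero, hc, cis_zero, sub_self, norm_zero, mul_zero, add_zero] at h
      exact h.mono_left nhdsWithin_le_nhds
    refine squeeze_zero_norm (fun ε => ?_) h1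
    rw [Real.norm_eq_abs]
    have := abs_sub (B (2 * π - ε)) (B ε)
    linarith [hB (2 * π - ε), hB ε]
  have hR' := hB0.add hR
  rw [zero_add] at hR'
  refine tendsto_nhds_unique hL (hR'.congr' ?_)
  filter_upwards [Ioo_mem_nhdsGT (show (0 : ℝ) < 1 by norm_num)] with ε hε
  have hle : ε ≤ 2 * π - ε := by linarith [hε.2, Real.pi_gt_three]
  have hu : ∀ β ∈ uIcc ε (2 * π - ε), HasDerivAt (fun β => ‖g (α + β) - g α‖ ^ 2 / 2)
      ((g (α + β) - g α) * conj (deriv g (α + β))).re β := by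
    intro β _
    have h1 := (hasDerivAt_norm_sub_sq hg (g α) (α + β)).comp_const_add α β
    convert! h1.div_const 2 using 1
    ring
  have hv : ∀ β ∈ uIcc ε (2 * π - ε), HasDerivAt (fun β : ℝ => Real.cot (β / 2))
      (-(1 / 2) * (1 / Real.sin (β / 2)) ^ 2) β := by
    intro β hβ
    rw [uIcc_of_le hle] at hβ
    exact hasDerivAt_cot_half (sin_half_pos hε.1 hβ).ne'
  have hv' : IntervalIntegrable (fun β : ℝ => -(1 / 2) * (1 / Real.sin (β / 2)) ^ 2) volume
      ε (2 * π - ε) := by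
    refine ContinuousOn.intervalIntegrable ?_
    rw [uIcc_of_le hle]
    refine continuousOn_const.mul (ContinuousOn.pow (ContinuousOn.div (by fun_prop) (by fun_prop)
      fun β hβ => (sin_half_pos hε.1 hβ).ne') 2)
  -- The real part of `(g - g α) conj g'` is the derivative of `‖g - g α‖²/2`, and the derivative of
  -- `cot(β/2)` is `-csc²(β/2)/2`; the two halves make the factor `1/4`.
  have hibp := intervalIntegral.integral_mul_deriv_eq_deriv_mul hu hv
    (Continuous.intervalIntegrable (by fun_prop) _ _) hv'
  have e1 : (∫ β in ε..(2 * π - ε), (g (α + β) - g α) * conj (deriv g (α + β))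
      * (Real.cot (β / 2) : ℂ)).re
      = ∫ β in ε..(2 * π - ε), ((g (α + β) - g α) * conj (deriv g (α + β))).re
        * Real.cot (β / 2) := by
    have := Complex.reCLM.intervalIntegral_comp_comm (hi ε (2 * π - ε))
    simp only [Complex.reCLM_apply] at this
    rw [← this]
    congr 1; ext β
    rw [Complex.re_mul_ofReal]
  have e2 : ∫ β in ε..(2 * π - ε), ‖g (α + β) - g α‖ ^ 2 / 2
      * (-(1 / 2) * (1 / Real.sin (β / 2)) ^ 2)
      = -(1 / 4 * ∫ β in ε..(2 * π - ε), cscKernel g α (α + β)) := by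
    rw [← intervalIntegral.integral_const_mul, ← intervalIntegral.integral_neg]
    congr 1; ext β
    rw [cscKernel, add_sub_cancel_left]; ring
  simp only [Function.comp_apply, B]
  rw [e1]
  linarith

/-- The commutator `[g, H̃] ∂(conj g)`. -/
lemma hilbertComm_deriv_conj {g : ℝ → ℂ} (hg : ContDiff ℝ 1 g)
    (hp : Function.Periodic g (2 * π)) (α : ℝ)
    (hconv : HilbertConverges (deriv fun β => conj (g β)) α) :
    HilbertConverges (fun β => g β * deriv (fun β => conj (g β)) β) α ∧
    (hilbertComm g (deriv fun β => conj (g β)) α).im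
      = 1 / (8 * π) * ∫ β in (0 : ℝ)..(2 * π), cscKernel g α β := by
  obtain ⟨C, hC0, hC⟩ := exists_norm_sub_le_chord hg hp
  have hgd := hg.continuous_deriv le_rfl
  have hgc := hg.continuous
  obtain ⟨D, hD0, hD⟩ := exists_norm_le_of_periodic hgd (deriv_periodic hp)
  have hder : ∀ β, deriv (fun β => conj (g β)) β = conj (deriv g β) := fun β =>
    ((hg.differentiable one_ne_zero β).hasDerivAt.star).deriv
  have hi : ∀ a b, IntervalIntegrable (fun β => (g (α + β) - g α) * conj (deriv g (α + β))
      * (Real.cot (β / 2) : ℂ)) volume a b := by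
    refine intervalIntegrable_of_bounded (C := 2 * C * D) ?_ fun β => ?_
    · refine AEStronglyMeasurable.mul (Continuous.aestronglyMeasurable (by fun_prop)) ?_
      exact (Complex.measurable_ofReal.comp measurable_cot_half).aestronglyMeasurable
    · rw [norm_mul, norm_mul, RCLike.norm_conj, Complex.norm_real, Real.norm_eq_abs]
      calc ‖g (α + β) - g α‖ * ‖deriv g (α + β)‖ * |Real.cot (β / 2)|
          ≤ C * ‖cis β - 1‖ * D * |Real.cot (β / 2)| := by
            gcongr
            · exact hC α β
            · exact hD _
        _ = C * D * (|Real.cot (β / 2)| * ‖cis β - 1‖) := by ring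
        _ ≤ C * D * 2 := by
            gcongr; exact abs_cot_mul_norm_le β
        _ = _ := by ring
  obtain ⟨l, hl⟩ := hconv
  set I := ∫ β in (0 : ℝ)..(2 * π), (g (α + β) - g α) * conj (deriv g (α + β))
      * (Real.cot (β / 2) : ℂ) with hI
  -- Writing `g = (g - g α) + g α` splits the truncation into an absolutely convergent integral and
  -- `g α` times the principal value already known to converge. The latter cancels in the
  -- commutator.
  have hlim : Tendsto (truncHilbert (fun β => g β * deriv (fun β => conj (g β)) β) α) (𝓝[>] 0)
      (𝓝 ((2 * π * Complex.I)⁻¹ * I + g α * l)) := by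
    refine (((tendsto_integral_trunc hi).const_mul (2 * π * Complex.I)⁻¹).add
      (hl.const_mul (g α))).congr' ?_
    filter_upwards [Ioo_mem_nhdsGT (show (0 : ℝ) < 1 by norm_num)] with ε hε
    have hle : ε ≤ 2 * π - ε := by linarith [hε.2, Real.pi_gt_three]
    have hi2 : IntervalIntegrable (fun β => conj (deriv g (α + β)) * (Real.cot (β / 2) : ℂ)) volume
        ε (2 * π - ε) := by
      refine ContinuousOn.intervalIntegrable ?_
      rw [uIcc_of_le hle]
      exact ContinuousOn.mul (by fun_prop)
        (Complex.continuous_ofReal.comp_continuousOn (continuousOn_cot_half hε.1))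
    rw [truncHilbert_eq, truncHilbert_eq, mul_left_comm (g α), ← mul_add]
    congr 1
    simp only [hder]
    rw [← intervalIntegral.integral_const_mul, ← intervalIntegral.integral_add (hi _ _)
      (hi2.const_mul _)]
    congr 1; ext β; ring
  refine ⟨⟨_, hlim⟩, ?_⟩
  rw [hilbertComm, hilbert, hilbert, hl.limUnder_eq, hlim.limUnder_eq]
  have e1 : g α * l - ((2 * π * Complex.I)⁻¹ * I + g α * l)
      = ((2 * π)⁻¹ : ℝ) * (Complex.I * I) := by
    have : (π : ℂ) ≠ 0 := by exact_mod_cast Real.pi_ne_zero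
    push_cast
    rw [mul_inv (2 * (π : ℂ)), Complex.inv_I]
    ring
  rw [e1, Complex.im_ofReal_mul, Complex.I_mul_im, hI, re_integral_mul_cot hg hp α hi,
    integral_cscKernel hp]
  field_simp
  ring

end EulerPoisson

/-! ### The inverse Riemann map and its boundary values. -/

namespace EulerPoisson

lemma IsBoundaryParam.isCompact_closure {U : Set ℂ} {γ : ℝ → ℂ} (hb : IsBoundaryParam U γ) :
    IsCompact (closure U) := hb.isBounded.isCompact_closure

lemma IsBoundaryParam.mem_frontier {U : Set ℂ} {γ : ℝ → ℂ} (hb : IsBoundaryParam U γ) (α : ℝ) :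
    γ α ∈ frontier U := hb.range_eq ▸ mem_range_self α

lemma IsBoundaryParam.mem_closure {U : Set ℂ} {γ : ℝ → ℂ} (hb : IsBoundaryParam U γ) (α : ℝ) :
    γ α ∈ closure U := frontier_subset_closure (hb.mem_frontier α)

/-- The inverse of an injective holomorphic function is holomorphic. -/
lemma differentiableOn_of_rightInverse {Φ Ψ : ℂ → ℂ} {U V : Set ℂ} (hU : IsOpen U)
    (hV : IsOpen V) (hΦ : DifferentiableOn ℂ Φ U) (hinj : InjOn Φ U) (hΨ : ContinuousOn Ψ V)
    (hmaps : MapsTo Ψ V U) (hinv : ∀ w ∈ V, Φ (Ψ w) = w) : DifferentiableOn ℂ Ψ V := by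
  have hdiff : ∀ w ∈ V, deriv Φ (Ψ w) ≠ 0 → DifferentiableAt ℂ Ψ w := by
    intro w hw hne
    have h1 := (hΦ.differentiableAt (hU.mem_nhds (hmaps hw))).hasDerivAt
    exact (HasDerivAt.of_local_left_inverse (hΨ.continuousAt (hV.mem_nhds hw)) h1 hne
      (by filter_upwards [hV.mem_nhds hw] with y hy using hinv y hy)).differentiableAt
  intro w hw
  -- Where `Φ'` does not vanish the inverse function rule applies; an isolated zero of `Φ'` gives a
  -- removable singularity of the continuous function `Ψ`.
  refine (Complex.analyticAt_of_differentiable_on_punctured_nhds_of_continuousAt ?_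
    (hΨ.continuousAt (hV.mem_nhds hw))).differentiableAt.differentiableWithinAt
  have han : AnalyticAt ℂ (deriv Φ) (Ψ w) :=
    (hΦ.deriv hU).analyticAt (hU.mem_nhds (hmaps hw))
  have hcont : Tendsto Ψ (𝓝[≠] w) (𝓝[≠] (Ψ w)) := by
    refine tendsto_nhdsWithin_iff.2 ⟨(hΨ.continuousAt (hV.mem_nhds hw)).tendsto.mono_left
      nhdsWithin_le_nhds, ?_⟩
    filter_upwards [self_mem_nhdsWithin, nhdsWithin_le_nhds (hV.mem_nhds hw)] with y hy hyV h
    exact hy (by rw [mem_singleton_iff, ← hinv y hyV, h, hinv w hw])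
  rcases han.eventually_eq_zero_or_eventually_ne_zero with h0 | h0
  -- If `Φ'` vanished near the point, `Φ` would be constant on a ball, against injectivity.
  · exfalso
    obtain ⟨r, hr, hball⟩ := Metric.eventually_nhds_iff_ball.1
      (h0.and (hU.mem_nhds (hmaps hw)))
    have hx : Ψ w ∈ Metric.ball (Ψ w) r := Metric.mem_ball_self hr
    have hy : Ψ w + (r / 2 : ℝ) ∈ Metric.ball (Ψ w) r := by
      rw [Metric.mem_ball, dist_self_add_left, Complex.norm_real, Real.norm_of_nonneg (by linarith)]
      linarith
    have h1 := Metric.isOpen_ball.is_const_of_deriv_eq_zero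
      (convex_ball (Ψ w) r).isPreconnected (hΦ.mono fun y hy => (hball y hy).2)
      (fun y hy => (hball y hy).1) hx hy
    have h2 := hinj (hball _ hx).2 (hball _ hy).2 h1
    have h3 : ((r / 2 : ℝ) : ℂ) = 0 := by
      linear_combination -h2
    have h4 : r / 2 = 0 := by exact_mod_cast h3
    linarith
  · filter_upwards [hcont.eventually h0, nhdsWithin_le_nhds (hV.mem_nhds hw)] with y hy hyV
    exact hdiff y hyV hy

/-- The inverse Riemann mapping and its boundary values. -/
lemma IsRiemannCoordinate.exists_inverse {U : Set ℂ} {γ : ℝ → ℂ} {x₀ : ℂ} {Φ : ℂ → ℂ}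
    {h : ℝ ≃ₜ ℝ} (hb : IsBoundaryParam U γ) (hR : IsRiemannCoordinate U γ x₀ Φ h) :
    ∃ Ψ : ℂ → ℂ, DiffContOnCl ℂ Ψ (Metric.ball 0 1) ∧ (∀ θ, Ψ (cis θ) = γ (h.symm θ)) ∧
      MapsTo Ψ (Metric.ball 0 1) U ∧ MapsTo Ψ (Metric.closedBall 0 1) (closure U) := by
  have hcis : ∀ α, Φ (γ α) = cis (h α) := fun α => by
    rw [← hR.exp_eq, cis, mul_comm]
  have hcl : closure U = U ∪ range γ := by
    rw [hb.range_eq, closure_eq_self_union_frontier]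
  have hnU : ∀ x ∈ U, ‖Φ x‖ < 1 := fun x hx => by simpa using hR.bijOn.mapsTo hx
  have hper : ∀ (b : ℝ) (n : ℤ), h (b + n * (2 * π)) = h b + n * (2 * π) := by
    intro b n
    have : Function.Periodic (fun x => h x - x) (2 * π) := fun x => by
      beta_reduce; rw [hR.map_add]; ring
    have h2 := this.int_mul n b
    beta_reduce at h2
    linarith
  -- Interior and boundary points are separated by `‖Φ‖ < 1` against `‖Φ‖ = 1`. Two boundary points
  -- with the same image have values of `h` differing by a multiple of `2π`, hence parameters
  -- differing by the same multiple.
  have hinj : InjOn Φ (closure U) := by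
    rw [hcl]
    rintro x (hx | ⟨a, rfl⟩) y (hy | ⟨b, rfl⟩) hxy
    · exact hR.bijOn.injOn hx hy hxy
    · have := hnU x hx
      rw [hxy, hcis, norm_cis] at this
      exact absurd this (lt_irrefl _)
    · have := hnU y hy
      rw [← hxy, hcis, norm_cis] at this
      exact absurd this (lt_irrefl _)
    · rw [hcis, hcis, cis, cis, Complex.exp_eq_exp_iff_exists_int] at hxy
      obtain ⟨n, hn⟩ := hxy
      have h1 : ((h a : ℝ) : ℂ) = ((h b + n * (2 * π) : ℝ) : ℂ) := by
        have : (h a : ℂ) * Complex.I = ((h b : ℂ) + n * (2 * π)) * Complex.I := by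
          rw [hn]; ring
        have := mul_right_cancel₀ Complex.I_ne_zero this
        rw [this]; push_cast; ring
      have h2 : h a = h (b + n * (2 * π)) := by rw [hper]; exact_mod_cast h1
      rw [h.injective h2]
      exact (hb.periodic.int_mul n b)
  have hmem : ∀ w ∈ Metric.closedBall (0 : ℂ) 1, ∃ x ∈ closure U, Φ x = w := by
    intro w hw
    rcases (mem_closedBall_zero_iff.1 hw).lt_or_eq with hw1 | hw1
    · obtain ⟨x, hx, hxw⟩ := hR.bijOn.surjOn (mem_ball_zero_iff.2 hw1)
      exact ⟨x, subset_closure hx, hxw⟩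
    · refine ⟨γ (h.symm w.arg), hb.mem_closure _, ?_⟩
      rw [hcis, h.apply_symm_apply, cis]
      have := Complex.norm_mul_exp_arg_mul_I w
      rwa [hw1, Complex.ofReal_one, one_mul] at this
  set Ψ := Function.invFunOn Φ (closure U) with hΨ
  have hΨmem : ∀ w ∈ Metric.closedBall (0 : ℂ) 1, Ψ w ∈ closure U := fun w hw =>
    Function.invFunOn_mem (hmem w hw)
  have hΨeq : ∀ w ∈ Metric.closedBall (0 : ℂ) 1, Φ (Ψ w) = w := fun w hw =>
    Function.invFunOn_eq (hmem w hw)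
  have hΦmem : ∀ x ∈ closure U, Φ x ∈ Metric.closedBall (0 : ℂ) 1 := by
    rw [hcl]
    rintro x (hx | ⟨a, rfl⟩)
    · exact mem_closedBall_zero_iff.2 (hnU x hx).le
    · rw [hcis]; simp
  have hΨleft : ∀ x ∈ closure U, Ψ (Φ x) = x := fun x hx =>
    hinj (hΨmem _ (hΦmem x hx)) hx (hΨeq _ (hΦmem x hx))
  have hmapsU : MapsTo Ψ (Metric.ball 0 1) U := by
    intro w hw
    have h1 := hΨmem w (Metric.ball_subset_closedBall hw)
    have h2 := hΨeq w (Metric.ball_subset_closedBall hw)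
    rw [hcl] at h1
    rcases h1 with h1 | ⟨a, ha⟩
    · exact h1
    · rw [← ha, hcis] at h2
      rw [← h2] at hw
      simp at hw
  -- The inverse of a continuous bijection from a compact set: images of closed subsets are compact,
  -- hence closed.
  have hcont : ContinuousOn Ψ (Metric.closedBall 0 1) := by
    rw [continuousOn_iff_isClosed]
    intro t ht
    refine ⟨Φ '' (t ∩ closure U), ?_, ?_⟩
    · exact ((hb.isCompact_closure.inter_left ht).image_of_continuousOn
        (hR.continuousOn.mono inter_subset_right)).isClosed
    · ext w
      constructor
      · rintro ⟨h1, h2⟩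
        exact ⟨⟨Ψ w, ⟨h1, hΨmem w h2⟩, hΨeq w h2⟩, h2⟩
      · rintro ⟨⟨x, ⟨hx1, hx2⟩, rfl⟩, h2⟩
        refine ⟨?_, h2⟩
        rw [mem_preimage, hΨleft x hx2]
        exact hx1
  refine ⟨Ψ, ⟨?_, ?_⟩, ?_, hmapsU, hΨmem⟩
  · exact differentiableOn_of_rightInverse hb.isOpen Metric.isOpen_ball hR.differentiableOn
      hR.bijOn.injOn (hcont.mono Metric.ball_subset_closedBall) hmapsU
      fun w hw => hΨeq w (Metric.ball_subset_closedBall hw)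
  · rwa [closure_ball _ one_ne_zero]
  · intro θ
    have h1 := hΨleft _ (hb.mem_closure (h.symm θ))
    rwa [hcis, h.apply_symm_apply] at h1

end EulerPoisson

/-! ### The gravity field inside the fluid. -/

namespace EulerPoisson

lemma conj_div_norm_sq (w : ℂ) : conj (w / ((‖w‖ ^ 2 : ℝ) : ℂ)) = w⁻¹ := by
  rw [map_div₀, Complex.conj_ofReal, Complex.inv_def, Complex.normSq_eq_norm_sq, div_eq_mul_inv,
    Complex.ofReal_inv]

lemma conj_gradPotential (U : Set ℂ) (x : ℂ) :
    conj (gradPotential U x) = ∫ y in U, (x - y)⁻¹ := by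
  rw [gradPotential, ← integral_conj]
  simp only [conj_div_norm_sq]

lemma locallyIntegrable_inv : LocallyIntegrable (fun y : ℂ => y⁻¹) volume := by
  refine locallyIntegrable_of_norm_le_rpow (C := 1) (α := 1) (by simp) (by simp) ?_ ?_
  · refine Eventually.of_forall fun y => ?_
    rw [norm_inv, Real.rpow_neg_one, one_mul]
  · exact measurable_inv.aestronglyMeasurable

lemma integrableOn_inv_sub {B : Set ℂ} (hB : Bornology.IsBounded B) (x : ℂ) :
    IntegrableOn (fun y => (x - y)⁻¹) B volume := by
  obtain ⟨R, hR⟩ := hB.subset_closedBall x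
  refine IntegrableOn.mono_set ?_ hR
  have h := locallyIntegrable_inv.integrableOn_isCompact (isCompact_closedBall (0 : ℂ) R)
  have hmp : MeasurePreserving (fun y : ℂ => x - y) volume volume := Measure.measurePreserving_sub_left _ x
  have hemb : MeasurableEmbedding (fun y : ℂ => x - y) :=
    (MeasurableEquiv.subLeft x).measurableEmbedding
  have h2 := (hmp.integrableOn_comp_preimage hemb (s := Metric.closedBall (0 : ℂ) R)
    (f := fun y : ℂ => y⁻¹)).2 h
  rwa [show (fun y : ℂ => x - y) ⁻¹' Metric.closedBall 0 R = Metric.closedBall x R by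
    ext y; simp [dist_eq_norm, norm_sub_rev x y]] at h2

lemma integral_Ioo_comp_cis {ψ : ℂ → ℂ} (hψ : DiffContOnCl ℂ ψ (Metric.ball 0 1)) :
    ∫ θ in Ioo (-π) π, ψ (cis θ) = 2 * π * ψ 0 := by
  rw [← integral_Ioc_eq_integral_Ioo,
    ← integral_eq_setIntegral_Ioc_of_periodic (comp_cis_periodic ψ)]
  have h2 := DiffContOnCl.circleAverage (f := ψ) (c := 0) (R := 1) (by simpa using hψ)
  simp only [Real.circleAverage, circleMap_eq_cis] at h2
  rw [← h2, Complex.real_smul]; push_cast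
  rw [mul_inv_cancel_left₀ (by simp [Real.pi_ne_zero])]

/-- Newton's shell theorem in complex form. If the circle lies inside radius `‖x‖`, the integrand is
holomorphic in the unit-disc variable and the mean value property applies. Otherwise `conj (cis θ) =
(cis θ)⁻¹` makes its conjugate holomorphic in that variable, with value zero at the centre. -/
lemma integral_inv_sub_circle {x : ℂ} {ρ : ℝ} (h0 : 0 < ρ) (hne : ρ ≠ ‖x‖) :
    ∫ θ in Ioo (-π) π, (x - ρ * cis θ)⁻¹ = if ρ < ‖x‖ then 2 * π * x⁻¹ else 0 := by
  have hd : ∀ {f : ℂ → ℂ}, (∀ ζ ∈ Metric.closedBall (0 : ℂ) 1, DifferentiableAt ℂ f ζ) →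
      DiffContOnCl ℂ f (Metric.ball 0 1) := by
    intro f hf
    refine DifferentiableOn.diffContOnCl fun ζ hζ => ?_
    rw [closure_ball _ one_ne_zero] at hζ
    exact (hf ζ hζ).differentiableWithinAt
  split_ifs with h
  · have := integral_Ioo_comp_cis (ψ := fun ζ => (x - ρ * ζ)⁻¹) (hd fun ζ hζ => ?_)
    · rw [this]; simp
    · refine DifferentiableAt.inv (by fun_prop) fun h3 => ?_
      have h4 : ‖x‖ = ρ * ‖ζ‖ := by
        rw [sub_eq_zero.1 h3, norm_mul, Complex.norm_real, Real.norm_of_nonneg h0.le]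
      have h5 : ‖ζ‖ ≤ 1 := by simpa using hζ
      nlinarith
  · have hlt : ‖x‖ < ρ := lt_of_le_of_ne (not_lt.1 h) (Ne.symm hne)
    have := integral_Ioo_comp_cis (ψ := fun ζ => ζ / (conj x * ζ - ρ)) (hd fun ζ hζ => ?_)
    · have e : ∀ θ, (x - ρ * cis θ)⁻¹ = conj (cis θ / (conj x * cis θ - ρ)) := by
        intro θ
        have hc : conj (cis θ) * cis θ = 1 := by
          rw [mul_comm, Complex.mul_conj, Complex.normSq_eq_norm_sq]; simp
        have hc0 : conj (cis θ) ≠ 0 := by simpa using cis_ne_zero θ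
        rw [map_div₀, map_sub, map_mul, Complex.conj_conj, Complex.conj_ofReal]
        rw [show x * conj (cis θ) - ρ = conj (cis θ) * (x - ρ * cis θ) by
          linear_combination (ρ : ℂ) * hc]
        rw [div_mul_eq_div_div, div_self hc0, one_div]
      simp only [e]
      rw [integral_conj, this]; simp
    · refine DifferentiableAt.div (by fun_prop) (by fun_prop) fun h3 => ?_
      have h4 : ρ = ‖x‖ * ‖ζ‖ := by
        have : ‖conj x * ζ‖ = ‖(ρ : ℂ)‖ := by rw [sub_eq_zero.1 h3]
        rw [norm_mul, RCLike.norm_conj, Complex.norm_real, Real.norm_of_nonneg h0.le] at this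
        exact this.symm
      have h5 : ‖ζ‖ ≤ 1 := by simpa using hζ
      nlinarith [norm_nonneg x]

/-- The change of variables for nonnegative functions, applied to the norm, transfers finiteness;
this justifies Fubini in polar coordinates despite the singularity of the kernel. -/
lemma integrableOn_comp_polarCoord_symm {f : ℂ → ℂ} (hf : Integrable f volume) (hm : Measurable f) :
    IntegrableOn (fun p : ℝ × ℝ => p.1 • f (Complex.polarCoord.symm p)) polarCoord.target := by
  have hmeas : Measurable fun p : ℝ × ℝ => Complex.polarCoord.symm p := by
    have : (fun p : ℝ × ℝ => Complex.polarCoord.symm p)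
        = fun p => (p.1 : ℂ) * (Real.cos p.2 + Real.sin p.2 * Complex.I) := by
      ext p; rw [Complex.polarCoord_symm_apply]
    rw [this]
    fun_prop
  refine ⟨(measurable_fst.smul (hm.comp hmeas)).aestronglyMeasurable, ?_⟩
  have h := Complex.lintegral_comp_polarCoord_symm (fun z => ‖f z‖ₑ)
  have h2 : ∫⁻ z, ‖f z‖ₑ < ⊤ := hf.2
  rw [← h] at h2
  refine lt_of_le_of_lt (le_of_eq ?_) h2
  refine setLIntegral_congr_fun polarCoord.open_target.measurableSet fun p hp => ?_
  have hp1 : 0 < p.1 := hp.1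
  beta_reduce
  rw [enorm_smul, Real.enorm_eq_ofReal hp1.le, smul_eq_mul]

/-- The Cauchy transform of a disc. -/
lemma integral_ball_inv_sub {x : ℂ} {r : ℝ} (hx : ‖x‖ < r) :
    ∫ y in Metric.ball (0 : ℂ) r, (x - y)⁻¹ = π * conj x := by
  have hms : MeasurableSet (Metric.ball (0 : ℂ) r) := measurableSet_ball
  set f : ℂ → ℂ := (Metric.ball (0 : ℂ) r).indicator fun y => (x - y)⁻¹ with hf
  have hfm : Measurable f := Measurable.indicator (by fun_prop) hms
  have hfi : Integrable f volume :=
    (integrable_indicator_iff hms).2 (integrableOn_inv_sub Metric.isBounded_ball x)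
  have hpol := integrableOn_comp_polarCoord_symm hfi hfm
  have hsymm : ∀ ρ θ : ℝ, Complex.polarCoord.symm (ρ, θ) = ρ * cis θ := by
    intro ρ θ
    rw [Complex.polarCoord_symm_apply, cis, Complex.exp_mul_I]; push_cast; rfl
  rw [← integral_indicator hms, ← Complex.integral_comp_polarCoord_symm]
  rw [show polarCoord.target = Ioi (0 : ℝ) ×ˢ Ioo (-π) π from rfl] at hpol ⊢
  rw [Measure.volume_eq_prod] at hpol ⊢
  rw [setIntegral_prod _ hpol]
  -- Only circles of radius below `‖x‖` contribute, and the exceptional radius `‖x‖` is null. The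
  -- remaining radial integral is `2πx⁻¹ · ‖x‖²/2 = π conj x`.
  have hinner : ∀ᵐ ρ : ℝ ∂volume, ρ ∈ Ioi (0 : ℝ) →
      ∫ θ in Ioo (-π) π, (ρ, θ).1 • f (Complex.polarCoord.symm (ρ, θ))
        = (Iio ‖x‖).indicator (fun ρ : ℝ => (ρ : ℂ) * (2 * π * x⁻¹)) ρ := by
    have hne : ∀ᵐ ρ : ℝ ∂volume, ρ ≠ ‖x‖ := by
      simp [ae_iff, measure_singleton]
    filter_upwards [hne] with ρ hρ hρ0
    have hρ0' : 0 < ρ := hρ0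
    simp only [hsymm, Complex.real_smul]
    rw [integral_const_mul]
    by_cases hr : ρ < r
    · have e : ∀ θ, f (ρ * cis θ) = (x - ρ * cis θ)⁻¹ := fun θ =>
        indicator_of_mem (by simpa [abs_of_pos hρ0'] using hr) _
      simp only [e]
      rw [integral_inv_sub_circle hρ0' hρ]
      by_cases hx2 : ρ < ‖x‖
      · rw [if_pos hx2, indicator_of_mem (show ρ ∈ Iio ‖x‖ from hx2)]
      · rw [if_neg hx2, indicator_of_notMem (show ρ ∉ Iio ‖x‖ from hx2), mul_zero]
    · have e : ∀ θ, f (ρ * cis θ) = 0 := fun θ =>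
        indicator_of_notMem (by simpa [abs_of_pos hρ0'] using hr) _
      simp only [e]
      rw [indicator_of_notMem (show ρ ∉ Iio ‖x‖ by simp only [mem_Iio]; linarith)]
      simp
  rw [setIntegral_congr_ae measurableSet_Ioi hinner, setIntegral_indicator measurableSet_Iio,
    Ioi_inter_Iio, ← integral_Ioc_eq_integral_Ioo, ← intervalIntegral.integral_of_le (norm_nonneg x),
    intervalIntegral.integral_mul_const, intervalIntegral.integral_ofReal, integral_id]
  by_cases hx0 : x = 0
  · simp [hx0]
  · have h1 : x * conj x = (‖x‖ : ℂ) ^ 2 := by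
      rw [Complex.mul_conj, Complex.normSq_eq_norm_sq]; push_cast; rfl
    push_cast
    field_simp
    rw [← h1]; ring

lemma integral_ball_inv_sub' {c x : ℂ} {r : ℝ} (hx : x ∈ Metric.ball c r) :
    ∫ y in Metric.ball c r, (x - y)⁻¹ = π * conj (x - c) := by
  rw [← integral_ball_inv_sub (x := x - c) (r := r) (by simpa [dist_eq_norm] using hx)]
  have hmp : MeasurePreserving (fun y : ℂ => y - c) volume volume := measurePreserving_sub_right _ c
  have hemb : MeasurableEmbedding (fun y : ℂ => y - c) :=
    (MeasurableEquiv.subRight c).measurableEmbedding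
  rw [← hmp.setIntegral_preimage_emb hemb (fun y => (x - c - y)⁻¹) (Metric.ball 0 r)]
  have : (fun y : ℂ => y - c) ⁻¹' Metric.ball 0 r = Metric.ball c r := by
    ext y; simp [dist_eq_norm]
  rw [this]
  congr 1; ext y; congr 1; ring

/-- Mass at distance at least `r` from `x` stays at distance `r/2` from a half-size ball around `x`,
where the derivative of the kernel is uniformly bounded; so one may differentiate under the
integral. -/
lemma hasDerivAt_integral_inv_sub {B : Set ℂ} (hB : Bornology.IsBounded B) (hBm : MeasurableSet B)
    {x : ℂ} {r : ℝ} (hr : 0 < r) (hdisj : ∀ y ∈ B, r ≤ ‖x - y‖) :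
    DifferentiableAt ℂ (fun x => ∫ y in B, (x - y)⁻¹) x := by
  have hfin : volume B < ⊤ := hB.measure_lt_top
  have hne : ∀ y ∈ B, ∀ z ∈ Metric.ball x (r / 2), r / 2 ≤ ‖z - y‖ := by
    intro y hy z hz
    have h1 := hdisj y hy
    have h2 : ‖z - x‖ < r / 2 := by simpa [dist_eq_norm] using hz
    have h3 : ‖x - y‖ ≤ ‖z - y‖ + ‖z - x‖ := by
      rw [show x - y = (z - y) - (z - x) by ring]
      exact norm_sub_le _ _
    linarith
  refine (hasDerivAt_integral_of_dominated_loc_of_deriv_le (μ := volume.restrict B)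
    (F := fun x y => (x - y)⁻¹) (F' := fun x y => -1 / (x - y) ^ 2)
    (bound := fun _ => 1 / (r / 2) ^ 2) (Metric.ball_mem_nhds x (half_pos hr))
    (Eventually.of_forall fun z => ?_) ?_ ?_ ?_ ?_ ?_).2.differentiableAt
  · exact Measurable.aestronglyMeasurable (by fun_prop)
  · exact integrableOn_inv_sub hB x
  · exact Measurable.aestronglyMeasurable (by fun_prop)
  · filter_upwards [ae_restrict_mem hBm] with y hy z hz
    have h1 := hne y hy z hz
    rw [norm_div, norm_neg, norm_one, norm_pow]
    gcongr
  · exact integrableOn_const (μ := volume) (s := B) (C := 1 / (r / 2) ^ 2) hfin.ne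
  · filter_upwards [ae_restrict_mem hBm] with y hy z hz
    have h1 := hne y hy z hz
    have h2 : z - y ≠ 0 := norm_pos_iff.1 (by linarith)
    exact ((hasDerivAt_id z).sub_const y).inv h2

/-- The gravity field is a holomorphic field up to the explicit field `π x`. -/
lemma differentiableOn_conj_gradPotential_sub {U : Set ℂ} (hU : IsOpen U)
    (hb : Bornology.IsBounded U) :
    DifferentiableOn ℂ (fun x => conj (gradPotential U x) - π * conj x) U := by
  intro c hc
  obtain ⟨r, hr, hball⟩ := Metric.isOpen_iff.1 hU c hc
  refine DifferentiableAt.differentiableWithinAt ?_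
  -- Remove a disc around the point: its field is known explicitly, and its only non-holomorphic
  -- part is `π conj x`. The remaining mass keeps a positive distance.
  have hd : DifferentiableAt ℂ (fun x => ∫ y in U \ Metric.ball c r, (x - y)⁻¹) c := by
    refine hasDerivAt_integral_inv_sub (hb.subset sdiff_subset)
      (hU.measurableSet.diff measurableSet_ball) hr fun y hy => ?_
    have := hy.2
    rw [Metric.mem_ball, not_lt, dist_comm, dist_eq_norm] at this
    exact this
  refine (hd.sub_const (π * conj c)).congr_of_eventuallyEq ?_
  filter_upwards [Metric.ball_mem_nhds c hr] with x hx
  rw [conj_gradPotential]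
  have hsplit := integral_inter_add_sdiff (μ := volume) (measurableSet_ball (x := c) (ε := r))
    (integrableOn_inv_sub hb x)
  rw [inter_eq_self_of_subset_right hball, integral_ball_inv_sub' hx, map_sub] at hsplit
  rw [← hsplit]; ring

end EulerPoisson

/-! ### Openness of the fluid domain in space-time and holomorphy of the velocity fields. -/

namespace EulerPoisson

variable {T : ℝ} {Ω : ℝ → Set ℂ} {v : ℝ → ℂ → ℂ} {P : ℝ → ℂ → ℝ} {z : ℝ → ℝ → ℂ}

lemma IsBoundaryParam.ne_of_mem {U : Set ℂ} {γ : ℝ → ℂ} (hb : IsBoundaryParam U γ) {x : ℂ}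
    (hx : x ∈ U) (α : ℝ) : γ α ≠ x := by
  intro h
  have h1 := hb.mem_frontier α
  rw [hb.isOpen.frontier_eq, h] at h1
  exact h1.2 hx

lemma IsBoundaryParam.continuous_deriv {U : Set ℂ} {γ : ℝ → ℂ} (hb : IsBoundaryParam U γ) :
    Continuous (deriv γ) := hb.contDiff.continuous_deriv (by norm_num)

/-- A point off the curve with nonzero winding number lies inside. -/
lemma IsBoundaryParam.mem_of_windingNumber_ne_zero {U : Set ℂ} {γ : ℝ → ℂ}
    (hb : IsBoundaryParam U γ) {w : ℂ} (hw : ∀ α ∈ Icc 0 (2 * π), γ α ≠ w)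
    (h : windingNumber γ w ≠ 0) : w ∈ U := by
  have h1 : w ∈ closure U := by
    by_contra hcon
    exact h (hb.winding_outside w hcon)
  rw [closure_eq_self_union_frontier, ← hb.range_eq] at h1
  rcases h1 with h1 | ⟨α, rfl⟩
  · exact h1
  · obtain ⟨β, hβ, hαβ⟩ := hb.periodic.exists_mem_Ico₀ (by positivity) α
    exact absurd hαβ.symm (hw β (Ico_subset_Icc_self hβ))

lemma IsSolution.continuous_deriv_z (sol : IsSolution T Ω v P z) :
    Continuous fun p : Ico 0 T × ℝ => deriv (z p.1) p.2 := by
  have hu : UniqueDiffOn ℝ (Ico 0 T ×ˢ (univ : Set ℝ)) :=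
    (uniqueDiffOn_Ico 0 T).prod uniqueDiffOn_univ
  have h1 := sol.contDiffOn_z.continuousOn_fderivWithin hu le_rfl
  have h2 : ∀ p : Ico 0 T × ℝ, deriv (z p.1) p.2 = fderivWithin ℝ (fun p : ℝ × ℝ => z p.1 p.2)
      (Ico 0 T ×ˢ univ) ((p.1 : ℝ), p.2) (0, 1) := by
    rintro ⟨s, α⟩
    have hd := ((sol.contDiffOn_z.differentiableOn one_ne_zero) ((s : ℝ), α)
      ⟨s.2, mem_univ _⟩).hasFDerivWithinAt
    have hc : HasDerivWithinAt (fun α : ℝ => ((s : ℝ), α)) ((0 : ℝ), (1 : ℝ)) univ α :=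
      (hasDerivWithinAt_const _ _ _).prodMk (hasDerivWithinAt_id _ _)
    have := hd.comp_hasDerivWithinAt α hc (fun a _ => ⟨s.2, mem_univ _⟩)
    rw [hasDerivWithinAt_univ] at this
    exact this.deriv
  simp_rw [h2]
  have h3 : Continuous fun p : Ico 0 T × ℝ => fderivWithin ℝ (fun p : ℝ × ℝ => z p.1 p.2)
      (Ico 0 T ×ˢ univ) ((p.1 : ℝ), p.2) :=
    h1.comp_continuous (by fun_prop) fun p => ⟨p.1.2, mem_univ _⟩
  exact h3.clm_apply continuous_const

lemma IsSolution.continuous_z (sol : IsSolution T Ω v P z) :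
    Continuous fun p : Ico 0 T × ℝ => z p.1 p.2 :=
  sol.contDiffOn_z.continuousOn.comp_continuous
    (f := fun p : Ico 0 T × ℝ => ((p.1 : ℝ), p.2)) (by fun_prop) fun p => ⟨p.1.2, mem_univ _⟩

/-- The fluid domain is open in space-time. -/
lemma IsSolution.eventually_mem (sol : IsSolution T Ω v P z) (t : Ico 0 T) {x : ℂ}
    (hx : x ∈ Ω t) : ∀ᶠ p : Ico 0 T × ℂ in 𝓝 (t, x), p.2 ∈ Ω p.1 := by
  have hb := sol.boundary t t.2
  obtain ⟨δ, hδ, hball⟩ := Metric.isOpen_iff.1 hb.isOpen x hx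
  obtain ⟨M, hM0, hM⟩ := exists_norm_le_of_periodic hb.continuous_deriv
    (deriv_periodic hb.periodic)
  have hdist : ∀ α, δ ≤ ‖z t α - x‖ := by
    intro α
    by_contra hcon
    exact hb.ne_of_mem (hball (by rw [Metric.mem_ball, dist_eq_norm]; exact not_le.1 hcon)) α rfl
  have hzc := sol.continuous_z
  have hdc := sol.continuous_deriv_z
  -- Compactness of one period makes the distance to the curve and the speed of the parametrization
  -- uniformly controlled for nearby times and points.
  have hev : ∀ᶠ p : Ico 0 T × ℂ in 𝓝 (t, x), ∀ α ∈ Icc (0 : ℝ) (2 * π),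
      δ / 2 < ‖z p.1 α - p.2‖ ∧ ‖deriv (z p.1) α‖ < M + 1 := by
    refine isCompact_Icc.eventually_forall_of_forall_eventually fun α _ => ?_
    have c1 : Continuous fun q : (Ico 0 T × ℂ) × ℝ => ‖z q.1.1 q.2 - q.1.2‖ :=
      ((hzc.comp (f := fun q : (Ico 0 T × ℂ) × ℝ => (q.1.1, q.2)) (by fun_prop)).sub
        (by fun_prop)).norm
    have c2 : Continuous fun q : (Ico 0 T × ℂ) × ℝ => ‖deriv (z q.1.1) q.2‖ :=
      (hdc.comp (f := fun q : (Ico 0 T × ℂ) × ℝ => (q.1.1, q.2)) (by fun_prop)).norm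
    have h1 : δ / 2 < ‖z t α - x‖ := by linarith [hdist α]
    have h2 : ‖deriv (z t) α‖ < M + 1 := by linarith [hM α]
    exact ((c1.tendsto ((t, x), α)).eventually (lt_mem_nhds h1)).and
      ((c2.tendsto ((t, x), α)).eventually (gt_mem_nhds h2))
  have hW : ContinuousAt (fun p : Ico 0 T × ℂ => ∫ α in (0 : ℝ)..(2 * π),
      deriv (z p.1) α / (z p.1 α - p.2)) (t, x) := by
    refine intervalIntegral.continuousAt_of_dominated_interval
      (bound := fun _ => (M + 1) / (δ / 2)) ?_ ?_ (by simp) ?_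
    · refine Eventually.of_forall fun p => Measurable.aestronglyMeasurable ?_
      have hbp := sol.boundary p.1 p.1.2
      exact hbp.continuous_deriv.measurable.div (hbp.contDiff.continuous.measurable.sub_const _)
    · filter_upwards [hev] with p hp
      refine Eventually.of_forall fun α hα => ?_
      rw [uIoc_of_le (by positivity)] at hα
      have := hp α (Ioc_subset_Icc_self hα)
      rw [norm_div]
      gcongr
      · exact this.2.le
      · exact this.1.le
    · refine Eventually.of_forall fun α _ => ?_
      refine ContinuousAt.div ?_ ?_ ?_
      · exact (hdc.comp (f := fun p : Ico 0 T × ℂ => (p.1, α)) (by fun_prop)).continuousAt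
      · exact ((hzc.comp (f := fun p : Ico 0 T × ℂ => (p.1, α)) (by fun_prop)).sub
          (by fun_prop)).continuousAt
      · exact sub_ne_zero.2 (hb.ne_of_mem hx α)
  have hne : windingNumber (z t) x ≠ 0 := by rw [hb.winding_inside x hx]; exact one_ne_zero
  -- Membership is detected by the winding number: it equals one at `(t, x)` and varies
  -- continuously, so it stays nonzero nearby, and off the curve this forces the point to lie
  -- inside.
  have hW2 : ContinuousAt (fun p : Ico 0 T × ℂ => windingNumber (z p.1) p.2) (t, x) :=
    continuousAt_const.mul hW
  filter_upwards [hev, hW2.eventually_ne hne] with p hp1 hp2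
  refine (sol.boundary p.1 p.1.2).mem_of_windingNumber_ne_zero (fun α hα h => ?_) hp2
  have := (hp1 α hα).1
  rw [h, sub_self, norm_zero] at this
  linarith

lemma IsSolution.contDiffOn_v_slice (sol : IsSolution T Ω v P z) {t : ℝ} (ht : t ∈ Ico 0 T) :
    ContDiffOn ℝ 1 (v t) (closure (Ω t)) := by
  have : ContDiffOn ℝ 1 (fun x : ℂ => (t, x)) (closure (Ω t)) := by fun_prop
  exact sol.contDiffOn_v.comp this fun x hx => ⟨ht, hx⟩

/-- The complex conjugate of the velocity is holomorphic. -/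
lemma IsSolution.differentiableOn_conj_v (sol : IsSolution T Ω v P z) {t : ℝ}
    (ht : t ∈ Ico 0 T) : DifferentiableOn ℂ (fun x => conj (v t x)) (Ω t) := by
  intro x hx
  have hnhds : closure (Ω t) ∈ 𝓝 x :=
    mem_of_superset ((sol.boundary t ht).isOpen.mem_nhds hx) subset_closure
  have hd : DifferentiableAt ℝ (v t) x :=
    ((sol.contDiffOn_v_slice ht).differentiableOn one_ne_zero).differentiableAt hnhds
  have hF : HasFDerivAt (fun x => conj (v t x))
      ((Complex.conjCLE : ℂ →L[ℝ] ℂ).comp (fderiv ℝ (v t) x)) x :=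
    (Complex.conjCLE : ℂ →L[ℝ] ℂ).hasFDerivAt.comp x hd.hasFDerivAt
  refine DifferentiableAt.differentiableWithinAt
    (differentiableAt_complex_iff_differentiableAt_real.2 ⟨hF.differentiableAt, ?_⟩)
  have h1 := sol.div_eq_zero t ht x hx
  have h2 := sol.curl_eq_zero t ht x hx
  rw [divergence] at h1
  rw [curl] at h2
  rw [hF.fderiv]
  -- The two components of the Cauchy–Riemann equation for `conj v` are the vanishing of the curl
  -- and of the divergence.
  apply Complex.ext
  · simp; linarith
  · simp; linarith

/-- The time derivative of the conjugate velocity is holomorphic. -/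
lemma IsSolution.differentiableOn_conj_v_t (sol : IsSolution T Ω v P z) {t : ℝ}
    (ht : t ∈ Ico 0 T) :
    DifferentiableOn ℂ (fun x => conj (derivWithin (fun s => v s x) (Ico 0 T) t)) (Ω t) := by
  intro x₀ hx₀
  obtain ⟨δ, hδ, hmem⟩ := Metric.eventually_nhds_iff_ball.1 (sol.eventually_mem ⟨t, ht⟩ hx₀)
  have hmem' : ∀ s ∈ Ico 0 T, s ∈ Metric.ball t δ → ∀ y ∈ Metric.ball x₀ δ, y ∈ Ω s := by
    intro s hs hst y hy
    exact hmem ((⟨s, hs⟩ : Ico 0 T), y) (by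
      rw [Metric.mem_ball, Prod.dist_eq]
      exact max_lt hst hy)
  set S := Ico 0 T ∩ Metric.ball t δ with hS
  set N : Set (ℝ × ℂ) := S ×ˢ Metric.ball x₀ δ with hN
  have htS : t ∈ S := ⟨ht, Metric.mem_ball_self hδ⟩
  set f : ℝ × ℂ → ℂ := fun p => v p.1 p.2 with hf
  have hcd : ContDiffOn ℝ 1 f N := sol.contDiffOn_v.mono fun p hp =>
    ⟨hp.1.1, subset_closure (hmem' p.1 hp.1.1 hp.1.2 p.2 hp.2)⟩
  have huS : UniqueDiffOn ℝ S := (uniqueDiffOn_Ico 0 T).inter Metric.isOpen_ball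
  have hu : UniqueDiffOn ℝ N := huS.prod Metric.isOpen_ball.uniqueDiffOn
  have hconv : Convex ℝ N := ((convex_Ico 0 T).inter (convex_ball t δ)).prod (convex_ball x₀ δ)
  set D := fderivWithin ℝ f N with hD
  have hDc : ContinuousOn D N := hcd.continuousOn_fderivWithin hu le_rfl
  have hDd : ∀ p ∈ N, HasFDerivWithinAt f (D p) N p := fun p hp =>
    (hcd.differentiableOn one_ne_zero p hp).hasFDerivWithinAt
  have hder : ∀ y ∈ Metric.ball x₀ δ,
      derivWithin (fun s => v s y) (Ico 0 T) t = D (t, y) (1, 0) := by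
    intro y hy
    have hc : HasDerivWithinAt (fun s : ℝ => (s, y)) ((1 : ℝ), (0 : ℂ)) S t :=
      (hasDerivWithinAt_id _ _).prodMk (hasDerivWithinAt_const _ _ _)
    have hm : MapsTo (fun s : ℝ => (s, y)) S N := fun s hs => ⟨hs, hy⟩
    have h1 := (hDd (t, y) ⟨htS, hy⟩).comp_hasDerivWithinAt t hc hm
    have h2 := (hasDerivWithinAt_inter (Metric.ball_mem_nhds t hδ)).1 h1
    exact h2.derivWithin (uniqueDiffOn_Ico 0 T t ht)
  -- The difference quotients of `conj v` in time are holomorphic in space, so by Weierstrass's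
  -- theorem local uniform convergence suffices. Only `s > t` is used, so that `t = 0` is covered.
  have hlim : TendstoLocallyUniformlyOn
      (fun (s : ℝ) (y : ℂ) => ((s - t : ℝ) : ℂ)⁻¹ * (conj (v s y) - conj (v t y)))
      (fun y => conj (D (t, y) (1, 0))) (𝓝[>] t) (Metric.ball x₀ δ) := by
    rw [Metric.tendstoLocallyUniformlyOn_iff]
    intro ε hε y₀ hy₀
    obtain ⟨η, hη, hηD⟩ := Metric.continuousWithinAt_iff.1 (hDc (t, y₀) ⟨htS, hy₀⟩) (ε / 4)
      (by positivity)
    refine ⟨Metric.ball x₀ δ ∩ Metric.ball y₀ η, inter_mem self_mem_nhdsWithin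
      (nhdsWithin_le_nhds (Metric.ball_mem_nhds y₀ hη)), ?_⟩
    have hpos : 0 < min (T - t) (min δ η) := lt_min (by linarith [ht.2]) (lt_min hδ hη)
    filter_upwards [Ioo_mem_nhdsGT (show t < t + min (T - t) (min δ η) by linarith)]
      with s hs y hy
    have hst : 0 < s - t := by linarith [hs.1]
    have hs1 : s - t < T - t := by linarith [hs.2, min_le_left (T - t) (min δ η)]
    have hs2 : s - t < δ := by
      linarith [hs.2, min_le_right (T - t) (min δ η), min_le_left δ η]
    have hs3 : s - t < η := by
      linarith [hs.2, min_le_right (T - t) (min δ η), min_le_right δ η]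
    have hsS : s ∈ S := ⟨⟨by linarith [ht.1], by linarith⟩, by
      rw [Metric.mem_ball, Real.dist_eq, abs_of_pos hst]; exact hs2⟩
    have hyη := hy.2
    have hball : ∀ p ∈ N ∩ Metric.ball (t, y₀) η, ‖D p - D (t, y₀)‖ ≤ ε / 4 := fun p hp => by
      rw [← dist_eq_norm]; exact (hηD hp.1 hp.2).le
    have hp : (s, y) ∈ N ∩ Metric.ball (t, y₀) η := ⟨⟨hsS, hy.1⟩, by
      rw [Metric.mem_ball, Prod.dist_eq]
      refine max_lt ?_ hyη
      rw [Real.dist_eq, abs_of_pos hst]; exact hs3⟩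
    have hq : (t, y) ∈ N ∩ Metric.ball (t, y₀) η := ⟨⟨htS, hy.1⟩, by
      rw [Metric.mem_ball, Prod.dist_eq]
      refine max_lt ?_ hyη
      rw [dist_self]; exact hη⟩
    -- The space-time derivative is within `ε/4` of its value at `(t, y₀)` on a convex
    -- neighbourhood, which controls the quotient uniformly in `y`. This error and that of replacing
    -- `y` by `y₀` add up to `ε/2`.
    have hmv := Convex.norm_image_sub_le_of_norm_hasFDerivWithin_le'
      (fun p hp => (hDd p hp.1).mono inter_subset_left) hball
      (hconv.inter (convex_ball (t, y₀) η)) hq hp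
    have e1 : ((s, y) : ℝ × ℂ) - (t, y) = (s - t) • ((1 : ℝ), (0 : ℂ)) := by
      ext <;> simp
    have e2 : ‖((1 : ℝ), (0 : ℂ))‖ = 1 := by simp [Prod.norm_def]
    rw [e1, map_smul, norm_smul, e2, mul_one, Real.norm_of_nonneg hst.le] at hmv
    have hD2 : ‖D (t, y) (1, 0) - D (t, y₀) (1, 0)‖ ≤ ε / 4 := by
      have := (D (t, y) - D (t, y₀)).le_opNorm ((1 : ℝ), (0 : ℂ))
      rw [e2, mul_one] at this
      exact this.trans (hball _ hq)
    have hst' : ((s - t : ℝ) : ℂ) ≠ 0 := by exact_mod_cast hst.ne'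
    set A := D (t, y) (1, 0)
    set B := D (t, y₀) (1, 0)
    have e3 : conj A - ((s - t : ℝ) : ℂ)⁻¹ * (conj (v s y) - conj (v t y))
        = conj ((A - B) - ((s - t : ℝ) : ℂ)⁻¹ * (f (s, y) - f (t, y) - (s - t) • B)) := by
      rw [map_sub, map_sub, map_mul, map_inv₀, Complex.conj_ofReal, map_sub, map_sub,
        Complex.real_smul, map_mul, Complex.conj_ofReal]
      field_simp
      ring
    rw [dist_eq_norm, e3, RCLike.norm_conj]
    refine lt_of_le_of_lt (norm_sub_le _ _) ?_
    rw [norm_mul, norm_inv, Complex.norm_real, Real.norm_of_nonneg hst.le]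
    have : (s - t)⁻¹ * ‖f (s, y) - f (t, y) - (s - t) • B‖ ≤ (s - t)⁻¹ * (ε / 4 * (s - t)) := by
      gcongr
    have e4 : (s - t)⁻¹ * (ε / 4 * (s - t)) = ε / 4 := by field_simp
    linarith
  have hdiff : DifferentiableOn ℂ (fun y => conj (D (t, y) (1, 0))) (Metric.ball x₀ δ) := by
    refine hlim.differentiableOn ?_ Metric.isOpen_ball
    have hpos : 0 < min (T - t) δ := lt_min (by linarith [ht.2]) hδ
    filter_upwards [Ioo_mem_nhdsGT (show t < t + min (T - t) δ by linarith)] with s hs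
    have hst : 0 < s - t := by linarith [hs.1]
    have hs1 : s ∈ Ico 0 T :=
      ⟨by linarith [ht.1], by linarith [hs.2, min_le_left (T - t) δ]⟩
    have hs2 : s ∈ Metric.ball t δ := by
      rw [Metric.mem_ball, Real.dist_eq, abs_of_pos hst]
      linarith [hs.2, min_le_right (T - t) δ]
    refine DifferentiableOn.const_mul (DifferentiableOn.sub ?_ ?_) _
    · exact (sol.differentiableOn_conj_v hs1).mono fun y hy => hmem' s hs1 hs2 y hy
    · exact (sol.differentiableOn_conj_v ht).mono fun y hy => hmem' t ht htS.2 y hy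
  refine ((hdiff.differentiableAt (Metric.ball_mem_nhds x₀ hδ)).congr_of_eventuallyEq
    ?_).differentiableWithinAt
  filter_upwards [Metric.ball_mem_nhds x₀ hδ] with y hy
  rw [hder y hy]

end EulerPoisson

/-! ### The pressure as a harmonic function minus squares. -/

namespace EulerPoisson

variable {T : ℝ} {Ω : ℝ → Set ℂ} {v : ℝ → ℂ → ℂ} {P : ℝ → ℂ → ℝ} {z : ℝ → ℝ → ℂ}

lemma IsSolution.hasFDerivAt_P (sol : IsSolution T Ω v P z) {t : ℝ} (ht : t ∈ Ico 0 T) {x : ℂ}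
    (hx : x ∈ Ω t) : HasFDerivAt (P t) (innerSL ℝ (gradient (P t) x)) x := by
  have hnhds : closure (Ω t) ∈ 𝓝 x :=
    mem_of_superset ((sol.boundary t ht).isOpen.mem_nhds hx) subset_closure
  exact (((sol.contDiffOn_P t ht).differentiableOn one_ne_zero).differentiableAt
    hnhds).hasGradientAt.hasFDerivAt

/-- The momentum equation in complex form. -/
lemma IsSolution.conj_gradient_P (sol : IsSolution T Ω v P z) {t : ℝ} (ht : t ∈ Ico 0 T) {x : ℂ}
    (hx : x ∈ Ω t) : conj (gradient (P t) x)
      = -(conj (derivWithin (fun s => v s x) (Ico 0 T) t)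
        + deriv (fun x => conj (v t x)) x * v t x + conj (gradPotential (Ω t) x)) := by
  have hmom := sol.momentum t ht x hx
  have hU := (sol.boundary t ht).isOpen
  have hF := (((sol.differentiableOn_conj_v ht).differentiableAt
    (hU.mem_nhds hx)).hasDerivAt).hasFDerivAt.restrictScalars ℝ
  have hnhds : closure (Ω t) ∈ 𝓝 x := mem_of_superset (hU.mem_nhds hx) subset_closure
  have hd : DifferentiableAt ℝ (v t) x :=
    ((sol.contDiffOn_v_slice ht).differentiableOn one_ne_zero).differentiableAt hnhds
  have hF2 : HasFDerivAt (fun x => conj (v t x))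
      ((Complex.conjCLE : ℂ →L[ℝ] ℂ).comp (fderiv ℝ (v t) x)) x :=
    (Complex.conjCLE : ℂ →L[ℝ] ℂ).hasFDerivAt.comp x hd.hasFDerivAt
  -- The derivative of `conj v` is multiplication by a complex number, so convection becomes `conj
  -- ((v·∇)v) = F' v`. As `v = conj F`, this is the conjugate gradient of `|F|²/2`.
  have h1 := congrArg (fun A : ℂ →L[ℝ] ℂ => A (v t x)) (hF.unique hF2)
  have h2 : deriv (fun x => conj (v t x)) x * v t x = conj (fderiv ℝ (v t) x (v t x)) := by
    have h3 : v t x * deriv (fun x => conj (v t x)) x = conj (fderiv ℝ (v t) x (v t x)) := by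
      simpa using h1
    rw [← h3, mul_comm]
  have h4 : gradient (P t) x = -(derivWithin (fun s => v s x) (Ico 0 T) t
      + fderiv ℝ (v t) x (v t x) + gradPotential (Ω t) x) := by
    rw [hmom]; ring
  rw [h4, h2, map_neg, map_add, map_add]

/-- The pressure is, up to explicit squares, the real part of a holomorphic function. -/
lemma IsSolution.exists_re_eq (sol : IsSolution T Ω v P z) {t : ℝ} (ht : t ∈ Ico 0 T) {c : ℂ}
    {r : ℝ} (hball : Metric.ball c r ⊆ Ω t) (a b : ℂ) :
    ∃ L : ℂ → ℂ, DifferentiableOn ℂ L (Metric.ball c r) ∧ ∀ x ∈ Metric.ball c r,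
      P t x + ‖conj (v t x) - a‖ ^ 2 / 2 + π / 2 * ‖x - b‖ ^ 2 = (L x).re := by
  have hb := sol.boundary t ht
  have hF := sol.differentiableOn_conj_v ht
  set F : ℂ → ℂ := fun x => conj (v t x) with hFdef
  -- The holomorphic remainder of the momentum equation once the gradients of the two squares are
  -- split off; the terms in `a` and `b` come from recentring the squares. A primitive `g` of `K`
  -- then makes `m` below have zero gradient.
  set K : ℂ → ℂ := fun x => conj (derivWithin (fun s => v s x) (Ico 0 T) t)
    + (conj (gradPotential (Ω t) x) - π * conj x) + deriv F x * conj a + π * conj b with hK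
  have hKd : DifferentiableOn ℂ K (Ω t) :=
    (((sol.differentiableOn_conj_v_t ht).add
      (differentiableOn_conj_gradPotential_sub hb.isOpen hb.isBounded)).add
      ((hF.deriv hb.isOpen).mul_const _)).add_const _
  obtain ⟨g, hg⟩ := (hKd.mono hball).isExactOn_ball
  set m : ℂ → ℝ := fun x => P t x + ‖F x - a‖ ^ 2 / 2 + π / 2 * ‖x - b‖ ^ 2
    + (g x).re with hm
  have hmd : ∀ x ∈ Metric.ball c r, HasFDerivAt m (0 : ℂ →L[ℝ] ℝ) x := by
    intro x hx
    have hxU := hball hx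
    have d1 := sol.hasFDerivAt_P ht hxU
    have d2 := ((((hF.differentiableAt (hb.isOpen.mem_nhds hxU)).hasDerivAt).hasFDerivAt.restrictScalars
      ℝ).sub_const a).norm_sq.const_mul (1 / 2 : ℝ)
    have d3 := ((hasFDerivAt_id (𝕜 := ℝ) x).sub_const b).norm_sq.const_mul (π / 2)
    have d4 := Complex.reCLM.hasFDerivAt.comp x (HasFDerivAt.restrictScalars ℝ (hg x hx).hasFDerivAt)
    have d5 := ((d1.add d2).add d3).add d4
    convert! d5 using 1
    · ext y
      simp only [hm, Pi.add_apply, Function.comp_apply, Complex.reCLM_apply, id_eq]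
      ring
    · have hgrad := sol.conj_gradient_P ht hxU
      have hv : v t x = conj (F x) := by rw [hFdef]; simp
      rw [hv] at hgrad
      refine ContinuousLinearMap.ext fun w => ?_
      have key : (conj (gradient (P t) x) * w).re + (conj (F x - a) * (deriv F x * w)).re
          + π * (conj (x - b) * w).re + (K x * w).re = 0 := by
        have e : ((conj (gradient (P t) x) * w) + (conj (F x - a) * (deriv F x * w))
          + π * (conj (x - b) * w) + (K x * w)) = 0 := by
          rw [hgrad, hK, map_sub, map_sub]
          ring
        have := congrArg Complex.re e
        simpa [Complex.re_ofReal_mul] using this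
      simp only [Complex.inner, add_apply, innerSL_apply_apply,
        smul_apply, ContinuousLinearMap.comp_apply,
        ContinuousLinearMap.coe_restrictScalars', Complex.reCLM_apply,
        ContinuousLinearMap.toSpanSingleton_apply, zero_apply, smul_eq_mul,
        ContinuousLinearMap.id_apply, nsmul_eq_mul]
      rw [mul_comm (conj (F x - a)), mul_comm (conj (x - b)), mul_comm (K x),
        mul_comm (deriv F x) w] at key
      rw [mul_comm w (conj (gradient (P t) x))]
      push_cast
      simp only [id_eq]
      linarith
  have hconst : ∀ x ∈ Metric.ball c r, m x = m c := by
    intro x hx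
    have hc : c ∈ Metric.ball c r := Metric.mem_ball_self (Metric.pos_of_mem_ball hx)
    exact Metric.isOpen_ball.is_const_of_fderiv_eq_zero (convex_ball c r).isPreconnected
      (fun y hy => (hmd y hy).differentiableAt.differentiableWithinAt)
      (fun y hy => (hmd y hy).fderiv) hx hc
  refine ⟨fun x => (m c : ℂ) - g x, fun x hx =>
    ((hg x hx).differentiableAt.const_sub _).differentiableWithinAt, fun x hx => ?_⟩
  have := hconst x hx
  rw [Complex.sub_re, Complex.ofReal_re, ← this, hm]
  ring

/-- The pressure in Riemann mapping coordinates is harmonic up to explicit squares. -/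
lemma IsSolution.harmonicContOnCl (sol : IsSolution T Ω v P z) {t : ℝ} (ht : t ∈ Ico 0 T)
    {Ψ : ℂ → ℂ} (hΨ : DiffContOnCl ℂ Ψ (Metric.ball 0 1)) (hm : MapsTo Ψ (Metric.ball 0 1) (Ω t))
    (hm' : MapsTo Ψ (Metric.closedBall 0 1) (closure (Ω t))) (a b : ℂ) :
    InnerProductSpace.HarmonicContOnCl (fun ζ => P t (Ψ ζ) + ‖conj (v t (Ψ ζ)) - a‖ ^ 2 / 2
      + π / 2 * ‖Ψ ζ - b‖ ^ 2) (Metric.ball 0 1) := by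
  constructor
  · intro ζ hζ
    obtain ⟨r, hr, hball⟩ := Metric.isOpen_iff.1 (sol.boundary t ht).isOpen _ (hm hζ)
    obtain ⟨L, hL, hLeq⟩ := sol.exists_re_eq ht hball a b
    have hΨan : AnalyticAt ℂ Ψ ζ :=
      hΨ.differentiableOn.analyticAt (Metric.isOpen_ball.mem_nhds hζ)
    have hLan : AnalyticAt ℂ L (Ψ ζ) := hL.analyticAt (Metric.ball_mem_nhds _ hr)
    have hh := (hLan.comp hΨan).harmonicAt_re
    refine (InnerProductSpace.harmonicAt_congr_nhds ?_).2 hh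
    filter_upwards [hΨan.continuousAt.preimage_mem_nhds (Metric.ball_mem_nhds _ hr)] with y hy
    exact hLeq _ hy
  · rw [closure_ball _ one_ne_zero]
    have hc := hΨ.continuousOn_ball
    have h1 := (sol.contDiffOn_P t ht).continuousOn.comp hc hm'
    have h2 := (sol.contDiffOn_v_slice ht).continuousOn.comp hc hm'
    have h3 : ContinuousOn (fun ζ => conj (v t (Ψ ζ))) (Metric.closedBall 0 1) :=
      Complex.continuous_conj.comp_continuousOn h2
    exact (h1.add (((h3.sub continuousOn_const).norm.pow 2).div_const 2)).add
      (continuousOn_const.mul ((hc.sub continuousOn_const).norm.pow 2))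

lemma IsSolution.diffContOnCl_conj_v_comp (sol : IsSolution T Ω v P z) {t : ℝ} (ht : t ∈ Ico 0 T)
    {Ψ : ℂ → ℂ} (hΨ : DiffContOnCl ℂ Ψ (Metric.ball 0 1)) (hm : MapsTo Ψ (Metric.ball 0 1) (Ω t))
    (hm' : MapsTo Ψ (Metric.closedBall 0 1) (closure (Ω t))) :
    DiffContOnCl ℂ (fun ζ => conj (v t (Ψ ζ))) (Metric.ball 0 1) := by
  refine ⟨(sol.differentiableOn_conj_v ht).comp hΨ.differentiableOn hm, ?_⟩
  rw [closure_ball _ one_ne_zero]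
  exact Complex.continuous_conj.comp_continuousOn
    ((sol.contDiffOn_v_slice ht).continuousOn.comp hΨ.continuousOn_ball hm')

end EulerPoisson

/-! ### The boundary derivative of the pressure. -/

namespace EulerPoisson

variable {T : ℝ} {Ω : ℝ → Set ℂ} {v : ℝ → ℂ → ℂ} {P : ℝ → ℂ → ℝ} {z : ℝ → ℝ → ℂ}

/-- The quotient is the squared difference quotient times `1 - r`. So the squares added to the
pressure, centred at the boundary point, leave no trace in the radial derivative. -/
lemma tendsto_norm_sub_sq_div {f : ℝ → ℂ} {f' : ℂ} (hf : HasDerivWithinAt f f' (Iic 1) 1) :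
    Tendsto (fun r => ‖f r - f 1‖ ^ 2 / (1 - r)) (𝓝[<] 1) (𝓝 0) := by
  have h := (hasDerivWithinAt_iff_tendsto_slope' (s := Iio 1) (by simp)).1
    (hf.mono Iio_subset_Iic_self)
  have h2 : Tendsto (fun r : ℝ => 1 - r) (𝓝[<] 1) (𝓝 0) := by
    have : Tendsto (fun r : ℝ => 1 - r) (𝓝 1) (𝓝 (1 - 1)) := Continuous.tendsto (by fun_prop) 1
    rw [sub_self] at this
    exact this.mono_left nhdsWithin_le_nhds
  have h3 := (h.norm.pow 2).mul h2
  rw [mul_zero] at h3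
  refine h3.congr' ?_
  filter_upwards [eventually_lt_one] with r hr
  have hne : 1 - r ≠ 0 := by linarith [hr.2]
  rw [slope_def_module, norm_smul, norm_inv, Real.norm_eq_abs, mul_pow, inv_pow, sq_abs]
  have e : (r - 1) ^ 2 = (1 - r) ^ 2 := by ring
  rw [e]
  field_simp

/-- The boundary derivative of the pressure in Riemann mapping coordinates. -/
lemma IsSolution.fderivWithin_eq_integral (sol : IsSolution T Ω v P z) {t : ℝ} (ht : t ∈ Ico 0 T)
    {Ψ : ℂ → ℂ} (hΨ : DiffContOnCl ℂ Ψ (Metric.ball 0 1)) (hm : MapsTo Ψ (Metric.ball 0 1) (Ω t))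
    (hm' : MapsTo Ψ (Metric.closedBall 0 1) (closure (Ω t)))
    (hbd : ∀ θ, Ψ (cis θ) ∈ frontier (Ω t)) (hZ : ContDiff ℝ 1 fun θ => Ψ (cis θ))
    (hV : ContDiff ℝ 1 fun θ => v t (Ψ (cis θ))) (θ : ℝ) :
    fderivWithin ℝ (P t) (closure (Ω t)) (Ψ (cis θ))
        (Complex.I * deriv (fun θ => Ψ (cis θ)) θ)
      = 1 / 8 * (∫ β in (0 : ℝ)..(2 * π), cscKernel (fun θ => Ψ (cis θ)) θ β)
        + 1 / (8 * π) * ∫ β in (0 : ℝ)..(2 * π), cscKernel (fun θ => v t (Ψ (cis θ))) θ β := by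
  set Z : ℝ → ℂ := fun θ => Ψ (cis θ) with hZdef
  set V : ℝ → ℂ := fun θ => v t (Ψ (cis θ)) with hVdef
  have hZp : Function.Periodic Z (2 * π) := comp_cis_periodic Ψ
  have hVp : Function.Periodic V (2 * π) := comp_cis_periodic fun ζ => v t (Ψ ζ)
  have hf := sol.diffContOnCl_conj_v_comp ht hΨ hm hm'
  have hVc : ContDiff ℝ 1 fun θ => conj (v t (Ψ (cis θ))) := Complex.conjCLE.contDiff.comp hV
  -- The constants `a` and `b` are the boundary values at `cis θ` itself, so the harmonic function
  -- vanishes there and its boundary values are quadratic in the chord.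
  have hu := sol.harmonicContOnCl ht hΨ hm hm' (conj (V θ)) (Z θ)
  set D := fderivWithin ℝ (P t) (closure (Ω t)) (Ψ (cis θ)) with hD
  have hcl : Z θ ∈ closure (Ω t) := frontier_subset_closure (hbd θ)
  -- the radial derivatives
  have hR := hasDerivWithinAt_radial hΨ hZ θ
  have hRf := hasDerivWithinAt_radial hf hVc θ
  have hone : Ψ ((1 : ℝ) * cis θ) = Z θ := by rw [hZdef]; simp
  have hP : HasDerivWithinAt (fun r : ℝ => P t (Ψ (r * cis θ))) (D (-Complex.I * deriv Z θ))
      (Icc 0 1) 1 := by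
    have h1 : HasFDerivWithinAt (P t) D (closure (Ω t)) (Ψ ((1 : ℝ) * cis θ)) := by
      rw [hone]
      exact ((sol.contDiffOn_P t ht).differentiableOn one_ne_zero _ hcl).hasFDerivWithinAt
    have hmaps : MapsTo (fun r : ℝ => Ψ (r * cis θ)) (Icc 0 1) (closure (Ω t)) := by
      intro r hr
      exact hm' (by simpa [abs_of_nonneg hr.1] using hr.2)
    exact h1.comp_hasDerivWithinAt 1 (hR.mono Icc_subset_Iic_self) hmaps
  -- The outward radial derivative of `Ψ` is `-i Z'`; dividing by `1 - r` rather than `r - 1` turns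
  -- this into the inward direction `i Z'`.
  have hslope : Tendsto (fun r : ℝ => P t (Ψ (r * cis θ)) / (1 - r)) (𝓝[<] 1)
      (𝓝 (D (Complex.I * deriv Z θ))) := by
    have h1 := ((hasDerivWithinAt_iff_tendsto_slope' (s := Ico 0 1) (by simp)).1
      (hP.mono Ico_subset_Icc_self)).neg
    rw [neg_mul, map_neg, neg_neg] at h1
    rw [nhdsWithin_Ico_eq_nhdsLT (by norm_num)] at h1
    refine h1.congr' ?_
    filter_upwards [eventually_lt_one] with r hr
    have hne : 1 - r ≠ 0 := by linarith [hr.2]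
    have hne' : r - 1 ≠ 0 := by linarith [hr.2]
    rw [slope_def_field, hone, sol.pressure_boundary t ht _ (hbd θ), sub_zero]
    field_simp
    ring
  have hleft := (hslope.add ((tendsto_norm_sub_sq_div hRf).const_mul (1 / 2))).add
    ((tendsto_norm_sub_sq_div hR).const_mul (π / 2))
  rw [mul_zero, mul_zero, add_zero, add_zero] at hleft
  -- the Poisson integral
  obtain ⟨C₁, hC₁, hC₁'⟩ := exists_norm_sub_le_chord hZ hZp
  obtain ⟨C₂, hC₂, hC₂'⟩ := exists_norm_sub_le_chord hV hVp
  set k : ℝ → ℝ := fun β => ‖V (θ + β) - V θ‖ ^ 2 / 2 + π / 2 * ‖Z (θ + β) - Z θ‖ ^ 2 with hk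
  have hVcont := hV.continuous
  have hZcont := hZ.continuous
  have hkc : Continuous k := by fun_prop
  have hkb : ∀ β, |k β| ≤ (C₂ ^ 2 / 2 + π / 2 * C₁ ^ 2) * ‖cis β - 1‖ ^ 2 := by
    intro β
    rw [abs_of_nonneg (by positivity)]
    calc k β ≤ (C₂ * ‖cis β - 1‖) ^ 2 / 2 + π / 2 * (C₁ * ‖cis β - 1‖) ^ 2 := by
          simp only [hk]
          gcongr
          · exact hC₂' θ β
          · exact hC₁' θ β
      _ = _ := by ring
  have hright := (tendsto_integral_diskPoisson_div hkc hkb).const_mul (2 * π)⁻¹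
  -- One harmonic function at radius `r`, divided by `1 - r`, is computed both from its interior
  -- expression and from the Poisson formula.
  have hkey := tendsto_nhds_unique hleft (hright.congr' ?_)
  · rw [hkey]
    have e : ∀ β, 2 * (k β / ‖cis β - 1‖ ^ 2)
        = 1 / 4 * cscKernel V θ (θ + β) + π / 4 * cscKernel Z θ (θ + β) := by
      intro β
      rw [cscKernel_add, cscKernel_add]
      simp only [hk]
      ring
    have hi : ∀ {g : ℝ → ℂ}, ContDiff ℝ 1 g → Function.Periodic g (2 * π) →
        IntervalIntegrable (fun β => cscKernel g θ (θ + β)) volume 0 (2 * π) := by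
      intro g hg hp
      have := (intervalIntegrable_cscKernel hg hp θ (θ + 0) (θ + 2 * π)).comp_add_left θ
      simpa using this
    simp only [e]
    rw [intervalIntegral.integral_add ((hi hV hVp).const_mul _) ((hi hZ hZp).const_mul _),
      intervalIntegral.integral_const_mul, intervalIntegral.integral_const_mul,
      ← integral_cscKernel hVp, ← integral_cscKernel hZp]
    field_simp
    ring
  · filter_upwards [eventually_lt_one] with r hr
    have h1 := integral_diskPoisson_mul_of_harmonic hu hr.1.le hr.2 θ
    have e : ∀ β, P t (Ψ (cis (θ + β))) + ‖conj (v t (Ψ (cis (θ + β)))) - conj (V θ)‖ ^ 2 / 2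
        + π / 2 * ‖Ψ (cis (θ + β)) - Z θ‖ ^ 2 = k β := by
      intro β
      rw [sol.pressure_boundary t ht _ (hbd _), ← map_sub, RCLike.norm_conj, zero_add]
    simp only [e] at h1
    rw [h1]
    have hne : 1 - r ≠ 0 := by linarith [hr.2]
    simp only [Complex.ofReal_one, one_mul]
    field_simp
    ring

end EulerPoisson

/-! ### Assembly of the formula in Riemann mapping coordinates. -/

namespace EulerPoisson

variable {T : ℝ} {Ω : ℝ → Set ℂ} {v : ℝ → ℂ → ℂ} {P : ℝ → ℂ → ℝ} {z : ℝ → ℝ → ℂ}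

lemma IsRiemannCoordinate.contDiff_symm {U : Set ℂ} {γ : ℝ → ℂ} {x₀ : ℂ} {Φ : ℂ → ℂ}
    {h : ℝ ≃ₜ ℝ} (hR : IsRiemannCoordinate U γ x₀ Φ h) : ContDiff ℝ 1 h.symm :=
  h.contDiff_symm_deriv (fun x => (hR.deriv_pos x).ne')
    (fun x => (hR.contDiff.differentiable one_ne_zero x).hasDerivAt) hR.contDiff

lemma IsRiemannCoordinate.hasDerivAt_symm {U : Set ℂ} {γ : ℝ → ℂ} {x₀ : ℂ} {Φ : ℂ → ℂ}
    {h : ℝ ≃ₜ ℝ} (hR : IsRiemannCoordinate U γ x₀ Φ h) (θ : ℝ) :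
    HasDerivAt h.symm (deriv h (h.symm θ))⁻¹ θ :=
  HasDerivAt.of_local_left_inverse h.symm.continuous.continuousAt
    (hR.contDiff.differentiable one_ne_zero _).hasDerivAt (hR.deriv_pos _).ne'
    (Eventually.of_forall h.apply_symm_apply)

/-- `(a h_α) ∘ h⁻¹ |Z'|²` is the derivative of the pressure in the direction `i Z'`. -/
lemma taylorCoeff_mul_eq {U : Set ℂ} {p : ℂ → ℝ} {γ : ℝ → ℂ} {α H : ℝ} {Z' : ℂ} (hH : 0 < H)
    (hγ : deriv γ α ≠ 0) (hZ' : Z' = H⁻¹ • deriv γ α) :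
    taylorCoeff U p γ α * H * ‖Z'‖ ^ 2
      = fderivWithin ℝ p (closure U) (γ α) (Complex.I * Z') := by
  have hn : ‖deriv γ α‖ ≠ 0 := by simpa using hγ
  -- The unit normal is a negative multiple of `i Z'`; the factors `H` and `‖γ'‖` then cancel
  -- against those in the coefficient and in `‖Z'‖²`.
  have e : -Complex.I * deriv γ α / (‖deriv γ α‖ : ℂ)
      = (-(H / ‖deriv γ α‖)) • (Complex.I * Z') := by
    have hnC : (‖deriv γ α‖ : ℂ) ≠ 0 := by exact_mod_cast hn
    have hHC : (H : ℂ) ≠ 0 := by exact_mod_cast hH.ne'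
    rw [hZ', Complex.real_smul, Complex.real_smul]
    push_cast
    field_simp
  rw [taylorCoeff, normalDeriv, e, map_smul, smul_eq_mul, hZ', norm_smul, norm_inv,
    Real.norm_of_nonneg hH.le]
  field_simp

lemma integral_cscKernel_pos {g : ℝ → ℂ} (hg : ContDiff ℝ 1 g)
    (hp : Function.Periodic g (2 * π)) (α : ℝ)
    (hinj : ∀ β ∈ Ioo 0 (2 * π), g (α + β) ≠ g α) :
    0 < ∫ β in (0 : ℝ)..(2 * π), cscKernel g α β := by
  rw [integral_cscKernel hp]
  refine intervalIntegral.intervalIntegral_pos_of_pos_on ?_ (fun β hβ => ?_) (by positivity)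
  · have := (intervalIntegrable_cscKernel hg hp α (α + 0) (α + 2 * π)).comp_add_left α
    simpa using this
  · have h1 : 0 < ‖g (α + β) - g α‖ := norm_pos_iff.2 (sub_ne_zero.2 (hinj β hβ))
    have h2 : 0 < Real.sin (β / 2) :=
      Real.sin_pos_of_pos_of_lt_pi (by linarith [hβ.1]) (by linarith [hβ.2])
    rw [cscKernel, add_sub_cancel_left]
    positivity

lemma integral_cscKernel_nonneg (g : ℝ → ℂ) (α : ℝ) :
    0 ≤ ∫ β in (0 : ℝ)..(2 * π), cscKernel g α β :=
  intervalIntegral.integral_nonneg (by positivity) fun β _ => cscKernel_nonneg g α β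

/-- The formula for `𝒜₁` in Riemann mapping coordinates. -/
theorem IsSolution.riemann_coordinate_formula (sol : IsSolution T Ω v P z) {t : ℝ}
    (ht : t ∈ Ico 0 T) (x₀ : ℂ) (Φ : ℂ → ℂ) (h : ℝ ≃ₜ ℝ)
    (hR : IsRiemannCoordinate (Ω t) (z t) x₀ Φ h) :
      let Z : ℝ → ℂ := fun α' => z t (h.symm α')
      let Zt : ℝ → ℂ := fun α' => derivWithin (fun s => z s (h.symm α')) (Ico 0 T) t
      let Zbar : ℝ → ℂ := fun α' => conj (Z α')
      let Ztbar : ℝ → ℂ := fun α' => conj (Zt α')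
      let A : ℝ → ℝ := fun α' =>
        taylorCoeff (Ω t) (P t) (z t) (h.symm α') * deriv h (h.symm α')
      let A₁ : ℝ → ℝ := fun α' => A α' * ‖deriv Z α'‖ ^ 2
      ContDiff ℝ 1 Z ∧ ContDiff ℝ 1 Zt ∧
      ∀ α' : ℝ,
        HilbertConverges (deriv Ztbar) α' ∧
        HilbertConverges (fun β' => Zt β' * deriv Ztbar β') α' ∧
        HilbertConverges (deriv Z) α' ∧
        HilbertConverges (fun β' => Zbar β' * deriv Z β') α' ∧
        A₁ α' = (hilbertComm Zt (deriv Ztbar) α').im + π * (hilbertComm Zbar (deriv Z) α').im ∧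
        IntervalIntegrable (cscKernel Z α') volume 0 (2 * π) ∧
        IntervalIntegrable (cscKernel Zt α') volume 0 (2 * π) ∧
        A₁ α' = 1 / 8 * (∫ β' in (0 : ℝ)..(2 * π), cscKernel Z α' β')
          + 1 / (8 * π) * (∫ β' in (0 : ℝ)..(2 * π), cscKernel Zt α' β') ∧
        0 < (∫ β' in (0 : ℝ)..(2 * π), cscKernel Z α' β') ∧
        0 ≤ (∫ β' in (0 : ℝ)..(2 * π), cscKernel Zt α' β') ∧
        0 < A₁ α' := by
  intro Z Zt Zbar Ztbar A A₁
  have hb := sol.boundary t ht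
  obtain ⟨Ψ, hΨ, hbd, hm, hm'⟩ := hR.exists_inverse hb
  have hZeq : Z = fun θ => Ψ (cis θ) := funext fun θ => (hbd θ).symm
  have hZteq : Zt = fun θ => v t (Ψ (cis θ)) := funext fun θ => by
    rw [hbd]; exact sol.lagrangian t ht _
  have hZ : ContDiff ℝ 1 Z :=
    (hb.contDiff.of_le (by norm_num)).comp hR.contDiff_symm
  have hZt : ContDiff ℝ 1 Zt := by
    have : Zt = fun θ => v t (Z θ) := by rw [hZteq, hZeq]
    rw [this, ← contDiffOn_univ]
    exact (sol.contDiffOn_v_slice ht).comp hZ.contDiffOn fun θ _ => hb.mem_closure _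
  have hZp : Function.Periodic Z (2 * π) := hZeq ▸ comp_cis_periodic Ψ
  have hZtp : Function.Periodic Zt (2 * π) := hZteq ▸ comp_cis_periodic fun ζ => v t (Ψ ζ)
  have hZbar : ContDiff ℝ 1 Zbar := Complex.conjCLE.contDiff.comp hZ
  have hZtbar : ContDiff ℝ 1 Ztbar := Complex.conjCLE.contDiff.comp hZt
  have hZbarp : Function.Periodic Zbar (2 * π) := fun θ => congrArg (starRingEnd ℂ) (hZp θ)
  refine ⟨hZ, hZt, fun α' => ?_⟩
  have hconj : (fun β => conj (Zbar β)) = Z := funext fun β => Complex.conj_conj _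
  have hcsc : cscKernel Zbar α' = cscKernel Z α' := by
    ext β
    rw [cscKernel, cscKernel, ← map_sub, RCLike.norm_conj]
  have c1 : HilbertConverges (deriv Ztbar) α' := by
    have hf := sol.diffContOnCl_conj_v_comp ht hΨ hm hm'
    have e : Ztbar = fun θ => (fun ζ => conj (v t (Ψ ζ))) (cis θ) :=
      funext fun θ => congrArg (starRingEnd ℂ) (congrFun hZteq θ)
    rw [e] at hZtbar ⊢
    exact hilbertConverges_deriv hf hZtbar α'
  have c3 : HilbertConverges (deriv Z) α' := by
    rw [hZeq] at hZ ⊢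
    exact hilbertConverges_deriv hΨ hZ α'
  obtain ⟨c2, e2⟩ := hilbertComm_deriv_conj hZt hZtp α' c1
  -- The same identity with `g = conj Z`: conjugating twice gives the derivative of `Z`, and the
  -- kernel sees only norms of differences.
  obtain ⟨c4, e4⟩ := hilbertComm_deriv_conj hZbar hZbarp α' (by rw [hconj]; exact c3)
  rw [hconj] at c4 e4
  rw [hcsc] at e4
  have hD := sol.fderivWithin_eq_integral ht hΨ hm hm'
    (fun θ => by rw [hbd]; exact hb.mem_frontier _) (hZeq ▸ hZ) (hZteq ▸ hZt) α'
  rw [← hZeq, ← hZteq, hbd] at hD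
  have hA : A₁ α' = 1 / 8 * (∫ β' in (0 : ℝ)..(2 * π), cscKernel Z α' β')
      + 1 / (8 * π) * (∫ β' in (0 : ℝ)..(2 * π), cscKernel Zt α' β') := by
    rw [← hD]
    refine taylorCoeff_mul_eq (hR.deriv_pos _) (hb.regular _) ?_
    have := (hb.contDiff.differentiable (by norm_num) (h.symm α')).hasDerivAt
    exact (this.scomp α' (hR.hasDerivAt_symm α')).deriv
  have hpos : 0 < ∫ β' in (0 : ℝ)..(2 * π), cscKernel Z α' β' := by
    -- Strict positivity rests on injectivity of the boundary curve, read off from `Φ (Z θ) = cis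
    -- θ`.
    refine integral_cscKernel_pos hZ hZp α' fun β hβ heq => ?_
    have hΦ : ∀ θ, Φ (Z θ) = cis θ := fun θ => by
      rw [← hR.exp_eq, h.apply_symm_apply, cis, mul_comm]
    have h1 : cis (α' + β) = cis α' := by rw [← hΦ, ← hΦ, heq]
    rw [cis_add] at h1
    have h2 : cis β = 1 := mul_left_cancel₀ (cis_ne_zero α') (by rw [h1, mul_one])
    have h3 := norm_cis_sub_one β
    rw [h2, sub_self, norm_zero] at h3
    have h4 : 0 < Real.sin (β / 2) :=
      Real.sin_pos_of_pos_of_lt_pi (by linarith [hβ.1]) (by linarith [hβ.2])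
    rw [abs_of_pos h4] at h3
    linarith
  have hnn := integral_cscKernel_nonneg Zt α'
  refine ⟨c1, c2, c3, c4, ?_, intervalIntegrable_cscKernel hZ hZp α' _ _,
    intervalIntegrable_cscKernel hZt hZtp α' _ _, hA, hpos, hnn, ?_⟩
  · rw [hA, e2, e4]
    have := Real.pi_ne_zero
    field_simp
    ring
  · rw [hA]
    positivity

end EulerPoisson

/-! ### Quantitative geometry of a simple regular `C²` curve. -/

namespace EulerPoisson

lemma IsBoundaryParam.ne_of_abs_lt {U : Set ℂ} {γ : ℝ → ℂ} (hb : IsBoundaryParam U γ) {α u : ℝ}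
    (hu : u ≠ 0) (hlt : |u| < 2 * π) : γ (α + u) ≠ γ α := by
  intro heq
  have h2pi : (0 : ℝ) < 2 * π := by positivity
  obtain ⟨m, hm, -⟩ := existsUnique_add_zsmul_mem_Ico h2pi (α + u) 0
  obtain ⟨n, hn, -⟩ := existsUnique_add_zsmul_mem_Ico h2pi α 0
  rw [zero_add] at hm hn
  have h1 : γ (α + u + m • (2 * π)) = γ (α + n • (2 * π)) := by
    rw [hb.periodic.zsmul m, hb.periodic.zsmul n, heq]
  have h2 := hb.injOn hm hn h1
  rw [zsmul_eq_mul, zsmul_eq_mul] at h2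
  have h3 : u = (n - m : ℤ) * (2 * π) := by push_cast; linarith
  have h4 : n - m ≠ 0 := fun h => hu (by rw [h3, h]; simp)
  have h5 : (1 : ℝ) ≤ |((n - m : ℤ) : ℝ)| := by exact_mod_cast Int.one_le_abs h4
  rw [h3, abs_mul, abs_of_pos h2pi] at hlt
  nlinarith

/-- The difference quotient, completed by the derivative at `u = 0`, is continuous and never zero on
`[-π, π]`: regularity handles `u = 0` and simplicity the other points. Its minimum is the constant.
-/
lemma IsBoundaryParam.exists_mul_abs_le {U : Set ℂ} {γ : ℝ → ℂ} (hb : IsBoundaryParam U γ)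
    (α : ℝ) : ∃ c > 0, ∀ u ∈ Icc (-π) π, c * |u| ≤ ‖γ (α + u) - γ α‖ := by
  have hpi := Real.pi_pos
  set f : ℝ → ℂ := fun u => γ (α + u) with hf
  have hfd : ∀ u, HasDerivAt f (deriv γ (α + u)) u := fun u =>
    ((hb.contDiff.differentiable (by norm_num) (α + u)).hasDerivAt).comp_const_add α u
  have hc : Continuous (dslope f 0) := by
    rw [continuous_iff_continuousAt]
    intro u
    by_cases hu : u = 0
    · rw [hu]
      exact continuousAt_dslope_same.2 (hfd 0).differentiableAt
    · exact (continuousAt_dslope_of_ne hu).2 (hfd u).continuousAt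
  obtain ⟨u₀, hu₀, hmin⟩ := isCompact_Icc.exists_isMinOn (nonempty_Icc.2 (by linarith : -π ≤ π))
    hc.norm.continuousOn
  have key : ∀ u, ‖f u - f 0‖ = |u| * ‖dslope f 0 u‖ := by
    intro u
    rw [← sub_smul_dslope, norm_smul, sub_zero, Real.norm_eq_abs]
  refine ⟨‖dslope f 0 u₀‖, ?_, fun u hu => ?_⟩
  · rw [gt_iff_lt, norm_pos_iff]
    by_cases h0 : u₀ = 0
    · rw [h0, dslope_same, (hfd 0).deriv]
      exact hb.regular _
    · intro hz
      have := key u₀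
      rw [hz, norm_zero, mul_zero, norm_eq_zero, sub_eq_zero] at this
      simp only [hf, add_zero] at this
      exact hb.ne_of_abs_lt h0 (by rw [abs_lt]; constructor <;> linarith [hu₀.1, hu₀.2]) this
  · have h1 := key u
    simp only [hf, add_zero] at h1
    rw [h1, mul_comm]
    exact mul_le_mul_of_nonneg_left (hmin hu) (abs_nonneg u)

/-- Taylor's estimate, with the bound global because the second derivative is periodic. It enters
both the tangent disc and the Cauchy kernel estimates. -/
lemma IsBoundaryParam.exists_norm_sub_sub_le {U : Set ℂ} {γ : ℝ → ℂ} (hb : IsBoundaryParam U γ)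
    (α : ℝ) : ∃ M > 0, ∀ u, ‖γ (α + u) - γ α - u * deriv γ α‖ ≤ M * u ^ 2 := by
  have hd1 : ContDiff ℝ 1 (deriv γ) := ((contDiff_succ_iff_deriv (n := 1)).1 hb.contDiff).2.2
  have hdp := deriv_periodic hb.periodic
  obtain ⟨M, hM0, hM⟩ := exists_norm_le_of_periodic (hd1.continuous_deriv le_rfl)
    (deriv_periodic hdp)
  have hlip : ∀ s, ‖deriv γ (α + s) - deriv γ α‖ ≤ M * |s| := by
    intro s
    have := convex_univ.norm_image_sub_le_of_norm_deriv_le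
      (fun x _ => hd1.differentiable one_ne_zero x) (fun x _ => hM x) (mem_univ α)
      (mem_univ (α + s))
    simpa using this
  refine ⟨M + 1, by linarith, fun u => ?_⟩
  have hg : ∀ s ∈ Icc (-|u|) |u|, HasDerivWithinAt
      (fun s : ℝ => γ (α + s) - s * deriv γ α) (deriv γ (α + s) - deriv γ α) (Icc (-|u|) |u|) s := by
    intro s _
    have h1 := ((hb.contDiff.differentiable (by norm_num) (α + s)).hasDerivAt).comp_const_add α s
    have h2 := (hasDerivAt_id s).ofReal_comp.mul_const (deriv γ α)
    have h3 := h1.sub h2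
    simp only [id, Complex.ofReal_one, one_mul] at h3
    exact h3.hasDerivWithinAt
  have hbound : ∀ s ∈ Icc (-|u|) |u|, ‖deriv γ (α + s) - deriv γ α‖ ≤ M * |u| := fun s hs =>
    (hlip s).trans (mul_le_mul_of_nonneg_left (abs_le.2 hs) hM0)
  have h := (convex_Icc (-|u|) |u|).norm_image_sub_le_of_norm_hasDerivWithin_le hg hbound
    (show (0 : ℝ) ∈ Icc (-|u|) |u| by constructor <;> simp)
    (show u ∈ Icc (-|u|) |u| from ⟨neg_abs_le u, le_abs_self u⟩)
  simp only [add_zero, Complex.ofReal_zero, zero_mul, sub_zero, Real.norm_eq_abs] at h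
  rw [show γ (α + u) - γ α - u * deriv γ α = γ (α + u) - u * deriv γ α - γ α by ring]
  refine h.trans ?_
  rw [mul_assoc, abs_mul_abs_self, ← sq]
  nlinarith [sq_nonneg u]

/-- The tangent discs of small radius do not meet the boundary curve. -/
lemma IsBoundaryParam.exists_disjoint_ball {U : Set ℂ} {γ : ℝ → ℂ} (hb : IsBoundaryParam U γ)
    (α : ℝ) {ν : ℂ} (hν : ‖ν‖ = 1) (hort : (conj ν * deriv γ α).re = 0) :
    ∃ ρ : ℝ, 0 < ρ ∧ ∀ β, ρ ≤ ‖γ β - (γ α + ρ * ν)‖ := by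
  obtain ⟨c, hc, hcle⟩ := hb.exists_mul_abs_le α
  obtain ⟨M, hM, hMle⟩ := hb.exists_norm_sub_sub_le α
  -- The radius is chosen so that `2ρM = c²`: the curve leaves its tangent by at most `M u²` but
  -- moves away from the point by at least `c|u|`, so `2ρ Re(conj ν d) ≤ ‖d‖²`, that is, `‖d - ρν‖ ≥
  -- ρ`.
  refine ⟨c ^ 2 / (2 * M), by positivity, fun β => ?_⟩
  set ρ := c ^ 2 / (2 * M) with hρ
  have hρ0 : 0 < ρ := by positivity
  obtain ⟨n, hn, -⟩ := existsUnique_add_zsmul_mem_Ioc (show (0 : ℝ) < 2 * π by positivity)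
    (β - α) (-π)
  set u := β - α + n • (2 * π) with hu
  have hβ : γ β = γ (α + u) := by
    rw [hu, ← add_assoc, add_sub_cancel, hb.periodic.zsmul n]
  have huI : u ∈ Icc (-π) π := ⟨hn.1.le, by linarith [hn.2]⟩
  have h1 := hcle u huI
  have h2 := hMle u
  rw [hβ]
  set d := γ (α + u) - γ α with hd
  have h3 : (conj ν * d).re ≤ M * u ^ 2 := by
    have e : (conj ν * d).re = (conj ν * (d - u * deriv γ α)).re := by
      have e2 : conj ν * (d - u * deriv γ α) = conj ν * d - u * (conj ν * deriv γ α) := by ring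
      rw [e2, Complex.sub_re, Complex.re_ofReal_mul, hort, mul_zero, sub_zero]
    rw [e]
    refine (Complex.re_le_norm _).trans ?_
    rw [norm_mul, RCLike.norm_conj, hν, one_mul]
    exact h2
  have h4 : ‖d - ρ * ν‖ ^ 2 = ‖d‖ ^ 2 - 2 * ρ * (conj ν * d).re + ρ ^ 2 := by
    have hν2 : ν.re ^ 2 + ν.im ^ 2 = 1 := by
      have := Complex.sq_norm ν
      rw [hν, Complex.normSq_apply] at this
      nlinarith
    rw [Complex.sq_norm, Complex.sq_norm, Complex.normSq_apply, Complex.normSq_apply]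
    simp
    linear_combination ρ ^ 2 * hν2
  have h5 : 2 * ρ * (conj ν * d).re ≤ ‖d‖ ^ 2 := by
    calc 2 * ρ * (conj ν * d).re ≤ 2 * ρ * (M * u ^ 2) := by gcongr
      _ = (c * |u|) ^ 2 := by
          rw [mul_pow, sq_abs, hρ]; field_simp
      _ ≤ ‖d‖ ^ 2 := by gcongr
  have h6 : γ (α + u) - (γ α + ρ * ν) = d - ρ * ν := by rw [hd]; ring
  rw [h6]
  refine abs_le_of_sq_le_sq' ?_ (norm_nonneg _) |>.2
  rw [h4]
  linarith

/-- Lower bound for the denominator of the difference of the Cauchy kernels on the two sides of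
the curve. -/
lemma IsBoundaryParam.exists_le_norm_sq_add {U : Set ℂ} {γ : ℝ → ℂ} (hb : IsBoundaryParam U γ)
    (α : ℝ) : ∃ c > 0, ∀ᶠ ε : ℝ in 𝓝[>] 0, ∀ u ∈ Icc (-π) π,
      c * (u ^ 2 + ε ^ 2) ≤ ‖(γ (α + u) - γ α) ^ 2 + ε ^ 2 * deriv γ α ^ 2‖ := by
  obtain ⟨c, hc, hcle⟩ := hb.exists_mul_abs_le α
  obtain ⟨M, hM, hMle⟩ := hb.exists_norm_sub_sub_le α
  have hpi := Real.pi_pos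
  have hT : 0 < ‖deriv γ α‖ := norm_pos_iff.2 (hb.regular α)
  set τ := ‖deriv γ α‖ with hτ
  -- For `|u| ≤ δ` the cubic Taylor error is at most half of the main term `τ²u²`. For `|u| > δ`,
  -- the bound `η` on `ε` makes `τε ≤ c|u|/2`, so the chord dominates.
  set δ := τ ^ 2 / (2 * (2 * τ * M + M ^ 2 * π)) with hδ
  have hδ0 : 0 < δ := by positivity
  set η := min δ (c * δ / (2 * τ)) with hη
  have hη0 : 0 < η := lt_min hδ0 (by positivity)
  refine ⟨min (τ ^ 2 / 2) (c ^ 2 / 4), by positivity, ?_⟩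
  filter_upwards [Ioo_mem_nhdsGT hη0] with ε hε u hu
  have hεδ : ε ≤ δ := hε.2.le.trans (min_le_left _ _)
  have hετ : τ * ε ≤ c * δ / 2 := by
    have h1 : ε ≤ c * δ / (2 * τ) := hε.2.le.trans (min_le_right _ _)
    calc τ * ε ≤ τ * (c * δ / (2 * τ)) := by gcongr
      _ = _ := by field_simp
  have hε0 := hε.1
  have hnormε : ‖(ε : ℂ) ^ 2 * deriv γ α ^ 2‖ = (τ * ε) ^ 2 := by
    rw [norm_mul, norm_pow, norm_pow, Complex.norm_real, Real.norm_of_nonneg hε0.le, ← hτ]; ring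
  have huπ : |u| ≤ π := abs_le.2 hu
  by_cases hnear : |u| ≤ δ
  · set E := γ (α + u) - γ α - u * deriv γ α with hE
    have hEle : ‖E‖ ≤ M * |u| ^ 2 := by rw [sq_abs]; exact hMle u
    have e : (γ (α + u) - γ α) ^ 2 + ε ^ 2 * deriv γ α ^ 2
        = ((u ^ 2 + ε ^ 2 : ℝ) : ℂ) * deriv γ α ^ 2 - (-(2 * u * deriv γ α * E + E ^ 2)) := by
      rw [hE]; push_cast; ring
    have h1 : ‖((u ^ 2 + ε ^ 2 : ℝ) : ℂ) * deriv γ α ^ 2‖ = (u ^ 2 + ε ^ 2) * τ ^ 2 := by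
      rw [norm_mul, Complex.norm_real, Real.norm_of_nonneg (by positivity), norm_pow]
    have h2 : ‖-(2 * u * deriv γ α * E + E ^ 2)‖ ≤ τ ^ 2 / 2 * u ^ 2 := by
      rw [norm_neg]
      refine (norm_add_le _ _).trans ?_
      rw [norm_mul, norm_mul, norm_mul, norm_pow, Complex.norm_real, Real.norm_eq_abs,
        Complex.norm_ofNat, ← hτ]
      have h3 : ‖E‖ ^ 2 ≤ M * |u| ^ 2 * (M * |u| ^ 2) := by
        rw [sq]; gcongr
      have h4 : M * |u| ^ 2 * (M * |u| ^ 2) ≤ M ^ 2 * π * |u| ^ 3 := by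
        calc M * |u| ^ 2 * (M * |u| ^ 2) = M ^ 2 * |u| ^ 3 * |u| := by ring
          _ ≤ M ^ 2 * |u| ^ 3 * π := by gcongr
          _ = _ := by ring
      have h5 : 2 * |u| * τ * ‖E‖ ≤ 2 * |u| * τ * (M * |u| ^ 2) := by gcongr
      calc 2 * |u| * τ * ‖E‖ + ‖E‖ ^ 2
          ≤ 2 * |u| * τ * (M * |u| ^ 2) + M ^ 2 * π * |u| ^ 3 := by linarith
        _ = (2 * τ * M + M ^ 2 * π) * |u| ^ 2 * |u| := by ring
        _ ≤ (2 * τ * M + M ^ 2 * π) * |u| ^ 2 * δ := by gcongr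
        _ = τ ^ 2 / 2 * |u| ^ 2 := by rw [hδ]; field_simp
        _ = τ ^ 2 / 2 * u ^ 2 := by rw [sq_abs]
    rw [e]
    refine le_trans ?_ (norm_sub_norm_le _ _)
    rw [h1]
    have h6 : min (τ ^ 2 / 2) (c ^ 2 / 4) * (u ^ 2 + ε ^ 2) ≤ τ ^ 2 / 2 * (u ^ 2 + ε ^ 2) := by
      gcongr; exact min_le_left _ _
    nlinarith [mul_nonneg (sq_nonneg τ) (sq_nonneg ε)]
  · have hfar : δ < |u| := not_le.1 hnear
    have h1 := hcle u hu
    have h2 : (c * |u|) ^ 2 ≤ ‖(γ (α + u) - γ α) ^ 2‖ := by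
      rw [norm_pow]; gcongr
    have h3 : (τ * ε) ^ 2 ≤ (c * |u| / 2) ^ 2 := by
      have : τ * ε ≤ c * |u| / 2 := hετ.trans (by gcongr)
      gcongr
    have h4 : ε ^ 2 ≤ |u| ^ 2 := by
      have : ε ≤ |u| := hεδ.trans hfar.le
      gcongr
    have h5 : min (τ ^ 2 / 2) (c ^ 2 / 4) * (u ^ 2 + ε ^ 2) ≤ c ^ 2 / 4 * (u ^ 2 + ε ^ 2) := by
      gcongr; exact min_le_right _ _
    have h6 := norm_sub_norm_le ((γ (α + u) - γ α) ^ 2) (-((ε : ℂ) ^ 2 * deriv γ α ^ 2))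
    rw [norm_neg, sub_neg_eq_add, hnormε] at h6
    refine le_trans ?_ h6
    have h7 : c ^ 2 * ε ^ 2 ≤ c ^ 2 * |u| ^ 2 := by gcongr
    rw [← sq_abs u] at h5 ⊢
    nlinarith [sq_nonneg (c * |u|)]

end EulerPoisson

/-! ### The jump of the winding number and the interior tangent disc. -/

namespace EulerPoisson

lemma integral_eq_integral_translate_of_periodic {g : ℝ → ℂ} (hg : Function.Periodic g (2 * π))
    (α : ℝ) : ∫ β in (0 : ℝ)..(2 * π), g β = ∫ u in (-π)..π, g (α + u) := by
  have h := hg.intervalIntegral_add_eq 0 (α - π)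
  rw [zero_add] at h
  rw [h, intervalIntegral.integral_comp_add_left]
  congr 1
  ring

/-- The winding number jumps by one across the curve. -/
lemma IsBoundaryParam.tendsto_windingNumber_sub {U : Set ℂ} {γ : ℝ → ℂ}
    (hb : IsBoundaryParam U γ) (α : ℝ) :
    Tendsto (fun ε : ℝ => windingNumber γ (γ α + ε * (Complex.I * deriv γ α))
      - windingNumber γ (γ α - ε * (Complex.I * deriv γ α))) (𝓝[>] 0) (𝓝 1) := by
  obtain ⟨c, hc, hcle⟩ := hb.exists_le_norm_sq_add α
  obtain ⟨C, hC0, hC⟩ := exists_norm_le_of_periodic hb.continuous_deriv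
    (deriv_periodic hb.periodic)
  have hpi := Real.pi_pos
  have hT := hb.regular α
  have hγc := hb.contDiff.continuous
  have hγ'c := hb.continuous_deriv
  set T := deriv γ α with hTdef
  -- `G` is the difference of the Cauchy kernels at the two points `γ α ± iεT`. Rescaling `u = εs`
  -- turns it into an approximation of `2i/(1 + s²)`, whose integral over the line is `2πi`.
  set G : ℝ → ℝ → ℂ := fun ε u => deriv γ (α + u) * (2 * Complex.I * ε * T)
    / ((γ (α + u) - γ α) ^ 2 + ε ^ 2 * T ^ 2) with hG
  have hGm : ∀ ε, Measurable (G ε) := fun ε => by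
    have m1 : Measurable fun u : ℝ => γ (α + u) := (hγc.comp (by fun_prop)).measurable
    have m2 : Measurable fun u : ℝ => deriv γ (α + u) := (hγ'c.comp (by fun_prop)).measurable
    exact (m2.mul_const _).div (((m1.sub_const _).pow_const 2).add_const _)
  have hlim : Tendsto (fun ε : ℝ => ∫ s : ℝ, (Ioc (-π / ε) (π / ε)).indicator
      (fun s => (ε : ℂ) * G ε (ε * s)) s) (𝓝[>] 0)
      (𝓝 (∫ s : ℝ, 2 * Complex.I * (((1 + s ^ 2)⁻¹ : ℝ) : ℂ))) := by
    refine tendsto_integral_filter_of_dominated_convergence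
      (fun s => 2 * C * ‖T‖ / c * (1 + s ^ 2)⁻¹) ?_ ?_ (integrable_inv_one_add_sq.const_mul _) ?_
    · refine Eventually.of_forall fun ε => Measurable.aestronglyMeasurable ?_
      exact Measurable.indicator (((hGm ε).comp (measurable_const_mul ε)).const_mul _)
        measurableSet_Ioc
    · filter_upwards [hcle, self_mem_nhdsWithin] with ε hε hε0
      have hε0' : 0 < ε := hε0
      refine Eventually.of_forall fun s => ?_
      by_cases hs : s ∈ Ioc (-π / ε) (π / ε)
      · rw [indicator_of_mem hs]
        have hu : ε * s ∈ Icc (-π) π := by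
          have h1 := (div_lt_iff₀ hε0').1 hs.1
          have h2 := (le_div_iff₀ hε0').1 hs.2
          constructor <;> linarith
        have h1 := hε _ hu
        have h2 := hC (α + ε * s)
        have h3 : 0 < c * ((ε * s) ^ 2 + ε ^ 2) := by positivity
        rw [norm_mul, hG, norm_div, norm_mul, norm_mul, norm_mul, norm_mul, Complex.norm_real,
          Real.norm_of_nonneg hε0'.le, Complex.norm_I, Complex.norm_ofNat]
        calc ε * (‖deriv γ (α + ε * s)‖ * (2 * 1 * ε * ‖T‖)
              / ‖(γ (α + ε * s) - γ α) ^ 2 + ε ^ 2 * T ^ 2‖)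
            ≤ ε * (C * (2 * 1 * ε * ‖T‖) / (c * ((ε * s) ^ 2 + ε ^ 2))) := by gcongr
          _ = 2 * C * ‖T‖ / c * (1 + s ^ 2)⁻¹ := by field_simp; ring
      · rw [indicator_of_notMem hs, norm_zero]
        positivity
    · refine Eventually.of_forall fun s => ?_
      have hslope : Tendsto (fun ε : ℝ => ε⁻¹ • (γ (α + ε * s) - γ α)) (𝓝[>] 0) (𝓝 (s * T)) := by
        have h1 : HasDerivAt (fun ε : ℝ => α + ε * s) s 0 := by
          simpa using ((hasDerivAt_id (0 : ℝ)).mul_const s).const_add α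
        have h2 : HasDerivAt γ T (α + 0 * s) := by
          rw [zero_mul, add_zero]
          exact (hb.contDiff.differentiable (by norm_num) α).hasDerivAt
        have h3 := (h2.scomp (0 : ℝ) h1).tendsto_slope_zero_right
        simpa using h3
      have hd : Tendsto (fun ε : ℝ => deriv γ (α + ε * s)) (𝓝[>] 0) (𝓝 T) := by
        have : Continuous fun ε : ℝ => deriv γ (α + ε * s) := by fun_prop
        have h := this.tendsto 0
        rw [zero_mul, add_zero] at h
        exact h.mono_left nhdsWithin_le_nhds
      have hne : (s * T) ^ 2 + T ^ 2 ≠ 0 := by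
        have : (s * T) ^ 2 + T ^ 2 = ((s ^ 2 + 1 : ℝ) : ℂ) * T ^ 2 := by push_cast; ring
        rw [this]
        refine mul_ne_zero ?_ (pow_ne_zero 2 hT)
        exact_mod_cast (by positivity : s ^ 2 + 1 ≠ 0)
      have h := (hd.mul_const (2 * Complex.I * T)).div ((hslope.pow 2).add_const (T ^ 2)) hne
      have e : T * (2 * Complex.I * T) / ((s * T) ^ 2 + T ^ 2)
          = 2 * Complex.I * (((1 + s ^ 2)⁻¹ : ℝ) : ℂ) := by
        have h1 : (1 + (s : ℂ) ^ 2) ≠ 0 := by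
          exact_mod_cast (by positivity : 1 + s ^ 2 ≠ 0)
        push_cast
        rw [div_eq_iff hne]
        field_simp
        ring
      rw [e] at h
      refine h.congr' ?_
      have hη : 0 < π / (|s| + 1) := by positivity
      filter_upwards [Ioo_mem_nhdsGT hη] with ε hε
      have hε0 := hε.1
      have h1 : ε * (|s| + 1) < π := (lt_div_iff₀ (by positivity)).1 hε.2
      have h2 : |s| < π / ε := by
        rw [lt_div_iff₀ hε0]; nlinarith
      have hs : s ∈ Ioc (-π / ε) (π / ε) := by
        rw [neg_div]
        exact ⟨(abs_lt.1 h2).1, (abs_lt.1 h2).2.le⟩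
      have hεC : (ε : ℂ) ≠ 0 := by exact_mod_cast hε0.ne'
      rw [indicator_of_mem hs, hG]
      simp only [Pi.div_apply, Complex.real_smul, Complex.ofReal_inv]
      have e2 : ((ε : ℂ)⁻¹ * (γ (α + ε * s) - γ α)) ^ 2 + T ^ 2
          = ((ε : ℂ) ^ 2)⁻¹ * ((γ (α + ε * s) - γ α) ^ 2 + ε ^ 2 * T ^ 2) := by
        field_simp
      rw [e2, div_eq_mul_inv, mul_inv, inv_inv, div_eq_mul_inv]
      ring
  have hval : ∫ s : ℝ, 2 * Complex.I * (((1 + s ^ 2)⁻¹ : ℝ) : ℂ) = 2 * π * Complex.I := by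
    have h : ∫ s : ℝ, (((1 + s ^ 2)⁻¹ : ℝ) : ℂ) = ((∫ s : ℝ, (1 + s ^ 2)⁻¹ : ℝ) : ℂ) :=
      integral_ofReal
    rw [integral_const_mul, h, integral_univ_inv_one_add_sq]
    ring
  rw [hval] at hlim
  have hpiC : (2 * π * Complex.I : ℂ) ≠ 0 := by simp [Real.pi_ne_zero]
  have hfin := hlim.const_mul (2 * π * Complex.I)⁻¹
  rw [inv_mul_cancel₀ hpiC] at hfin
  refine hfin.congr' ?_
  filter_upwards [hcle, self_mem_nhdsWithin] with ε hε hε0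
  have hε0' : 0 < ε := hε0
  have hper : ∀ w, Function.Periodic (fun β => deriv γ β / (γ β - w)) (2 * π) := fun w β => by
    beta_reduce
    rw [hb.periodic, deriv_periodic hb.periodic]
  rw [windingNumber, windingNumber, ← mul_sub, integral_eq_integral_translate_of_periodic (hper _) α,
    integral_eq_integral_translate_of_periodic (hper _) α]
  congr 1
  have hprod : ∀ u, (γ (α + u) - (γ α + ε * (Complex.I * T)))
      * (γ (α + u) - (γ α - ε * (Complex.I * T)))
      = (γ (α + u) - γ α) ^ 2 + ε ^ 2 * T ^ 2 := by
    intro u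
    linear_combination (-(ε : ℂ) ^ 2 * T ^ 2) * Complex.I_sq
  have hne : ∀ u ∈ Icc (-π) π, (γ (α + u) - (γ α + ε * (Complex.I * T)))
      * (γ (α + u) - (γ α - ε * (Complex.I * T))) ≠ 0 := by
    intro u hu
    rw [hprod, ← norm_pos_iff]
    exact lt_of_lt_of_le (by positivity) (hε u hu)
  have hle : -π ≤ π := by linarith
  have hint : ∀ w, (∀ u ∈ Icc (-π) π, γ (α + u) - w ≠ 0) →
      IntervalIntegrable (fun u => deriv γ (α + u) / (γ (α + u) - w)) volume (-π) π := by
    intro w hw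
    refine ContinuousOn.intervalIntegrable ?_
    rw [uIcc_of_le hle]
    exact ContinuousOn.div (by fun_prop) (by fun_prop) hw
  rw [← intervalIntegral.integral_sub (hint _ fun u hu => left_ne_zero_of_mul (hne u hu))
    (hint _ fun u hu => right_ne_zero_of_mul (hne u hu))]
  have e1 : ∫ u in (-π)..π, (deriv γ (α + u) / (γ (α + u) - (γ α + ε * (Complex.I * T)))
      - deriv γ (α + u) / (γ (α + u) - (γ α - ε * (Complex.I * T)))) = ∫ u in (-π)..π, G ε u := by
    refine intervalIntegral.integral_congr fun u hu => ?_
    rw [uIcc_of_le hle] at hu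
    rw [div_sub_div _ _ (left_ne_zero_of_mul (hne u hu)) (right_ne_zero_of_mul (hne u hu)), hprod]
    simp only [hG]
    congr 1
    ring
  have e2 := intervalIntegral.integral_comp_mul_left (G ε) (a := -π / ε) (b := π / ε) hε0'.ne'
  rw [mul_div_cancel₀ _ hε0'.ne', mul_div_cancel₀ _ hε0'.ne'] at e2
  have hεC : (ε : ℂ) ≠ 0 := by exact_mod_cast hε0'.ne'
  rw [e1, integral_indicator measurableSet_Ioc, integral_const_mul,
    ← intervalIntegral.integral_of_le (by gcongr), e2, Complex.real_smul, Complex.ofReal_inv,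
    mul_inv_cancel_left₀ hεC]

/-- The boundary has an interior tangent disc at each point. -/
lemma IsBoundaryParam.exists_interior_ball {U : Set ℂ} {γ : ℝ → ℂ}
    (hb : IsBoundaryParam U γ) (α : ℝ) :
    ∃ ρ : ℝ, 0 < ρ ∧
      Metric.ball (γ α + ρ * (Complex.I * deriv γ α / (‖deriv γ α‖ : ℂ))) ρ ⊆ U := by
  have hT : 0 < ‖deriv γ α‖ := norm_pos_iff.2 (hb.regular α)
  set T := deriv γ α with hTdef
  set ν : ℂ := Complex.I * T / (‖T‖ : ℂ) with hνdef
  have hTC : (‖T‖ : ℂ) ≠ 0 := by exact_mod_cast hT.ne'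
  have hν : ‖ν‖ = 1 := by
    rw [hνdef, norm_div, norm_mul, Complex.norm_I, one_mul, Complex.norm_real, norm_norm,
      div_self hT.ne']
  have hconjT : conj T * T = (‖T‖ : ℂ) ^ 2 := by
    rw [mul_comm, Complex.mul_conj, Complex.normSq_eq_norm_sq]; push_cast; rfl
  have hort : (conj ν * T).re = 0 := by
    have : conj ν * T = -(((‖T‖ : ℝ) : ℂ) * Complex.I) := by
      rw [hνdef, map_div₀, map_mul, Complex.conj_I, Complex.conj_ofReal, div_mul_eq_mul_div,
        div_eq_iff hTC]
      linear_combination (-Complex.I) * hconjT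
    rw [this]; simp
  have hITν : Complex.I * T = (‖T‖ : ℂ) * ν := by rw [hνdef]; field_simp
  have hort' : (conj (-ν) * T).re = 0 := by
    rw [map_neg, neg_mul, Complex.neg_re, hort, neg_zero]
  obtain ⟨ρ, hρ, hdisj⟩ := hb.exists_disjoint_ball α hν hort
  obtain ⟨ρ', hρ', hdisj'⟩ := hb.exists_disjoint_ball α (ν := -ν) (by rwa [norm_neg]) hort'
  refine ⟨ρ, hρ, ?_⟩
  -- points of the two tangent discs on the normal line
  have hnorm : ∀ {ε r : ℝ}, 0 < ε → 0 < r → ε * ‖T‖ < r →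
      ‖(ε : ℂ) * (‖T‖ : ℂ) - r‖ < r := by
    intro ε r hε hr h
    rw [← Complex.ofReal_mul, ← Complex.ofReal_sub, Complex.norm_real, Real.norm_eq_abs, abs_lt]
    constructor <;> nlinarith [mul_pos hε hT]
  have hplus : ∀ ε : ℝ, 0 < ε → ε * ‖T‖ < ρ →
      γ α + ε * (Complex.I * T) ∈ Metric.ball (γ α + ρ * ν) ρ := by
    intro ε hε h
    rw [Metric.mem_ball, dist_eq_norm, hITν]
    have e : γ α + ε * ((‖T‖ : ℂ) * ν) - (γ α + ρ * ν) = ((ε : ℂ) * (‖T‖ : ℂ) - ρ) * ν := by ring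
    rw [e, norm_mul, hν, mul_one]
    exact hnorm hε hρ h
  have hminus : ∀ ε : ℝ, 0 < ε → ε * ‖T‖ < ρ' →
      γ α - ε * (Complex.I * T) ∈ Metric.ball (γ α + ρ' * (-ν)) ρ' := by
    intro ε hε h
    rw [Metric.mem_ball, dist_eq_norm, hITν]
    have e : γ α - ε * ((‖T‖ : ℂ) * ν) - (γ α + ρ' * (-ν)) = -(((ε : ℂ) * (‖T‖ : ℂ) - ρ') * ν) := by
      ring
    rw [e, norm_neg, norm_mul, hν, mul_one]
    exact hnorm hε hρ' h
  have hwind : ∀ w, w ∉ frontier U →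
      (w ∈ U ∧ windingNumber γ w = 1) ∨ windingNumber γ w = 0 := by
    intro w hw
    by_cases hwU : w ∈ U
    · exact Or.inl ⟨hwU, hb.winding_inside w hwU⟩
    · refine Or.inr (hb.winding_outside w fun hcl => ?_)
      rw [closure_eq_self_union_frontier] at hcl
      exact hcl.elim hwU hw
  have hnf : ∀ {c w : ℂ} {r : ℝ}, (∀ β, r ≤ ‖γ β - c‖) → w ∈ Metric.ball c r →
      w ∉ frontier U := by
    intro c w r hr hw hf
    rw [← hb.range_eq] at hf
    obtain ⟨β, rfl⟩ := hf
    rw [Metric.mem_ball, dist_eq_norm] at hw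
    linarith [hr β]
  -- Off the curve winding numbers are `0` or `1`, so a difference within `1/2` of `1` forces the
  -- value `1` on the side of `iT`.
  have hJ := (hb.tendsto_windingNumber_sub α).eventually
    (Metric.ball_mem_nhds (1 : ℂ) (show (0 : ℝ) < 1 / 2 by norm_num))
  have hη : 0 < min ρ ρ' / ‖T‖ := div_pos (lt_min hρ hρ') hT
  obtain ⟨ε, hεJ, hε⟩ := (hJ.and (Ioo_mem_nhdsGT hη)).exists
  have hε1 : ε * ‖T‖ < min ρ ρ' := (lt_div_iff₀ hT).1 hε.2
  have hp := hplus ε hε.1 (hε1.trans_le (min_le_left _ _))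
  have hm := hminus ε hε.1 (hε1.trans_le (min_le_right _ _))
  have hmem : γ α + ε * (Complex.I * T) ∈ U := by
    rcases hwind _ (hnf hdisj hp) with h | h
    · exact h.1
    · exfalso
      rw [h] at hεJ
      rcases hwind _ (hnf hdisj' hm) with h' | h'
      · rw [h'.2, dist_eq_norm] at hεJ
        norm_num at hεJ
      · rw [h', dist_eq_norm] at hεJ
        norm_num at hεJ
  -- The disc is connected and misses the frontier, so a single point in `U` places all of it there.
  refine (convex_ball (γ α + ρ * ν) ρ).isPreconnected.subset_left_of_subset_union hb.isOpen
    isClosed_closure.isOpen_compl (disjoint_compl_right_iff_subset.2 subset_closure) ?_ ⟨_, hp, hmem⟩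
  intro w hw
  by_cases hwU : w ∈ U
  · exact Or.inl hwU
  · refine Or.inr fun hcl => ?_
    rw [closure_eq_self_union_frontier] at hcl
    exact hcl.elim hwU (hnf hdisj hw)

end EulerPoisson

/-! ### Minimum principle and Hopf lemma for the pressure. -/

namespace EulerPoisson

variable {T : ℝ} {Ω : ℝ → Set ℂ} {v : ℝ → ℂ → ℂ} {P : ℝ → ℂ → ℝ} {z : ℝ → ℝ → ℂ}

/-- The pressure, even after adding a small paraboloid, has no interior local minimum. -/
lemma IsSolution.not_isLocalMin (sol : IsSolution T Ω v P z) {t : ℝ} (ht : t ∈ Ico 0 T) {x : ℂ}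
    (hx : x ∈ Ω t) (c : ℂ) {κ : ℝ} (hκ : κ < π / 2) :
    ¬ IsLocalMin (fun y => P t y + κ * ‖y - c‖ ^ 2) x := by
  intro hmin
  obtain ⟨r, hr, hball⟩ := Metric.isOpen_iff.1 (sol.boundary t ht).isOpen x hx
  obtain ⟨L, hL, hLeq⟩ := sol.exists_re_eq ht hball (conj (v t x)) x
  -- Expanding `κ‖y - c‖²` about `x` gives a harmonic linear term, absorbed in `H`, and `κ‖y - x‖²`,
  -- beaten by the `(π/2)‖y - x‖²` in `L`. A local minimum would thus be a strict minimum of the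
  -- harmonic function `Re H`.
  set H : ℂ → ℂ := fun y => L y + 2 * κ * (conj (x - c) * (y - x)) with hH
  have hHd : DifferentiableOn ℂ H (Metric.ball x r) := hL.add (by fun_prop)
  have hLx : P t x = (L x).re := by
    simpa using hLeq x (Metric.mem_ball_self hr)
  have hHx : (H x).re = P t x := by simp [hH, hLx]
  have hsq : ∀ y, ‖y - c‖ ^ 2
      = ‖y - x‖ ^ 2 + 2 * (conj (x - c) * (y - x)).re + ‖x - c‖ ^ 2 := by
    intro y
    simp only [← Complex.normSq_eq_norm_sq, Complex.normSq_apply, Complex.mul_re, Complex.conj_re,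
      Complex.conj_im, Complex.sub_re, Complex.sub_im]
    ring
  have hge : ∀ᶠ y in 𝓝 x, (H x).re + (π / 2 - κ) * ‖y - x‖ ^ 2 ≤ (H y).re := by
    filter_upwards [hmin, Metric.ball_mem_nhds x hr] with y hy hyr
    have h1 := hLeq y hyr
    have h2 : (H y).re = (L y).re + 2 * κ * (conj (x - c) * (y - x)).re := by
      have : (2 * κ * (conj (x - c) * (y - x)) : ℂ)
          = ((2 * κ : ℝ) : ℂ) * (conj (x - c) * (y - x)) := by push_cast; ring
      rw [hH, Complex.add_re, this, Complex.re_ofReal_mul]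
    rw [hHx, h2, ← h1]
    rw [hsq y] at hy
    nlinarith [sq_nonneg ‖conj (v t y) - conj (v t x)‖]
  have hnorm : ∀ y, ‖Complex.exp (-H y)‖ = Real.exp (-(H y).re) := fun y => by
    rw [Complex.norm_exp, Complex.neg_re]
  have hκ' : 0 < π / 2 - κ := by linarith
  -- Exponentiating turns the minimum of `Re H` into a maximum of the modulus of a holomorphic
  -- function, and the maximum principle makes that function locally constant, against strictness.
  have hmax : IsLocalMax (norm ∘ fun y => Complex.exp (-H y)) x := by
    filter_upwards [hge] with y hy
    simp only [Function.comp_apply, hnorm]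
    rw [Real.exp_le_exp]
    nlinarith [mul_nonneg hκ'.le (sq_nonneg ‖y - x‖)]
  have hd : ∀ᶠ y in 𝓝 x, DifferentiableAt ℂ (fun y => Complex.exp (-H y)) y := by
    filter_upwards [Metric.isOpen_ball.mem_nhds (Metric.mem_ball_self hr)] with y hy
    exact (hHd.differentiableAt (Metric.isOpen_ball.mem_nhds hy)).neg.cexp
  have hconst := Complex.eventually_eq_of_isLocalMax_norm hd hmax
  have hEq : ∀ᶠ y in 𝓝 x, y = x := by
    filter_upwards [hconst, hge] with y hy hy'
    have h1 := congrArg norm hy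
    rw [hnorm, hnorm, Real.exp_eq_exp] at h1
    have h2 : ‖y - x‖ ^ 2 ≤ 0 := by
      by_contra! h3
      nlinarith [mul_pos hκ' h3]
    have h3 : ‖y - x‖ = 0 := pow_eq_zero_iff two_ne_zero |>.1 (le_antisymm h2 (sq_nonneg _))
    exact sub_eq_zero.1 (norm_eq_zero.1 h3)
  obtain ⟨y, hy, hne⟩ := ((hEq.filter_mono nhdsWithin_le_nhds).and
    (self_mem_nhdsWithin : {x}ᶜ ∈ 𝓝[≠] x)).exists
  exact hne hy

lemma IsSolution.pressure_nonneg (sol : IsSolution T Ω v P z) {t : ℝ} (ht : t ∈ Ico 0 T) {x : ℂ}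
    (hx : x ∈ closure (Ω t)) : 0 ≤ P t x := by
  have hb := sol.boundary t ht
  obtain ⟨m, hm, hmin⟩ := hb.isCompact_closure.exists_isMinOn ⟨x, hx⟩
    (sol.contDiffOn_P t ht).continuousOn
  refine le_trans ?_ (hmin hx)
  by_cases hmU : m ∈ Ω t
  · refine absurd ?_ (sol.not_isLocalMin ht hmU 0 (κ := 0) (by positivity))
    simp only [zero_mul, add_zero]
    exact hmin.isLocalMin (mem_of_superset (hb.isOpen.mem_nhds hmU) subset_closure)
  · rw [closure_eq_self_union_frontier] at hm
    exact (sol.pressure_boundary t ht m (hm.resolve_left hmU)).ge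

/-- Comparison with a paraboloid on a disc inside the fluid. -/
lemma IsSolution.le_pressure_of_ball_subset (sol : IsSolution T Ω v P z) {t : ℝ}
    (ht : t ∈ Ico 0 T) {c : ℂ} {ρ : ℝ} (hρ : 0 < ρ) (hball : Metric.ball c ρ ⊆ Ω t) {x : ℂ}
    (hx : x ∈ Metric.closedBall c ρ) : π / 4 * (ρ ^ 2 - ‖x - c‖ ^ 2) ≤ P t x := by
  have hsub : Metric.closedBall c ρ ⊆ closure (Ω t) := by
    rw [← closure_ball c hρ.ne']
    exact closure_mono hball
  have hcont : ContinuousOn (fun y => P t y + π / 4 * ‖y - c‖ ^ 2) (Metric.closedBall c ρ) :=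
    ((sol.contDiffOn_P t ht).continuousOn.mono hsub).add (by fun_prop)
  obtain ⟨m, hm, hmin⟩ := (isCompact_closedBall c ρ).exists_isMinOn ⟨x, hx⟩ hcont
  have h1 : P t m + π / 4 * ‖m - c‖ ^ 2 ≤ P t x + π / 4 * ‖x - c‖ ^ 2 := hmin hx
  by_cases hmb : m ∈ Metric.ball c ρ
  · refine absurd ?_ (sol.not_isLocalMin ht (hball hmb) c (κ := π / 4)
      (by linarith [Real.pi_pos]))
    exact hmin.isLocalMin (mem_of_superset (Metric.isOpen_ball.mem_nhds hmb)
      Metric.ball_subset_closedBall)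
  · have h2 : ‖m - c‖ = ρ := by
      rw [Metric.mem_closedBall, dist_eq_norm] at hm
      rw [Metric.mem_ball, dist_eq_norm, not_lt] at hmb
      exact le_antisymm hm hmb
    have h3 := sol.pressure_nonneg ht (hsub hm)
    rw [h2] at h1
    linarith

/-- The Taylor sign condition: a Hopf type boundary point lemma for the pressure. -/
lemma IsSolution.normalDeriv_neg (sol : IsSolution T Ω v P z) {t : ℝ} (ht : t ∈ Ico 0 T) (α : ℝ) :
    normalDeriv (Ω t) (P t) (z t) α < 0 := by
  have hb := sol.boundary t ht
  obtain ⟨ρ, hρ, hball⟩ := hb.exists_interior_ball α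
  set ν : ℂ := Complex.I * deriv (z t) α / (‖deriv (z t) α‖ : ℂ) with hν
  have hT : ‖deriv (z t) α‖ ≠ 0 := norm_ne_zero_iff.2 (hb.regular α)
  have hν1 : ‖ν‖ = 1 := by
    rw [hν, norm_div, norm_mul, Complex.norm_I, one_mul, Complex.norm_real, norm_norm, div_self hT]
  set D := fderivWithin ℝ (P t) (closure (Ω t)) (z t α) with hD
  have hDP : HasFDerivWithinAt (P t) D (closure (Ω t)) (z t α) :=
    ((sol.contDiffOn_P t ht).differentiableOn (by norm_num) _
      (hb.mem_closure α)).hasFDerivWithinAt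
  have hline : ∀ s ∈ Icc (0 : ℝ) ρ,
      ‖z t α + s * ν - (z t α + ρ * ν)‖ = ρ - s := by
    intro s hs
    have e : z t α + s * ν - (z t α + ρ * ν) = ((s - ρ : ℝ) : ℂ) * ν := by push_cast; ring
    rw [e, norm_mul, hν1, mul_one, Complex.norm_real, Real.norm_eq_abs, abs_sub_comm,
      abs_of_nonneg (by linarith [hs.2])]
  have hmem : ∀ s ∈ Icc (0 : ℝ) ρ,
      z t α + s * ν ∈ Metric.closedBall (z t α + ρ * ν) ρ := by
    intro s hs
    rw [Metric.mem_closedBall, dist_eq_norm, hline s hs]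
    linarith [hs.1]
  have hcl : ∀ s ∈ Icc (0 : ℝ) ρ, z t α + s * ν ∈ closure (Ω t) := by
    intro s hs
    have h := hmem s hs
    rw [← closure_ball _ hρ.ne'] at h
    exact closure_mono hball h
  have hlineD : HasDerivWithinAt (fun s : ℝ => z t α + s * ν) ν (Icc 0 ρ) 0 := by
    have h := ((Complex.ofRealCLM.hasDerivAt (x := (0 : ℝ))).mul_const ν).const_add (z t α)
    simpa using h.hasDerivWithinAt
  have hz0 : z t α + ((0 : ℝ) : ℂ) * ν = z t α := by simp
  have hder : HasDerivWithinAt (fun s : ℝ => P t (z t α + s * ν)) (D ν) (Icc 0 ρ) 0 :=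
    HasFDerivWithinAt.comp_hasDerivWithinAt (0 : ℝ) (by rwa [hz0]) hlineD hcl
  have hP0 : P t (z t α) = 0 := sol.pressure_boundary t ht _ (hb.mem_frontier α)
  have hset : Ioc 0 ρ \ {0} = Ioc (0 : ℝ) ρ := by
    ext s; simp only [Set.mem_sdiff, mem_Ioc, mem_singleton_iff]
    exact ⟨fun h => h.1, fun h => ⟨h, h.1.ne'⟩⟩
  have hslope' : Tendsto (slope (fun s : ℝ => P t (z t α + s * ν)) 0) (𝓝[>] 0) (𝓝 (D ν)) := by
    have := hasDerivWithinAt_iff_tendsto_slope.1 (hder.mono Ioc_subset_Icc_self)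
    rwa [hset, nhdsWithin_Ioc_eq_nhdsGT hρ] at this
  -- At distance `s` inside along the normal the paraboloid equals `(π/4)(ρ² - (ρ - s)²) = (π/4)s(2ρ
  -- - s)`, so the inward derivative of the pressure is at least `πρ/2`.
  have hlow : Tendsto (fun s : ℝ => π / 4 * (2 * ρ - s)) (𝓝[>] 0) (𝓝 (π / 4 * (2 * ρ - 0))) :=
    (Continuous.tendsto (by fun_prop) 0).mono_left nhdsWithin_le_nhds
  have hle : π / 4 * (2 * ρ - 0) ≤ D ν := by
    refine le_of_tendsto_of_tendsto hlow hslope' ?_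
    filter_upwards [Ioc_mem_nhdsGT hρ] with s hs
    have hs' := Ioc_subset_Icc_self hs
    have h := sol.le_pressure_of_ball_subset ht hρ hball (hmem s hs')
    rw [hline s hs'] at h
    rw [slope_def_field, hz0, hP0, sub_zero, sub_zero, le_div_iff₀ hs.1]
    linarith
  have hpos : 0 < D ν := lt_of_lt_of_le (by rw [sub_zero]; positivity) hle
  have hneg : -Complex.I * deriv (z t) α / (‖deriv (z t) α‖ : ℂ) = -ν := by rw [hν]; ring
  rw [normalDeriv, hneg, map_neg]
  linarith

end EulerPoisson

theorem mainTheorem6 (T : ℝ) (Ω : ℝ → Set ℂ) (v : ℝ → ℂ → ℂ) (P : ℝ → ℂ → ℝ) (z : ℝ → ℝ → ℂ)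
    (sol : IsSolution T Ω v P z) :
    -- in Riemann mapping coordinates
    (∀ t ∈ Ico 0 T, ∀ (x₀ : ℂ) (Φ : ℂ → ℂ) (h : ℝ ≃ₜ ℝ),
      IsRiemannCoordinate (Ω t) (z t) x₀ Φ h →
      let Z : ℝ → ℂ := fun α' => z t (h.symm α')
      let Zt : ℝ → ℂ := fun α' => derivWithin (fun s => z s (h.symm α')) (Ico 0 T) t
      let Zbar : ℝ → ℂ := fun α' => conj (Z α')
      let Ztbar : ℝ → ℂ := fun α' => conj (Zt α')
      let A : ℝ → ℝ := fun α' =>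
        taylorCoeff (Ω t) (P t) (z t) (h.symm α') * deriv h (h.symm α')
      let A₁ : ℝ → ℝ := fun α' => A α' * ‖deriv Z α'‖ ^ 2
      ContDiff ℝ 1 Z ∧ ContDiff ℝ 1 Zt ∧
      ∀ α' : ℝ,
        -- the four principal values converge
        HilbertConverges (deriv Ztbar) α' ∧
        HilbertConverges (fun β' => Zt β' * deriv Ztbar β') α' ∧
        HilbertConverges (deriv Z) α' ∧
        HilbertConverges (fun β' => Zbar β' * deriv Z β') α' ∧
        A₁ α' = (hilbertComm Zt (deriv Ztbar) α').im + π * (hilbertComm Zbar (deriv Z) α').im ∧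
        -- the two integrals
        IntervalIntegrable (cscKernel Z α') volume 0 (2 * π) ∧
        IntervalIntegrable (cscKernel Zt α') volume 0 (2 * π) ∧
        A₁ α' = 1 / 8 * (∫ β' in (0 : ℝ)..(2 * π), cscKernel Z α' β')
          + 1 / (8 * π) * (∫ β' in (0 : ℝ)..(2 * π), cscKernel Zt α' β') ∧
        0 < (∫ β' in (0 : ℝ)..(2 * π), cscKernel Z α' β') ∧
        0 ≤ (∫ β' in (0 : ℝ)..(2 * π), cscKernel Zt α' β') ∧
        0 < A₁ α') ∧
    -- the Taylor sign condition, at all times and all boundary points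
    (∀ t ∈ Ico 0 T, ∀ α : ℝ,
      0 < taylorCoeff (Ω t) (P t) (z t) α ∧ normalDeriv (Ω t) (P t) (z t) α < 0) := by
  refine ⟨fun t ht x₀ Φ h hR => sol.riemann_coordinate_formula ht x₀ Φ h hR, fun t ht α => ?_⟩
  have hneg := sol.normalDeriv_neg ht α
  refine ⟨?_, hneg⟩
  have hT : 0 < ‖deriv (z t) α‖ := norm_pos_iff.2 ((sol.boundary t ht).regular α)
  rw [taylorCoeff, neg_mul, neg_pos]
  exact mul_neg_of_pos_of_neg (by positivity) hneg
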